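/- Let $\Bbbk$ be a field of characteristic zero. All cochain complexes and graded objects are concentrated in degrees $n\ge 0$ and cohomologically graded. Let $\mathsf{cdga}$ (resp. $\mathsf{cga}$) be the category of unital commutative dg $\Bbbk$-algebras (resp. unital graded commutative $\Bbbk$-algebras). Let $\Delta_+\subseteq\Delta$ be the wide subcategory of the maps $\alpha$ with $\alpha(0)=0$. For a category $\mathcal C$ write $c\,\mathcal C$ for the functors $\Delta\to\mathcal C$ (cosimplicial objects) and $c^+\mathcal C$ for the functors $\Delta_+\to\mathcal C$ (almost cosimplicial objects; these have all structure maps except the zeroth cofaces $d^0$). In particular $c\mathsf{Com}$, $c^+\mathsf{Com}$ are the categories of (almost) cosimplicial commutative $\Bbbk$-algebras and $c\mathsf{Vect}$, $c^+\mathsf{Vect}$ those of (almost) cosimplicial vector spaces. Let $U^\bullet_{+}\colon c\mathsf{Com}\to c^+\mathsf{Com}$ be restriction to $\Delta_+$ and $U^*_{+}\colon\mathsf{cdga}\to\mathsf{cga}$ the functor forgetting the differential. Normalized cochains $N\colon c\mathsf{Vect}\to \mathrm{Ch}^{*\ge 0}$ are $N^0(V)=V^0$, $N^n(V)=\bigcap_{i=0}^{n-1}\ker(s^i\colon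 V^n\to V^{n-1})$ for $n\geq 1$, with differential $\sum_{i=0}^{n+1}(-1)^{n+1+i}d^i\colon N^n(V)\to N^{n+1}(V)$; $N_+\colon c^+\mathsf{Vect}\to\mathsf{grVect}$ is given by the same graded vector spaces. $\mathrm{Sym}^\bullet$, $\mathrm{Sym}^\bullet_+$, $\mathrm{Sym}^*$, $\mathrm{Sym}^*_+$ denote the free commutative algebra functors $c\mathsf{Vect}\to c\mathsf{Com}$, $c^+\mathsf{Vect}\to c^+\mathsf{Com}$, $\mathrm{Ch}^{*\ge0}\to\mathsf{cdga}$, $\mathsf{grVect}\to\mathsf{cga}$. Let $\Lambda^n=\Bbbk[e_0,\dots,e_n]$ be the free graded commutative algebra on generators of degree $-1$, with the derivation $e_i\mapsto 1$ as differential; with $e_i\mapsto e_{\alpha(i)}$ this is a cosimplicial commutative dg algebra $\Lambda^\bullet$. The functor $K_{\mathrm{alg}}\colon\mathsf{cdga}\to c\mathsf{Com}$ is $K_{\mathrm{alg}}(C)=Z^0(C\otimes\Lambda^\bullet)$ (degree $0$ cocycles), and $K_{\mathrm{alg}^+}\colon\mathsf{cga}\to c^+\mathsf{Com}$ sends $C$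 to $U^\bullet_+K_{\mathrm{alg}}(C,0)$, where $C$ is regarded as a cdga with zero differential. Theorem. The functors $K_{\mathrm{alg}}$ and $K_{\mathrm{alg}^+}$ admit left adjoints $D^*\colon c\mathsf{Com}\to\mathsf{cdga}$ and $D^*_+\colon c^+\mathsf{Com}\to\mathsf{cga}$ such that: 1. There are isomorphisms $D^*(\mathrm{Sym}^\bullet(V))\cong\mathrm{Sym}^*(N(V))$ and $D^*_+(\mathrm{Sym}^\bullet_+(W))\cong\mathrm{Sym}^*_+(N_+(W))$, natural in $V\in c\mathsf{Vect}$ and $W\in c^+\mathsf{Vect}$. 2. There is a natural isomorphism of functors $U^*_+D^*\cong D^*_+U^\bullet_+\colon c\mathsf{Com}\to\mathsf{cga}$. 3. The counits $D^*K_{\mathrm{alg}}\to\mathrm{id}_{\mathsf{cdga}}$ and $D^*_+K_{\mathrm{alg}^+}\to\mathrm{id}_{\mathsf{cga}}$ are isomorphisms. -/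

import Mathlib

open CategoryTheory
open scoped DirectSum TensorProduct

universe u

noncomputable section

namespace DoldKan

variable (k : Type u) [Field k]

/-! ## Graded commutative algebras and commutative dg algebras -/

/-- A unital graded commutative `k`-algebra `A = ⨁_{n ≥ 0} A^n`. (When `2` is invertible in `k`
the condition below forces the square of an element of odd degree to vanish.) -/
structure CGA where
  carrier : Type u
  [ring : Ring carrier]
  [algebra : Algebra k carrier]
  grading : ℕ → Submodule k carrier
  [gradedAlgebra : GradedAlgebra grading]
  graded_comm : ∀ {i j : ℕ} {x y : carrier}, x ∈ grading i → y ∈ grading j →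
    x * y = (-1 : k) ^ (i * j) • (y * x)

attribute [instance] CGA.ring CGA.algebra CGA.gradedAlgebra

/-- A commutative dg algebra, cohomologically graded and concentrated in degrees `≥ 0`. -/
structure CDGA extends CGA k where
  d : carrier →ₗ[k] carrier
  d_mem : ∀ {i : ℕ} {x : carrier}, x ∈ grading i → d x ∈ grading (i + 1)
  d_d : ∀ x : carrier, d (d x) = 0
  leibniz : ∀ {i : ℕ} {x : carrier} (y : carrier), x ∈ grading i →
    d (x * y) = d x * y + (-1 : k) ^ i • (x * d y)

variable {k}

/-- Morphisms of graded commutative algebras: unital algebra maps preserving degrees. -/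
@[ext]
structure CGA.Hom (A B : CGA k) where
  toAlgHom : A.carrier →ₐ[k] B.carrier
  map_mem : ∀ {i : ℕ} {x : A.carrier}, x ∈ A.grading i → toAlgHom x ∈ B.grading i

/-- Morphisms of cdgas: degree-preserving unital algebra maps commuting with differentials. -/
@[ext]
structure CDGA.Hom (A B : CDGA k) extends CGA.Hom A.toCGA B.toCGA where
  map_d : ∀ x : A.carrier, toAlgHom (A.d x) = B.d (toAlgHom x)

instance : Category (CGA k) where
  Hom A B := CGA.Hom A B
  id A := ⟨AlgHom.id k _, fun h => h⟩
  comp f g := ⟨g.toAlgHom.comp f.toAlgHom, fun h => g.map_mem (f.map_mem h)⟩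

instance : Category (CDGA k) where
  Hom A B := CDGA.Hom A B
  id A := ⟨⟨AlgHom.id k _, fun h => h⟩, fun _ => rfl⟩
  comp f g := ⟨⟨g.toAlgHom.comp f.toAlgHom, fun h => g.map_mem (f.map_mem h)⟩, fun x => by
    simp [f.map_d, g.map_d]⟩

variable (k)

/-- The functor `cdga ⥤ cga` forgetting the differential. -/
def forgetDiff : CDGA k ⥤ CGA k where
  obj A := A.toCGA
  map f := f.toHom

/-- A graded commutative algebra regarded as a cdga with zero differential. -/
def zeroDiff : CGA k ⥤ CDGA k where
  obj A :=
    { toCGA := A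
      d := 0
      d_mem := fun _ => Submodule.zero_mem _
      d_d := fun _ => rfl
      leibniz := fun _ _ => by simp }
  map {A B} f := ⟨f, fun _ => map_zero f.toAlgHom⟩

/-- The underlying graded vector space of a graded commutative algebra. -/
def forgetCGA : CGA k ⥤ GradedObject ℕ (ModuleCat.{u} k) where
  obj A := fun n => ModuleCat.of k (A.grading n)
  map {A B} f := fun n => ModuleCat.ofHom
    (f.toAlgHom.toLinearMap.restrict (p := A.grading n) (q := B.grading n)
      (fun _ h => f.map_mem h))

/-- The underlying cochain complex of a cdga. -/
def forgetCDGA : CDGA k ⥤ CochainComplex (ModuleCat.{u} k) ℕ where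
  obj A := CochainComplex.of (fun n => ModuleCat.of k (A.grading n))
    (fun n => ModuleCat.ofHom
      (A.d.restrict (p := A.grading n) (q := A.grading (n + 1)) (fun _ h => A.d_mem h)))
    (fun n => by
      apply ModuleCat.hom_ext
      exact LinearMap.ext fun x => Subtype.ext (A.d_d x.1))
  map {A B} f := CochainComplex.ofHom
    (fun n => ModuleCat.ofHom
      (f.toAlgHom.toLinearMap.restrict (p := A.grading n) (q := B.grading n)
        (fun _ h => f.map_mem h)))
    (fun n => by
      simp only [CochainComplex.of_d]
      apply ModuleCat.hom_ext
      exact LinearMap.ext fun x => Subtype.ext (f.map_d x.1).symm)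
  map_id A := by ext; rfl
  map_comp f g := by ext; rfl

lemma forgetCDGA_d (B : CDGA k) (i : ℕ) : ((forgetCDGA k).obj B).d i (i + 1) = ModuleCat.ofHom
    (B.d.restrict (p := B.grading i) (q := B.grading (i + 1)) (fun _ h => B.d_mem h)) := by
  simp only [forgetCDGA, CochainComplex.of_d]

variable {k}

/-! ## Free graded commutative algebras -/

section FreeCGA

variable (V : GradedObject ℕ (ModuleCat.{u} k))

/-- The relations `x y = (-1)^{ij} y x` for `x ∈ V^i`, `y ∈ V^j`. -/
inductive GSymRel : TensorAlgebra k (⨁ n, V n) → TensorAlgebra k (⨁ n, V n) → Prop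
  | comm (i j : ℕ) (x : V i) (y : V j) : GSymRel
      (TensorAlgebra.ι k (DirectSum.lof k ℕ (fun n => V n) i x) *
        TensorAlgebra.ι k (DirectSum.lof k ℕ (fun n => V n) j y))
      ((-1 : k) ^ (i * j) • (TensorAlgebra.ι k (DirectSum.lof k ℕ (fun n => V n) j y) *
        TensorAlgebra.ι k (DirectSum.lof k ℕ (fun n => V n) i x)))

/-- The underlying algebra of the free graded commutative algebra on `V`: the tensor algebra
of `⨁ V^n` modulo graded commutativity. -/
abbrev GSym : Type u := RingQuot (GSymRel V)

/-- The inclusion of generators `V^i → Sym(V)`. -/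
def GSym.gen (i : ℕ) : V i →ₗ[k] GSym V :=
  (RingQuot.mkAlgHom k (GSymRel V)).toLinearMap ∘ₗ TensorAlgebra.ι k ∘ₗ
    DirectSum.lof k ℕ (fun n => V n) i

variable {V}

lemma GSym.gen_comm {i j : ℕ} (x : V i) (y : V j) :
    GSym.gen V i x * GSym.gen V j y
      = (-1 : k) ^ (i * j) • (GSym.gen V j y * GSym.gen V i x) := by
  have := RingQuot.mkAlgHom_rel k (GSymRel.comm i j x y)
  rw [map_mul, map_smul, map_mul] at this
  exact this

/-- Algebra maps out of `Sym(V)`. -/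
def GSym.lift {B : Type u} [Semiring B] [Algebra k B] (f : ∀ i, V i →ₗ[k] B)
    (hf : ∀ i j (x : V i) (y : V j), f i x * f j y = (-1 : k) ^ (i * j) • (f j y * f i x)) :
    GSym V →ₐ[k] B :=
  RingQuot.liftAlgHom k ⟨TensorAlgebra.lift k (DirectSum.toModule k ℕ B f), by
    rintro _ _ ⟨i, j, x, y⟩
    simpa using hf i j x y⟩

lemma GSym.lift_gen {B : Type u} [Semiring B] [Algebra k B] (f : ∀ i, V i →ₗ[k] B)
    (hf : ∀ i j (x : V i) (y : V j), f i x * f j y = (-1 : k) ^ (i * j) • (f j y * f i x))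
    (i : ℕ) (x : V i) : GSym.lift f hf (GSym.gen V i x) = f i x := by
  have : GSym.lift f hf (GSym.gen V i x) = TensorAlgebra.lift k (DirectSum.toModule k ℕ B f)
      (TensorAlgebra.ι k (DirectSum.lof k ℕ (fun n => V n) i x)) :=
    RingQuot.liftAlgHom_mkAlgHom_apply _ _ _ _
  rw [this]
  simp

lemma GSym.hom_ext {B : Type u} [Semiring B] [Algebra k B] {f g : GSym V →ₐ[k] B}
    (h : ∀ i (x : V i), f (GSym.gen V i x) = g (GSym.gen V i x)) : f = g := by
  apply RingQuot.ringQuot_ext'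
  apply TensorAlgebra.hom_ext
  apply DirectSum.linearMap_ext
  intro i
  ext x
  exact h i x

variable (V)

/-- `x` is a product of generators of total degree `n`. -/
inductive GSym.IsMonomial : ℕ → GSym V → Prop
  | one : IsMonomial 0 1
  | gen_mul (i : ℕ) (x : V i) {n : ℕ} {m : GSym V} :
      IsMonomial n m → IsMonomial (i + n) (GSym.gen V i x * m)

/-- The degree `n` part of `Sym(V)`: the span of the products of generators of total
degree `n`. -/
def GSym.grading (n : ℕ) : Submodule k (GSym V) :=
  Submodule.span k {x | GSym.IsMonomial V n x}

variable {V}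

lemma GSym.IsMonomial.mul {n m : ℕ} {x y : GSym V} (hx : GSym.IsMonomial V n x)
    (hy : GSym.IsMonomial V m y) : GSym.IsMonomial V (n + m) (x * y) := by
  induction hx with
  | one => simpa using hy
  | gen_mul i z _ ih =>
    rw [mul_assoc, add_assoc]
    exact .gen_mul i z ih

lemma GSym.gen_mem (i : ℕ) (x : V i) : GSym.gen V i x ∈ GSym.grading V i := by
  have := GSym.IsMonomial.gen_mul i x (GSym.IsMonomial.one (V := V))
  rw [mul_one, add_zero] at this
  exact Submodule.subset_span this

instance : SetLike.GradedMonoid (GSym.grading V) where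
  one_mem := Submodule.subset_span .one
  mul_mem {i j x y} hx hy := by
    induction hx, hy using Submodule.span_induction₂ with
    | mem_mem x y hx hy => exact Submodule.subset_span (hx.mul hy)
    | zero_left y hy => simp
    | zero_right y hy => simp
    | add_left x y z _ _ _ h1 h2 => rw [add_mul]; exact add_mem h1 h2
    | add_right x y z _ _ _ h1 h2 => rw [mul_add]; exact add_mem h1 h2
    | smul_left r x y _ _ h => rw [smul_mul_assoc]; exact Submodule.smul_mem _ _ h
    | smul_right r x y _ _ h => rw [mul_smul_comm]; exact Submodule.smul_mem _ _ h

/-- The decomposition of `Sym(V)` into homogeneous components. -/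
def GSym.decompose : GSym V →ₐ[k] ⨁ n, GSym.grading V n :=
  GSym.lift (B := ⨁ n, GSym.grading V n)
      (fun i => DirectSum.lof k ℕ (fun n => GSym.grading V n) i ∘ₗ
      (GSym.gen V i).codRestrict (GSym.grading V i) (GSym.gen_mem i)) (by
    intro i j x y
    simp only [LinearMap.comp_apply, DirectSum.lof_eq_of, DirectSum.of_mul_of]
    rw [← DirectSum.lof_eq_of k, ← DirectSum.lof_eq_of k, ← map_smul, DirectSum.lof_eq_of,
      DirectSum.lof_eq_of]
    exact DirectSum.of_eq_of_gradedMonoid_eq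
      (Sigma.subtype_ext (add_comm _ _) (GSym.gen_comm x y)))

lemma GSym.decompose_gen (i : ℕ) (x : V i) :
    GSym.decompose (GSym.gen V i x)
      = DirectSum.of (fun n => GSym.grading V n) i ⟨GSym.gen V i x, GSym.gen_mem i x⟩ :=
  GSym.lift_gen (B := ⨁ n, GSym.grading V n) _ _ _ _

instance : GradedAlgebra (GSym.grading V) :=
  GradedAlgebra.ofAlgHom _ GSym.decompose
    (by
      apply GSym.hom_ext
      intro i x
      simp [GSym.decompose_gen])
    (by
      rintro i ⟨x, hx⟩
      dsimp only
      induction hx using Submodule.span_induction with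
      | mem x hx =>
        induction hx with
        | one => rw [map_one]; rfl
        | gen_mul i z hm ih =>
          rw [map_mul, ih, GSym.decompose_gen, DirectSum.of_mul_of]
          rfl
      | zero => rw [map_zero]; exact (map_zero (DirectSum.of _ _)).symm
      | add x y _ _ h1 h2 => rw [map_add, h1, h2, ← map_add]; rfl
      | smul r x _ h1 =>
        rw [map_smul, h1, ← DirectSum.lof_eq_of k, ← map_smul]; rfl)

lemma GSym.graded_comm {i j : ℕ} {x y : GSym V} (hx : x ∈ GSym.grading V i)
    (hy : y ∈ GSym.grading V j) : x * y = (-1 : k) ^ (i * j) • (y * x) := by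
  induction hx, hy using Submodule.span_induction₂ with
  | zero_left y hy => simp
  | zero_right y hy => simp
  | add_left x y z _ _ _ h1 h2 => rw [add_mul, h1, h2, mul_add, smul_add]
  | add_right x y z _ _ _ h1 h2 => rw [mul_add, h1, h2, add_mul, smul_add]
  | smul_left r x y _ _ h => rw [smul_mul_assoc, h, mul_smul_comm, smul_comm]
  | smul_right r x y _ _ h => rw [mul_smul_comm, h, smul_mul_assoc, smul_comm]
  | mem_mem x y hx hy =>
    have step : ∀ (a : ℕ) (z : V a) {m : ℕ} {w : GSym V}, GSym.IsMonomial V m w →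
        GSym.gen V a z * w = (-1 : k) ^ (a * m) • (w * GSym.gen V a z) := by
      intro a z m w hw
      induction hw with
      | one => simp
      | gen_mul b t _ ih =>
        rw [← mul_assoc, GSym.gen_comm, smul_mul_assoc, mul_assoc, ih, mul_smul_comm, smul_smul,
          mul_assoc, mul_add, pow_add]
    induction hx with
    | one => simp
    | gen_mul a z hm ih =>
      rw [mul_assoc, ih, mul_smul_comm, ← mul_assoc, step a z hy, smul_mul_assoc, smul_smul,
        mul_assoc, add_mul, pow_add, mul_comm]

variable (V)

/-- The free graded commutative algebra on a graded vector space. -/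
def freeCGAObj : CGA k where
  carrier := GSym V
  grading := GSym.grading V
  graded_comm := GSym.graded_comm

variable {V}

/-- The extension of a degree-preserving linear map `V → B` to `Sym(V)`. -/
def GSym.extend (B : CGA k) (g : ∀ i, V i →ₗ[k] B.grading i) : GSym V →ₐ[k] B.carrier :=
  GSym.lift (fun i => (B.grading i).subtype ∘ₗ g i)
    (fun _ _ x y => B.graded_comm (g _ x).2 (g _ y).2)

lemma GSym.extend_gen (B : CGA k) (g : ∀ i, V i →ₗ[k] B.grading i) (i : ℕ) (x : V i) :
    GSym.extend B g (GSym.gen V i x) = g i x :=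
  GSym.lift_gen _ _ i x

lemma GSym.map_mem_of_gen {B : CGA k} (f : GSym V →ₐ[k] B.carrier)
    (hf : ∀ i (x : V i), f (GSym.gen V i x) ∈ B.grading i) {i : ℕ} {x : GSym V}
    (hx : x ∈ GSym.grading V i) : f x ∈ B.grading i := by
  induction hx using Submodule.span_induction with
  | zero => rw [map_zero]; exact zero_mem _
  | add x y _ _ h1 h2 => rw [map_add]; exact add_mem h1 h2
  | smul r x _ h => rw [map_smul]; exact Submodule.smul_mem _ _ h
  | mem x hx =>
    induction hx with
    | one => rw [map_one]; exact SetLike.one_mem_graded _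
    | gen_mul a z _ ih =>
      rw [map_mul]
      exact SetLike.mul_mem_graded (hf a z) ih

lemma GSym.extend_mem (B : CGA k) (g : ∀ i, V i →ₗ[k] B.grading i) {i : ℕ} {x : GSym V}
    (hx : x ∈ GSym.grading V i) : GSym.extend B g x ∈ B.grading i :=
  GSym.map_mem_of_gen _ (fun i x => by rw [GSym.extend_gen]; exact (g i x).2) hx

/-- The universal property of the free graded commutative algebra. -/
def freeCGAHomEquiv (V : GradedObject ℕ (ModuleCat.{u} k)) (B : CGA k) :
    (freeCGAObj V ⟶ B) ≃ (V ⟶ (forgetCGA k).obj B) where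
  toFun f := fun i => ModuleCat.ofHom
    ((f.toAlgHom.toLinearMap ∘ₗ GSym.gen V i).codRestrict (B.grading i)
      (fun x => f.map_mem (GSym.gen_mem i x)))
  invFun g := ⟨GSym.extend B (fun i => (g i).hom), fun hx => GSym.extend_mem B _ hx⟩
  left_inv f := by
    apply CGA.Hom.ext
    apply GSym.hom_ext
    intro i x
    exact GSym.extend_gen B _ i x
  right_inv g := by
    funext i
    apply ModuleCat.hom_ext
    exact LinearMap.ext fun x => Subtype.ext (GSym.extend_gen B _ i x)

end FreeCGA

variable (k)

/-- The free graded commutative algebra functor `Sym₊^*`. -/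
def symCGA : GradedObject ℕ (ModuleCat.{u} k) ⥤ CGA k :=
  Adjunction.leftAdjointOfEquiv (G := forgetCGA k) (F_obj := freeCGAObj) freeCGAHomEquiv
    (fun _ _ _ _ _ => rfl)

/-- `Sym₊^*` is left adjoint to the forgetful functor. -/
def symCGAAdj : symCGA k ⊣ forgetCGA k :=
  Adjunction.adjunctionOfEquivLeft freeCGAHomEquiv (fun _ _ _ _ _ => rfl)


variable {k}

/-! ## Free commutative dg algebras -/

section FreeCDGA

variable (V : CochainComplex (ModuleCat.{u} k) ℕ)

/-- The differential on generators, as a map into `Sym(V)`. -/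
def GSym.genD (i : ℕ) : V.X i →ₗ[k] GSym V.X :=
  GSym.gen V.X (i + 1) ∘ₗ (V.d i (i + 1)).hom

/-- An algebra map `x ↦ !![± x, d x; 0, x]`, which encodes the unique (graded) derivation `d` of
`Sym(V)` that extends the differential of `V`. -/
def GSym.derMatrix : GSym V.X →ₐ[k] Matrix (Fin 2) (Fin 2) (GSym V.X) :=
  GSym.lift
    (fun i =>
      { toFun := fun x => !![(-1 : k) ^ i • GSym.gen V.X i x, GSym.genD V i x;
          0, GSym.gen V.X i x]
        map_add' := fun x y => by
          ext a b
          fin_cases a <;> fin_cases b <;> simp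
        map_smul' := fun r x => by
          ext a b
          fin_cases a <;> fin_cases b
          · simpa using smul_comm _ _ _
          all_goals simp })
    (by
      intro i j x y
      have h1 := GSym.gen_comm (V := V.X) x y
      have h2 : GSym.gen V.X i x * GSym.genD V j y
          = (-1 : k) ^ (i * (j + 1)) • (GSym.genD V j y * GSym.gen V.X i x) :=
        GSym.gen_comm (V := V.X) x _
      have h3 : GSym.genD V i x * GSym.gen V.X j y
          = (-1 : k) ^ ((i + 1) * j) • (GSym.gen V.X j y * GSym.genD V i x) :=
        GSym.gen_comm (V := V.X) _ y
      have e1 : (-1 : k) ^ i * (-1 : k) ^ i = 1 := by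
        rw [← mul_pow]; simp
      ext a b
      fin_cases a <;> fin_cases b
      · simp [h1, smul_smul]
        ring_nf
      · simp [h2, h3, smul_smul]
        rw [add_comm]
        congr 2
        · ring
        · rw [mul_add, mul_one, pow_add, mul_left_comm, e1, mul_one]
      · simp
      · simp [h1])

/-- The differential of `Sym(V)`. -/
def GSym.der : GSym V.X →ₗ[k] GSym V.X where
  toFun x := GSym.derMatrix V x 0 1
  map_add' x y := by simp
  map_smul' r x := by simp

variable {V}

lemma GSym.derMatrix_gen (i : ℕ) (x : V.X i) : GSym.derMatrix V (GSym.gen V.X i x)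
    = !![(-1 : k) ^ i • GSym.gen V.X i x, GSym.genD V i x; 0, GSym.gen V.X i x] :=
  GSym.lift_gen _ _ i x

lemma GSym.der_gen (i : ℕ) (x : V.X i) :
    GSym.der V (GSym.gen V.X i x) = GSym.gen V.X (i + 1) ((V.d i (i + 1)).hom x) := by
  change GSym.derMatrix V (GSym.gen V.X i x) 0 1 = _
  rw [GSym.derMatrix_gen]
  rfl

lemma GSym.derMatrix_of_mem {n : ℕ} {x : GSym V.X} (hx : x ∈ GSym.grading V.X n) :
    GSym.derMatrix V x = !![(-1 : k) ^ n • x, GSym.der V x; 0, x] := by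
  suffices h : GSym.derMatrix V x 0 0 = (-1 : k) ^ n • x ∧ GSym.derMatrix V x 1 0 = 0 ∧
      GSym.derMatrix V x 1 1 = x by
    ext a b
    fin_cases a <;> fin_cases b
    · exact h.1
    · rfl
    · exact h.2.1
    · exact h.2.2
  induction hx using Submodule.span_induction with
  | zero => simp
  | add x y _ _ h1 h2 => simp [h1.1, h1.2, h2.1, h2.2]
  | smul r x _ h =>
    refine ⟨?_, ?_, ?_⟩
    · rw [map_smul, Matrix.smul_apply, h.1, smul_comm]
    · rw [map_smul, Matrix.smul_apply, h.2.1, smul_zero]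
    · rw [map_smul, Matrix.smul_apply, h.2.2]
  | mem x hx =>
    induction hx with
    | one => simp
    | gen_mul a z _ ih =>
      simp [GSym.derMatrix_gen, Matrix.mul_apply, Fin.sum_univ_two, ih.1, ih.2, smul_smul,
        pow_add, mul_comm]

lemma GSym.derMatrix_snd (x : GSym V.X) :
    GSym.derMatrix V x 1 1 = x := by
  induction x using DirectSum.Decomposition.inductionOn (GSym.grading V.X) with
  | zero => simp
  | homogeneous x => rw [GSym.derMatrix_of_mem x.2]; rfl
  | add x y h1 h2 => simp [h1, h2]

lemma GSym.der_mul {i : ℕ} {x : GSym V.X} (y : GSym V.X) (hx : x ∈ GSym.grading V.X i) :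
    GSym.der V (x * y) = GSym.der V x * y + (-1 : k) ^ i • (x * GSym.der V y) := by
  change GSym.derMatrix V (x * y) 0 1 = _
  rw [map_mul, Matrix.mul_apply, Fin.sum_univ_two, GSym.derMatrix_snd,
    GSym.derMatrix_of_mem hx, add_comm]
  simp [GSym.der]

lemma GSym.der_one : GSym.der V 1 = 0 := by
  change GSym.derMatrix V 1 0 1 = _
  simp

lemma GSym.der_mem {i : ℕ} {x : GSym V.X} (hx : x ∈ GSym.grading V.X i) :
    GSym.der V x ∈ GSym.grading V.X (i + 1) := by
  induction hx using Submodule.span_induction with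
  | zero => rw [map_zero]; exact zero_mem _
  | add x y _ _ h1 h2 => rw [map_add]; exact add_mem h1 h2
  | smul r x _ h => rw [map_smul]; exact Submodule.smul_mem _ _ h
  | mem x hx =>
    induction hx with
    | one => rw [GSym.der_one]; exact zero_mem _
    | @gen_mul a z n m hm ih =>
      rw [GSym.der_mul _ (GSym.gen_mem a z), GSym.der_gen]
      refine add_mem ?_ (Submodule.smul_mem _ _ ?_)
      · have := SetLike.mul_mem_graded (GSym.gen_mem (V := V.X) (a + 1) ((V.d a (a + 1)).hom z))
          (Submodule.subset_span hm : m ∈ GSym.grading V.X n)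
        rwa [add_right_comm] at this
      · rw [add_assoc]
        exact SetLike.mul_mem_graded (GSym.gen_mem (V := V.X) a z) ih

lemma GSym.der_der (x : GSym V.X) : GSym.der V (GSym.der V x) = 0 := by
  induction x using DirectSum.Decomposition.inductionOn (GSym.grading V.X) with
  | zero => simp
  | add x y h1 h2 => simp [h1, h2]
  | @homogeneous n x =>
    obtain ⟨x, hx⟩ := x
    dsimp only
    induction hx using Submodule.span_induction with
    | zero => simp
    | add x y _ _ h1 h2 => simp [h1, h2]
    | smul r x _ h => simp [h]
    | mem x hx =>
      induction hx with
      | one => simp [GSym.der_one]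
      | @gen_mul a z n m hm ih =>
        have hz : (V.d (a + 1) (a + 1 + 1)).hom ((V.d a (a + 1)).hom z) = 0 := by
          rw [← LinearMap.comp_apply, ← ModuleCat.hom_comp, V.d_comp_d]; rfl
        have e1 : (-1 : k) ^ (a + 1) = - (-1 : k) ^ a := by rw [pow_succ]; ring
        rw [GSym.der_mul _ (GSym.gen_mem a z), map_add, map_smul, GSym.der_gen,
          GSym.der_mul _ (GSym.gen_mem (a + 1) _), GSym.der_mul _ (GSym.gen_mem a z), ih,
          GSym.der_gen, GSym.der_gen, hz, e1]
        simp only [map_zero, zero_mul, zero_add, mul_zero]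
        generalize GSym.gen V.X (a + 1) ((V.d a (a + 1)).hom z) * GSym.der V m = w
        generalize (-1 : k) ^ a = c
        have h0 : c • (0 : GSym V.X) = 0 := smul_zero c
        rw [h0, add_zero]
        refine (add_smul (-c) c w).symm.trans ?_
        rw [neg_add_cancel]
        exact zero_smul k w

variable (V)

/-- The free commutative dg algebra on a cochain complex: the free graded commutative algebra
with the derivation extending the differential. -/
def freeCDGAObj : CDGA k where
  toCGA := freeCGAObj V.X
  d := GSym.der V
  d_mem := GSym.der_mem
  d_d := GSym.der_der
  leibniz := GSym.der_mul

variable {V}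

lemma GSym.map_der {B : CDGA k} (f : GSym V.X →ₐ[k] B.carrier)
    (hf : ∀ i (x : V.X i), f (GSym.gen V.X i x) ∈ B.grading i)
    (hd : ∀ i (x : V.X i), f (GSym.gen V.X (i + 1) ((V.d i (i + 1)).hom x))
      = B.d (f (GSym.gen V.X i x))) (x : GSym V.X) :
    f (GSym.der V x) = B.d (f x) := by
  have h1 : B.d 1 = 0 := by
    have := B.leibniz (1 : B.carrier) (SetLike.one_mem_graded B.grading)
    simpa using this
  induction x using DirectSum.Decomposition.inductionOn (GSym.grading V.X) with
  | zero => simp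
  | add x y h1 h2 => simp [h1, h2]
  | @homogeneous n x =>
    obtain ⟨x, hx⟩ := x
    dsimp only
    induction hx using Submodule.span_induction with
    | zero => simp
    | add x y _ _ h1 h2 => simp [h1, h2]
    | smul r x _ h => simp [h]
    | mem x hx =>
      induction hx with
      | one => simp [GSym.der_one, h1]
      | @gen_mul a z n m hm ih =>
        rw [GSym.der_mul _ (GSym.gen_mem a z), GSym.der_gen, map_mul, B.leibniz _ (hf a z),
          map_add, map_smul, map_mul, map_mul, hd, ih]

/-- The universal property of the free commutative dg algebra. -/
def freeCDGAHomEquiv (V : CochainComplex (ModuleCat.{u} k) ℕ) (B : CDGA k) :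
    (freeCDGAObj V ⟶ B) ≃ (V ⟶ (forgetCDGA k).obj B) where
  toFun f :=
    { f := freeCGAHomEquiv V.X B.toCGA f.toHom
      comm' := by
        rintro i j rfl
        rw [forgetCDGA_d]
        apply ModuleCat.hom_ext
        refine LinearMap.ext fun x => Subtype.ext ?_
        refine (f.map_d (GSym.gen V.X i x)).symm.trans ?_
        exact congrArg f.toAlgHom (GSym.der_gen i x) }
  invFun g :=
    { toHom := (freeCGAHomEquiv V.X B.toCGA).symm g.f
      map_d := by
        have hg : ∀ i (x : V.X i), GSym.extend B.toCGA (fun i => (g.f i).hom) (GSym.gen V.X i x)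
            = ((g.f i).hom x : B.grading i).1 := fun i x => GSym.extend_gen B.toCGA _ i x
        refine GSym.map_der (GSym.extend B.toCGA (fun i => (g.f i).hom)) (fun i x => ?_)
          (fun i x => ?_)
        · rw [hg]; exact Subtype.property _
        · rw [hg, hg]
          have h := g.comm i (i + 1)
          rw [forgetCDGA_d] at h
          exact (congrArg (fun φ => ((ModuleCat.Hom.hom φ x : B.grading (i + 1)) : B.carrier))
            h).symm }
  left_inv f := CDGA.Hom.ext
    (congrArg CGA.Hom.toAlgHom ((freeCGAHomEquiv V.X B.toCGA).left_inv f.toHom))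
  right_inv g := HomologicalComplex.hom_ext _ _ fun i =>
    congrFun ((freeCGAHomEquiv V.X B.toCGA).right_inv g.f) i

end FreeCDGA

variable (k)

/-- The free commutative dg algebra functor `Sym^*`. -/
def symCDGA : CochainComplex (ModuleCat.{u} k) ℕ ⥤ CDGA k :=
  Adjunction.leftAdjointOfEquiv (G := forgetCDGA k) (F_obj := freeCDGAObj) freeCDGAHomEquiv
    (fun _ _ _ _ _ => rfl)

/-- `Sym^*` is left adjoint to the forgetful functor. -/
def symCDGAAdj : symCDGA k ⊣ forgetCDGA k :=
  Adjunction.adjunctionOfEquivLeft freeCDGAHomEquiv (fun _ _ _ _ _ => rfl)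


/-! ## Cosimplicial and almost cosimplicial objects -/

/-- The maps `α` of the simplex category with `α 0 = 0`. -/
def fixZero : MorphismProperty SimplexCategory := fun _ _ α => α.toOrderHom 0 = 0

instance : fixZero.IsMultiplicative where
  id_mem _ := rfl
  comp_mem f g hf hg := by
    change g.toOrderHom (f.toOrderHom 0) = 0
    rw [show f.toOrderHom 0 = 0 from hf]
    exact hg

/-- The wide subcategory `Δ₊ ⊆ Δ` of the maps that fix `0`. -/
abbrev DeltaPlus := WideSubcategory fixZero

/-- Almost cosimplicial objects. -/
abbrev AlmostCosimplicialObject (C : Type*) [Category C] := DeltaPlus ⥤ C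

/-- The functor `c 𝒞 ⥤ c⁺ 𝒞` which forgets the zeroth coface maps. -/
def forgetCoface (C : Type*) [Category C] :
    CosimplicialObject C ⥤ AlmostCosimplicialObject C :=
  (Functor.whiskeringLeft DeltaPlus SimplexCategory C).obj (wideSubcategoryInclusion fixZero)

/-- The object `[n]` of `Δ₊`. -/
def DeltaPlus.mk (n : ℕ) : DeltaPlus := ⟨SimplexCategory.mk n⟩

/-- The codegeneracies `[n+1] → [n]` belong to `Δ₊`. -/
def DeltaPlus.σ {n : ℕ} (i : Fin (n + 1)) : DeltaPlus.mk (n + 1) ⟶ DeltaPlus.mk n :=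
  ⟨SimplexCategory.σ i, by
    change Fin.predAbove i 0 = 0
    simp⟩

/-! ## Normalized cochains -/

variable {k}

/-- `N^0(A) = A^0`, and `N^n(A)` is the intersection of the kernels of the codegeneracies
`s^i : A^n → A^{n-1}` for `n ≥ 1`. -/
def normSub (A : AlmostCosimplicialObject (ModuleCat.{u} k)) :
    ∀ n : ℕ, Submodule k (A.obj (DeltaPlus.mk n))
  | 0 => ⊤
  | n + 1 => ⨅ i : Fin (n + 1), LinearMap.ker (A.map (DeltaPlus.σ i)).hom

lemma mem_normSub_succ {A : AlmostCosimplicialObject (ModuleCat.{u} k)} {n : ℕ}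
    {x : A.obj (DeltaPlus.mk (n + 1))} :
    x ∈ normSub A (n + 1) ↔ ∀ i : Fin (n + 1), (A.map (DeltaPlus.σ i)).hom x = 0 := by
  simp only [normSub, Submodule.mem_iInf, LinearMap.mem_ker]

lemma normSub_map {A B : AlmostCosimplicialObject (ModuleCat.{u} k)} (f : A ⟶ B) (n : ℕ)
    (x : A.obj (DeltaPlus.mk n)) (hx : x ∈ normSub A n) :
    (f.app (DeltaPlus.mk n)).hom x ∈ normSub B n := by
  cases n with
  | zero => trivial
  | succ n =>
    rw [mem_normSub_succ] at hx ⊢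
    intro i
    have h := congrArg (fun φ => ModuleCat.Hom.hom φ x) (f.naturality (DeltaPlus.σ i))
    refine h.symm.trans ?_
    exact (congrArg (f.app (DeltaPlus.mk n)).hom (hx i)).trans (map_zero _)

variable (k)

/-- Almost cosimplicial normalized cochains `N₊ : c⁺Vect ⥤ grVect`. -/
def normalizedCochainsPlus : AlmostCosimplicialObject (ModuleCat.{u} k) ⥤ GradedObject ℕ (ModuleCat.{u} k) where
  obj A := fun n => ModuleCat.of k (normSub A n)
  map f := fun n => ModuleCat.ofHom ((f.app (DeltaPlus.mk n)).hom.restrict (normSub_map f n))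

variable {k}

/-- The map `∑ (-1)^{n+1+i} d^i : A^n → A^{n+1}`. -/
def cobdry (A : CosimplicialObject (ModuleCat.{u} k)) (n : ℕ) :
    A.obj (SimplexCategory.mk n) →ₗ[k] A.obj (SimplexCategory.mk (n + 1)) :=
  ∑ i : Fin (n + 2), (-1 : k) ^ (n + 1 + (i : ℕ)) • (A.δ i).hom

lemma cobdry_eq (A : CosimplicialObject (ModuleCat.{u} k)) (n : ℕ) :
    cobdry A n = (-1 : k) ^ (n + 1) •
      (AlgebraicTopology.AlternatingCofaceMapComplex.objD A n).hom := by
  have : (AlgebraicTopology.AlternatingCofaceMapComplex.objD A n).hom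
      = ∑ i : Fin (n + 2), (-1 : k) ^ (i : ℕ) • (A.δ i).hom := by
    simp only [AlgebraicTopology.AlternatingCofaceMapComplex.objD, ModuleCat.hom_sum,
      ModuleCat.hom_zsmul]
    refine Finset.sum_congr rfl fun i _ => ?_
    rcases Nat.even_or_odd (i : ℕ) with h | h <;> simp [h.neg_one_pow]
  rw [this, cobdry, Finset.smul_sum]
  simp only [smul_smul, pow_add]

lemma cobdry_cobdry (A : CosimplicialObject (ModuleCat.{u} k)) (n : ℕ)
    (x : A.obj (SimplexCategory.mk n)) : cobdry A (n + 1) (cobdry A n x) = 0 := by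
  rw [cobdry_eq, cobdry_eq, LinearMap.smul_apply, LinearMap.smul_apply, map_smul]
  have h := congrArg (fun φ => ModuleCat.Hom.hom φ x)
    (AlgebraicTopology.AlternatingCofaceMapComplex.d_squared A n)
  have h' : (AlgebraicTopology.AlternatingCofaceMapComplex.objD A (n + 1)).hom
      ((AlgebraicTopology.AlternatingCofaceMapComplex.objD A n).hom x) = 0 := h
  rw [h', smul_zero, smul_zero]

lemma cobdry_mem (A : CosimplicialObject (ModuleCat.{u} k)) (n : ℕ)
    (x : A.obj (SimplexCategory.mk n)) (hx : x ∈ normSub ((forgetCoface _).obj A) n) :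
    cobdry A n x ∈ normSub ((forgetCoface _).obj A) (n + 1) := by
  refine mem_normSub_succ.2 fun j => ?_
  change (A.σ j).hom (cobdry A n x) = 0
  have key : ∀ i : Fin (n + 2), i ≠ j.castSucc → i ≠ j.succ →
      (A.σ j).hom ((A.δ i).hom x) = 0 := by
    intro i h1 h2
    cases n with
    | zero => exfalso; fin_cases i <;> fin_cases j <;> simp_all
    | succ n =>
      have hx' : ∀ a : Fin (n + 1), (A.σ a).hom x = 0 := mem_normSub_succ.1 hx
      rcases lt_or_gt_of_ne h1 with h | h
      · obtain ⟨j', rfl⟩ := Fin.exists_succ_eq.2 (show j ≠ 0 by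
          rintro rfl; exact absurd h (by simp))
        obtain ⟨i', rfl⟩ := Fin.exists_castSucc_eq.2 (show i ≠ Fin.last _ from
          (lt_of_lt_of_le h (Fin.le_last _)).ne)
        have e := CosimplicialObject.δ_comp_σ_of_le A (i := i') (j := j') (by
          rw [← Fin.succ_castSucc, Fin.castSucc_lt_succ_iff] at h; exact h)
        have e' := congrArg (fun φ => ModuleCat.Hom.hom φ x) e
        refine Eq.trans e' ?_
        exact (congrArg (A.δ i').hom (hx' j')).trans (map_zero _)
      · have h' : j.succ < i := lt_of_le_of_ne (Fin.castSucc_lt_iff_succ_le.1 h) (Ne.symm h2)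
        have e := CosimplicialObject.δ_comp_σ_of_gt' A h'
        have e' := congrArg (fun φ => ModuleCat.Hom.hom φ x) e
        refine Eq.trans e' ?_
        exact (congrArg (A.δ _).hom (hx' _)).trans (map_zero _)
  have e1 : (A.σ j).hom ((A.δ j.castSucc).hom x) = x :=
    congrArg (fun φ => ModuleCat.Hom.hom φ x) (CosimplicialObject.δ_comp_σ_self A (i := j))
  have e2 : (A.σ j).hom ((A.δ j.succ).hom x) = x :=
    congrArg (fun φ => ModuleCat.Hom.hom φ x) (CosimplicialObject.δ_comp_σ_succ A (i := j))
  rw [cobdry, LinearMap.sum_apply, map_sum, Finset.sum_eq_add j.castSucc j.succ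
    (Fin.castSucc_lt_succ).ne]
  · simp only [LinearMap.smul_apply, map_smul, e1, e2, Fin.val_castSucc, Fin.val_succ]
    rw [← add_smul, ← add_assoc, pow_succ _ (n + 1 + (j : ℕ))]
    simp
  · rintro c - ⟨h1, h2⟩
    rw [LinearMap.smul_apply, map_smul, key c h1 h2, smul_zero]
  · simp
  · simp

lemma cobdry_naturality {A B : CosimplicialObject (ModuleCat.{u} k)} (f : A ⟶ B) (n : ℕ)
    (x : A.obj (SimplexCategory.mk n)) :
    cobdry B n ((f.app (SimplexCategory.mk n)).hom x)
      = (f.app (SimplexCategory.mk (n + 1))).hom (cobdry A n x) := by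
  have h : ∀ i : Fin (n + 2), (B.δ i).hom ((f.app (SimplexCategory.mk n)).hom x)
      = (f.app (SimplexCategory.mk (n + 1))).hom ((A.δ i).hom x) := fun i =>
    (congrArg (fun φ => ModuleCat.Hom.hom φ x) (f.naturality (SimplexCategory.δ i))).symm
  rw [cobdry, cobdry, LinearMap.sum_apply, LinearMap.sum_apply, map_sum]
  refine Finset.sum_congr rfl fun i _ => ?_
  rw [LinearMap.smul_apply, LinearMap.smul_apply, map_smul, h]

variable (k)

/-- Normalized cochains `N : cVect ⥤ Ch^{≥0}`, with differential `∑ (-1)^{n+1+i} d^i`. -/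
def normalizedCochains : CosimplicialObject (ModuleCat.{u} k) ⥤ CochainComplex (ModuleCat.{u} k) ℕ where
  obj A := CochainComplex.of (fun n => ModuleCat.of k (normSub ((forgetCoface _).obj A) n))
    (fun n => ModuleCat.ofHom ((cobdry A n).restrict (cobdry_mem A n)))
    (fun n => by
      apply ModuleCat.hom_ext
      exact LinearMap.ext fun x => Subtype.ext (cobdry_cobdry A n x.1))
  map {A B} f := CochainComplex.ofHom
    (fun n => ModuleCat.ofHom ((f.app (SimplexCategory.mk n)).hom.restrict
      (normSub_map ((forgetCoface _).map f) n))) (fun n => by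
    simp only [CochainComplex.of_d]
    apply ModuleCat.hom_ext
    refine LinearMap.ext fun x => Subtype.ext ?_
    change cobdry B n ((f.app _).hom x.1) = (f.app _).hom (cobdry A n x.1)
    exact cobdry_naturality f n x.1)
  map_id A := by ext; rfl
  map_comp f g := by ext; rfl

/-! ## Free (almost) cosimplicial commutative algebras -/

/-- The underlying vector space of a commutative algebra. -/
def forgetComm : CommAlgCat.{u} k ⥤ ModuleCat.{u} k where
  obj A := ModuleCat.of k A
  map f := ModuleCat.ofHom f.hom.toLinearMap

/-- The symmetric algebra functor. -/
def symComm : ModuleCat.{u} k ⥤ CommAlgCat.{u} k where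
  obj V := CommAlgCat.of k (SymmetricAlgebra k V)
  map f := CommAlgCat.ofHom (SymmetricAlgebra.lift (SymmetricAlgebra.ι k _ ∘ₗ f.hom))
  map_id V := by
    apply CommAlgCat.hom_ext
    apply SymmetricAlgebra.algHom_ext
    ext x
    simp
  map_comp f g := by
    apply CommAlgCat.hom_ext
    apply SymmetricAlgebra.algHom_ext
    ext x
    simp

/-- The symmetric algebra is the free commutative algebra. -/
def symCommAdj : symComm k ⊣ forgetComm k :=
  Adjunction.mkOfHomEquiv
    { homEquiv := fun V A =>
        { toFun := fun f => ModuleCat.ofHom (f.hom.toLinearMap ∘ₗ SymmetricAlgebra.ι k V)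
          invFun := fun g => CommAlgCat.ofHom (SymmetricAlgebra.lift (A := A) g.hom)
          left_inv := fun f => by
            apply CommAlgCat.hom_ext
            apply SymmetricAlgebra.algHom_ext
            exact SymmetricAlgebra.lift_comp_ι _
          right_inv := fun g => by
            apply ModuleCat.hom_ext
            exact SymmetricAlgebra.lift_comp_ι _ }
      homEquiv_naturality_left_symm := fun f g => by
        apply CommAlgCat.hom_ext
        apply SymmetricAlgebra.algHom_ext
        refine LinearMap.ext fun x => ?_
        refine (SymmetricAlgebra.lift_ι_apply _ _).trans ?_
        symm
        refine (congrArg _ (SymmetricAlgebra.lift_ι_apply _ _)).trans ?_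
        exact SymmetricAlgebra.lift_ι_apply _ _
      homEquiv_naturality_right := fun f g => rfl }

/-- Cosimplicial commutative algebras. -/
abbrev CosimplicialCommAlg := CosimplicialObject (CommAlgCat.{u} k)

/-- Almost cosimplicial commutative algebras. -/
abbrev AlmostCosimplicialCommAlg := AlmostCosimplicialObject (CommAlgCat.{u} k)

/-- The free cosimplicial commutative algebra functor `Sym^•`: the symmetric algebra in each
cosimplicial degree. -/
def symCosimplicial : CosimplicialObject (ModuleCat.{u} k) ⥤ CosimplicialCommAlg k :=
  (CosimplicialObject.whiskering _ _).obj (symComm k)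

/-- The free almost cosimplicial commutative algebra functor `Sym₊^•`. -/
def symAlmostCosimplicial :
    AlmostCosimplicialObject (ModuleCat.{u} k) ⥤ AlmostCosimplicialCommAlg k :=
  (Functor.whiskeringRight DeltaPlus _ _).obj (symComm k)

/-- `Sym^•` is left adjoint to the forgetful functor. -/
def symCosimplicialAdj :
    symCosimplicial k ⊣ (CosimplicialObject.whiskering _ _).obj (forgetComm k) :=
  (symCommAdj k).whiskerRight SimplexCategory

/-- `Sym₊^•` is left adjoint to the forgetful functor. -/
def symAlmostCosimplicialAdj :
    symAlmostCosimplicial k ⊣ (Functor.whiskeringRight DeltaPlus _ _).obj (forgetComm k) :=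
  (symCommAdj k).whiskerRight DeltaPlus


/-! ## The cosimplicial cdga `Λ^•` and the functor `K_alg` -/

/-- `Λ^n = k[e_0, …, e_n]`, the free graded commutative algebra on generators `e_i` of degree
`-1`; a product of `p` generators has degree `-p`. -/
abbrev Lam (n : ℕ) := ExteriorAlgebra k (Fin (n + 1) →₀ k)

/-- The part of `Λ^n` of degree `-p`. -/
abbrev lamGrading (n : ℕ) : ℕ → Submodule k (Lam k n) :=
  fun p => ⋀[k]^p (Fin (n + 1) →₀ k)

/-- The differential of `Λ^n`: the derivation with `e_i ↦ 1` for all `i`. -/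
def lamD (n : ℕ) : Lam k n →ₗ[k] Lam k n :=
  CliffordAlgebra.contractLeft (Finsupp.linearCombination k (fun _ : Fin (n + 1) => (1 : k)))

/-- The algebra map `Λ^m → Λ^n`, `e_i ↦ e_{α i}`, for a map `α : [m] → [n]`. -/
def lamMap {m n : ℕ} (α : Fin (m + 1) → Fin (n + 1)) : Lam k m →ₐ[k] Lam k n :=
  ExteriorAlgebra.map (Finsupp.lmapDomain k k α)

variable {k}

lemma lamD_ι_mul {n : ℕ} (v : Fin (n + 1) →₀ k) (x : Lam k n) :
    lamD k n (ExteriorAlgebra.ι k v * x) =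
      Finsupp.linearCombination k (fun _ : Fin (n + 1) => (1 : k)) v • x
        - ExteriorAlgebra.ι k v * lamD k n x :=
  CliffordAlgebra.contractLeft_ι_mul _ _ _

lemma lamD_algebraMap {n : ℕ} (r : k) : lamD k n (algebraMap k (Lam k n) r) = 0 :=
  CliffordAlgebra.contractLeft_algebraMap _ _ _

lemma lamD_lamD {n : ℕ} (x : Lam k n) : lamD k n (lamD k n x) = 0 :=
  CliffordAlgebra.contractLeft_contractLeft _ _

lemma lamD_gen {n : ℕ} (i : Fin (n + 1)) :
    lamD k n (ExteriorAlgebra.ι k (Finsupp.single i 1)) = 1 := by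
  refine (CliffordAlgebra.contractLeft_ι _ _ _).trans ?_
  simp

lemma lamD_mul {n p : ℕ} {x : Lam k n} (y : Lam k n) (hx : x ∈ lamGrading k n p) :
    lamD k n (x * y) = lamD k n x * y + (-1 : k) ^ p • (x * lamD k n y) := by
  induction hx using Submodule.pow_induction_on_left' with
  | algebraMap r =>
    rw [lamD_algebraMap, ← Algebra.smul_def, map_smul, ← Algebra.smul_def]
    simp
  | add x z i _ _ h1 h2 =>
    rw [add_mul, map_add, h1, h2, map_add, add_mul, add_mul, smul_add]
    abel
  | mem_mul v hv i x _ ih =>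
    obtain ⟨v, rfl⟩ := hv
    rw [mul_assoc, lamD_ι_mul, ih, lamD_ι_mul, sub_mul, smul_mul_assoc, mul_add, mul_smul_comm,
      mul_assoc, mul_assoc, pow_succ, mul_neg_one, neg_smul]
    abel

lemma lamD_mem_zero {n : ℕ} {x : Lam k n} (hx : x ∈ lamGrading k n 0) : lamD k n x = 0 := by
  have hx' : x ∈ (1 : Submodule k (Lam k n)) := by simpa [lamGrading] using hx
  obtain ⟨r, rfl⟩ := Submodule.mem_one.1 hx'
  exact lamD_algebraMap r

lemma lamD_mem {n p : ℕ} {x : Lam k n} (hx : x ∈ lamGrading k n (p + 1)) :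
    lamD k n x ∈ lamGrading k n p := by
  suffices h : ∀ q, ∀ x ∈ lamGrading k n q, ∀ p, q = p + 1 → lamD k n x ∈ lamGrading k n p from
    h _ x hx p rfl
  intro q x hx
  induction hx using Submodule.pow_induction_on_left' with
  | algebraMap r => intro p hp; omega
  | add x z i _ _ h1 h2 =>
    intro p hp
    rw [map_add]
    exact add_mem (h1 p hp) (h2 p hp)
  | mem_mul v hv i x hx ih =>
    intro p hp
    obtain rfl : i = p := by simpa using hp
    obtain ⟨v, rfl⟩ := hv
    rw [lamD_ι_mul]
    refine sub_mem (Submodule.smul_mem _ _ hx) ?_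
    cases i with
    | zero => rw [lamD_mem_zero hx, mul_zero]; exact zero_mem _
    | succ j =>
      have := Submodule.mul_mem_mul (LinearMap.mem_range_self (ExteriorAlgebra.ι k) v) (ih j rfl)
      rwa [← pow_succ'] at this

lemma lamMap_mem {m n p : ℕ} (α : Fin (m + 1) → Fin (n + 1)) {x : Lam k m}
    (hx : x ∈ lamGrading k m p) : lamMap k α x ∈ lamGrading k n p := by
  induction hx using Submodule.pow_induction_on_left' with
  | algebraMap r =>
    rw [AlgHom.commutes]
    exact SetLike.algebraMap_mem_graded (lamGrading k n) r
  | add x z i _ _ h1 h2 => rw [map_add]; exact add_mem h1 h2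
  | mem_mul v hv i x hx ih =>
    obtain ⟨v, rfl⟩ := hv
    rw [map_mul, lamMap, ExteriorAlgebra.map_apply_ι]
    have := Submodule.mul_mem_mul (LinearMap.mem_range_self (ExteriorAlgebra.ι k)
      (Finsupp.lmapDomain k k α v)) ih
    rwa [← pow_succ'] at this

lemma lamMap_lamD {m n : ℕ} (α : Fin (m + 1) → Fin (n + 1)) (x : Lam k m) :
    lamMap k α (lamD k m x) = lamD k n (lamMap k α x) := by
  induction x using CliffordAlgebra.left_induction with
  | algebraMap r =>
    change lamMap k α (lamD k m (algebraMap k (Lam k m) r))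
      = lamD k n (lamMap k α (algebraMap k (Lam k m) r))
    rw [lamD_algebraMap, AlgHom.commutes, lamD_algebraMap, map_zero]
  | add x y h1 h2 => simp [h1, h2]
  | ι_mul x v ih =>
    have e : ∀ w : Fin (m + 1) →₀ k, lamMap k α (ExteriorAlgebra.ι k w)
        = ExteriorAlgebra.ι k (Finsupp.lmapDomain k k α w) := fun w =>
      ExteriorAlgebra.map_apply_ι _ _
    change lamMap k α (lamD k m (ExteriorAlgebra.ι k v * x))
      = lamD k n (lamMap k α (ExteriorAlgebra.ι k v * x))
    rw [lamD_ι_mul, map_mul, e, lamD_ι_mul, map_sub, map_mul, e, map_smul, ih]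
    congr 2
    simp [Finsupp.linearCombination_mapDomain, Function.comp_def]

/-- The sign operator `x ↦ (-1)^{|x|} x` of a graded algebra. -/
def CGA.sgn (A : CGA k) : A.carrier →ₗ[k] A.carrier :=
  DirectSum.toModule k ℕ A.carrier (fun i => (-1 : k) ^ i • (A.grading i).subtype) ∘ₗ
    (DirectSum.decomposeLinearEquiv A.grading).toLinearMap

lemma CGA.sgn_of_mem (A : CGA k) {i : ℕ} {x : A.carrier} (hx : x ∈ A.grading i) :
    A.sgn x = (-1 : k) ^ i • x := by
  simp only [CGA.sgn, LinearMap.comp_apply, LinearEquiv.coe_coe,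
    DirectSum.decomposeLinearEquiv_apply]
  rw [DirectSum.decompose_of_mem _ hx, ← DirectSum.lof_eq_of k, DirectSum.toModule_lof]
  rfl

lemma CGA.Hom.map_sgn {A B : CGA k} (f : CGA.Hom A B) (x : A.carrier) :
    f.toAlgHom (A.sgn x) = B.sgn (f.toAlgHom x) := by
  induction x using DirectSum.Decomposition.inductionOn A.grading with
  | zero => simp
  | add x y h1 h2 => simp [h1, h2]
  | homogeneous x => rw [A.sgn_of_mem x.2, map_smul, B.sgn_of_mem (f.map_mem x.2)]

/-- The graded tensor product `C ⊗ Λ^n`. -/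
abbrev tensLam (C : CGA k) (n : ℕ) : Type u := C.grading ᵍ⊗[k] lamGrading k n

/-- The differential `d ⊗ 1 ± 1 ⊗ d` of `C ⊗ Λ^n`. -/
def tensD (C : CDGA k) (n : ℕ) : tensLam C.toCGA n →ₗ[k] tensLam C.toCGA n :=
  (GradedTensorProduct.of k C.grading (lamGrading k n)).toLinearMap ∘ₗ
    (TensorProduct.map C.d LinearMap.id + TensorProduct.map C.sgn (lamD k n)) ∘ₗ
    (GradedTensorProduct.of k C.grading (lamGrading k n)).symm.toLinearMap

/-- The degree `0` part `⨁_p C^p ⊗ (Λ^n)^{-p}` of `C ⊗ Λ^n`. -/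
def tensDegZero (C : CGA k) (n : ℕ) : Submodule k (tensLam C n) :=
  Submodule.span k {z | ∃ p : ℕ, ∃ c ∈ C.grading p, ∃ l ∈ lamGrading k n p, z = c ᵍ⊗ₜ[k] l}

lemma tmul_mul_tmul (C : CGA k) {n i j : ℕ} (a : C.carrier) {b : Lam k n} {a' : C.carrier}
    (b' : Lam k n) (hb : b ∈ lamGrading k n j) (ha : a' ∈ C.grading i) :
    ((a ᵍ⊗ₜ[k] b : tensLam C n) * a' ᵍ⊗ₜ[k] b' : tensLam C n)
      = (-1 : k) ^ (j * i) • ((a * a') ᵍ⊗ₜ[k] (b * b') : tensLam C n) := by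
  have h := GradedTensorProduct.tmul_coe_mul_coe_tmul C.grading (lamGrading k n) a
    (⟨b, hb⟩ : lamGrading k n j) (⟨a', ha⟩ : C.grading i) b'
  refine h.trans ?_
  have hp := uzpow_natCast (R := ℕ) (-1 : ℤˣ) (j * i)
  rw [Nat.cast_id] at hp
  rw [hp]
  rcases Nat.even_or_odd (j * i) with e | e
  · rw [e.neg_one_pow, e.neg_one_pow, one_smul, one_smul]
  · rw [e.neg_one_pow, e.neg_one_pow, Units.neg_smul, one_smul, neg_smul, one_smul]

lemma tensD_tmul (C : CDGA k) {n i : ℕ} {c : C.carrier} (l : Lam k n) (hc : c ∈ C.grading i) :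
    tensD C n (c ᵍ⊗ₜ[k] l) = (C.d c ᵍ⊗ₜ[k] l : tensLam C.toCGA n)
      + (-1 : k) ^ i • (c ᵍ⊗ₜ[k] lamD k n l : tensLam C.toCGA n) := by
  change GradedTensorProduct.of k C.grading (lamGrading k n)
    (C.d c ⊗ₜ[k] l + C.sgn c ⊗ₜ[k] lamD k n l) = _
  rw [C.sgn_of_mem hc, map_add, ← TensorProduct.smul_tmul', map_smul]


lemma tmul_mem_tensDegZero {C : CGA k} {n p : ℕ} {c : C.carrier} {l : Lam k n}
    (hc : c ∈ C.grading p) (hl : l ∈ lamGrading k n p) :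
    (c ᵍ⊗ₜ[k] l : tensLam C n) ∈ tensDegZero C n :=
  Submodule.subset_span ⟨p, c, hc, l, hl, rfl⟩

lemma one_mem_tensDegZero (C : CGA k) (n : ℕ) : (1 : tensLam C n) ∈ tensDegZero C n :=
  tmul_mem_tensDegZero (p := 0) (SetLike.one_mem_graded C.grading)
    (SetLike.one_mem_graded (lamGrading k n))

lemma mul_mem_tensDegZero {C : CGA k} {n : ℕ} {x y : tensLam C n} (hx : x ∈ tensDegZero C n)
    (hy : y ∈ tensDegZero C n) : x * y ∈ tensDegZero C n := by
  induction hx using Submodule.span_induction with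
  | zero => rw [zero_mul]; exact zero_mem _
  | add x x' _ _ h1 h2 => rw [add_mul]; exact add_mem h1 h2
  | smul r x _ h => rw [smul_mul_assoc]; exact Submodule.smul_mem _ _ h
  | mem x hx =>
    obtain ⟨p, c, hc, l, hl, rfl⟩ := hx
    induction hy using Submodule.span_induction with
    | zero => rw [mul_zero]; exact zero_mem _
    | add x x' _ _ h1 h2 => rw [mul_add]; exact add_mem h1 h2
    | smul r x _ h => rw [mul_smul_comm]; exact Submodule.smul_mem _ _ h
    | mem y hy =>
      obtain ⟨q, c', hc', l', hl', rfl⟩ := hy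
      rw [tmul_mul_tmul C c l' hl hc']
      exact Submodule.smul_mem _ _ (tmul_mem_tensDegZero (SetLike.mul_mem_graded hc hc')
        (SetLike.mul_mem_graded hl hl'))

lemma lam_comm {n p q : ℕ} {x y : Lam k n} (hx : x ∈ lamGrading k n p)
    (hy : y ∈ lamGrading k n q) : x * y = (-1 : k) ^ (p * q) • (y * x) := by
  have step : ∀ (v : Fin (n + 1) →₀ k) {q : ℕ} {y : Lam k n}, y ∈ lamGrading k n q →
      ExteriorAlgebra.ι k v * y = (-1 : k) ^ q • (y * ExteriorAlgebra.ι k v) := by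
    intro v q y hy
    induction hy using Submodule.pow_induction_on_left' with
    | algebraMap r => rw [pow_zero, one_smul, Algebra.commutes]
    | add x z i _ _ h1 h2 => rw [mul_add, h1, h2, add_mul, smul_add]
    | mem_mul w hw i x hx ih =>
      obtain ⟨w, rfl⟩ := hw
      have h := ExteriorAlgebra.ι_add_mul_swap (R := k) v w
      rw [← mul_assoc, eq_neg_of_add_eq_zero_left h, neg_mul, mul_assoc, ih, mul_smul_comm,
        mul_assoc, pow_succ, mul_neg_one, neg_smul]
  induction hx using Submodule.pow_induction_on_left' with
  | algebraMap r => rw [zero_mul, pow_zero, one_smul, Algebra.commutes]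
  | add x z i _ _ h1 h2 => rw [mul_add, add_mul, h1, h2, smul_add]
  | mem_mul w hw i x hx ih =>
    obtain ⟨w, rfl⟩ := hw
    rw [mul_assoc, ih, mul_smul_comm, ← mul_assoc, step w hy, smul_mul_assoc, smul_smul,
      ← pow_add, mul_assoc]
    congr 2
    rw [Nat.succ_eq_add_one, add_mul, one_mul]

lemma tensDegZero_mul_comm {C : CGA k} {n : ℕ} {x y : tensLam C n} (hx : x ∈ tensDegZero C n)
    (hy : y ∈ tensDegZero C n) : x * y = y * x := by
  induction hx using Submodule.span_induction with
  | zero => rw [zero_mul, mul_zero]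
  | add x x' _ _ h1 h2 => rw [add_mul, mul_add, h1, h2]
  | smul r x _ h => rw [smul_mul_assoc, mul_smul_comm, h]
  | mem x hx =>
    obtain ⟨p, c, hc, l, hl, rfl⟩ := hx
    induction hy using Submodule.span_induction with
    | zero => rw [zero_mul, mul_zero]
    | add x x' _ _ h1 h2 => rw [add_mul, mul_add, h1, h2]
    | smul r x _ h => rw [smul_mul_assoc, mul_smul_comm, h]
    | mem y hy =>
      obtain ⟨q, c', hc', l', hl', rfl⟩ := hy
      rw [tmul_mul_tmul C c l' hl hc', tmul_mul_tmul C c' l hl' hc, C.graded_comm hc hc',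
        lam_comm hl hl', mul_comm q p]
      have e : (-1 : k) ^ (p * q) * (-1 : k) ^ (p * q) = 1 := by
        rw [← mul_pow]; simp
      rw [GradedTensorProduct.tmul, GradedTensorProduct.tmul, TensorProduct.tmul_smul,
        ← TensorProduct.smul_tmul', map_smul, map_smul, smul_smul, e, one_smul]

lemma tensD_mul (C : CDGA k) {n : ℕ} {x y : tensLam C.toCGA n}
    (hx : x ∈ tensDegZero C.toCGA n) (hy : y ∈ tensDegZero C.toCGA n) :
    tensD C n (x * y) = tensD C n x * y + x * tensD C n y := by
  induction hx using Submodule.span_induction with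
  | zero => simp
  | add x x' _ _ h1 h2 => rw [add_mul, map_add, h1, h2, map_add, add_mul, add_mul]; abel
  | smul r x _ h =>
    rw [smul_mul_assoc, map_smul, h, map_smul, smul_mul_assoc, smul_mul_assoc, smul_add]
  | mem x hx =>
    obtain ⟨p, c, hc, l, hl, rfl⟩ := hx
    induction hy using Submodule.span_induction with
    | zero => simp
    | add x x' _ _ h1 h2 => rw [mul_add, map_add, h1, h2, map_add, mul_add, mul_add]; abel
    | smul r x _ h =>
      rw [mul_smul_comm, map_smul, h, map_smul, mul_smul_comm, mul_smul_comm, smul_add]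
    | mem y hy =>
      obtain ⟨q, c', hc', l', hl', rfl⟩ := hy
      have hcc : c * c' ∈ C.grading (p + q) := SetLike.mul_mem_graded hc hc'
      -- the sign in the term `∂ l * l'`, where `∂ l` has degree `-(p-1)`
      have h4 : (-1 : k) ^ p • ((c ᵍ⊗ₜ[k] lamD k n l : tensLam C.toCGA n) *
            c' ᵍ⊗ₜ[k] l' : tensLam C.toCGA n)
          = (-1 : k) ^ (p * q + (p + q)) •
            ((c * c') ᵍ⊗ₜ[k] (lamD k n l * l') : tensLam C.toCGA n) := by
        cases p with
        | zero =>
          have z : ∀ a : C.carrier, (a ᵍ⊗ₜ[k] (0 : Lam k n) : tensLam C.toCGA n) = 0 := fun a => by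
            rw [GradedTensorProduct.tmul, TensorProduct.tmul_zero, map_zero]
          rw [lamD_mem_zero hl, zero_mul (M₀ := Lam k n), z, z, zero_mul, smul_zero, smul_zero]
        | succ p =>
          rw [tmul_mul_tmul C.toCGA c l' (lamD_mem hl) hc', smul_smul, ← pow_add]
          congr 1
          have e2 : (-1 : k) ^ (q + q) = 1 := by rw [pow_add, ← mul_pow]; simp
          rw [show (p + 1) * q + (p + 1 + q) = (p + 1 + p * q) + (q + q) by ring, pow_add _ _ (q + q),
            e2, mul_one]
      rw [tmul_mul_tmul C.toCGA c l' hl hc', map_smul, tensD_tmul C _ hcc, C.leibniz _ hc,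
        lamD_mul _ hl, tensD_tmul C _ hc, tensD_tmul C _ hc', add_mul, smul_mul_assoc, h4,
        mul_add, mul_smul_comm, tmul_mul_tmul C.toCGA _ _ hl hc',
        tmul_mul_tmul C.toCGA _ _ hl (C.d_mem hc'), tmul_mul_tmul C.toCGA _ _ hl hc']
      have e1 : ∀ (a b : C.carrier) (s : k) (z : Lam k n),
          ((a + s • b) ᵍ⊗ₜ[k] z : tensLam C.toCGA n)
            = (a ᵍ⊗ₜ[k] z : tensLam C.toCGA n) + s • (b ᵍ⊗ₜ[k] z : tensLam C.toCGA n) := by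
        intro a b s z
        rw [GradedTensorProduct.tmul, TensorProduct.add_tmul, ← TensorProduct.smul_tmul', map_add,
          map_smul]
      have e2 : ∀ (a : C.carrier) (s : k) (z w : Lam k n),
          (a ᵍ⊗ₜ[k] (z + s • w) : tensLam C.toCGA n)
            = (a ᵍ⊗ₜ[k] z : tensLam C.toCGA n) + s • (a ᵍ⊗ₜ[k] w : tensLam C.toCGA n) := by
        intro a s z w
        rw [GradedTensorProduct.tmul, TensorProduct.tmul_add, TensorProduct.tmul_smul, map_add,
          map_smul]
      have e3 : (-1 : k) ^ p * (-1 : k) ^ p = 1 := by rw [← mul_pow]; simp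
      rw [e1, e2]
      simp only [smul_add, smul_smul]
      have c1 : (-1 : k) ^ (p * q) * (-1 : k) ^ p = (-1 : k) ^ (p * (q + 1)) := by ring
      have c2 : (-1 : k) ^ (p * q) * (-1 : k) ^ (p + q) = (-1 : k) ^ (p * q + (p + q)) := by ring
      have c3 : (-1 : k) ^ (p * q) * ((-1 : k) ^ (p + q) * (-1 : k) ^ p)
          = (-1 : k) ^ q * (-1 : k) ^ (p * q) := by
        rw [pow_add _ p q, mul_right_comm ((-1 : k) ^ p), e3, one_mul, mul_comm]
      simp only [c1, c2, c3]
      abel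

/-- `K_alg^n(C) = Z^0(C ⊗ Λ^n)`: the cocycles of degree `0`, as a subalgebra. -/
def cocycles (C : CDGA k) (n : ℕ) : Subalgebra k (tensLam C.toCGA n) where
  carrier := {x | x ∈ tensDegZero C.toCGA n ∧ tensD C n x = 0}
  mul_mem' {x y} hx hy :=
    ⟨mul_mem_tensDegZero hx.1 hy.1, by rw [tensD_mul C hx.1 hy.1, hx.2, hy.2]; simp⟩
  add_mem' {x y} hx hy := ⟨add_mem hx.1 hy.1, by rw [map_add, hx.2, hy.2, add_zero]⟩
  algebraMap_mem' r := by
    have h1 : tensD C n 1 = 0 := by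
      have := tensD_mul C (one_mem_tensDegZero C.toCGA n) (one_mem_tensDegZero C.toCGA n)
      simpa using this
    rw [Algebra.algebraMap_eq_smul_one]
    exact ⟨Submodule.smul_mem _ _ (one_mem_tensDegZero _ _), by rw [map_smul, h1, smul_zero]⟩

instance (C : CDGA k) (n : ℕ) : CommRing (cocycles C n) :=
  { (inferInstance : Ring (cocycles C n)) with
    mul_comm := fun x y => Subtype.ext (tensDegZero_mul_comm x.2.1 y.2.1) }

/-- The algebra map `f ⊗ Λ(α) : A ⊗ Λ^m → B ⊗ Λ^n`. -/
def tensMap {A B : CGA k} (f : CGA.Hom A B) {m n : ℕ} (α : Fin (m + 1) → Fin (n + 1)) :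
    tensLam A m →ₐ[k] tensLam B n :=
  GradedTensorProduct.lift A.grading (lamGrading k m)
    ((GradedTensorProduct.includeLeft B.grading (lamGrading k n)).comp f.toAlgHom)
    ((GradedTensorProduct.includeRight B.grading (lamGrading k n)).comp (lamMap k α))
    (fun i j a b => by
      have h := GradedTensorProduct.tmul_coe_mul_coe_tmul B.grading (lamGrading k n) 1
        (⟨lamMap k α b, lamMap_mem α b.2⟩ : lamGrading k n j)
        (⟨f.toAlgHom a, f.map_mem a.2⟩ : B.grading i) 1
      have h' := GradedTensorProduct.tmul_one_mul_one_tmul B.grading (lamGrading k n)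
        (f.toAlgHom a) (lamMap k α b)
      rw [one_mul, mul_one] at h
      refine h'.trans ?_
      refine Eq.trans ?_ (congrArg (fun z => (-1 : ℤˣ) ^ (j * i) • z) h).symm
      rw [smul_smul, Int.units_mul_self, one_smul])

lemma tensMap_tmul {A B : CGA k} (f : CGA.Hom A B) {m n : ℕ} (α : Fin (m + 1) → Fin (n + 1))
    (a : A.carrier) (l : Lam k m) :
    tensMap f α (a ᵍ⊗ₜ[k] l) = (f.toAlgHom a ᵍ⊗ₜ[k] lamMap k α l : tensLam B n) :=
  (GradedTensorProduct.lift_tmul _ _ _ _ _ _ _).trans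
    (GradedTensorProduct.tmul_one_mul_one_tmul _ _ _ _)

lemma tensMap_mem {A B : CGA k} (f : CGA.Hom A B) {m n : ℕ} (α : Fin (m + 1) → Fin (n + 1))
    {x : tensLam A m} (hx : x ∈ tensDegZero A m) : tensMap f α x ∈ tensDegZero B n := by
  induction hx using Submodule.span_induction with
  | zero => rw [map_zero]; exact zero_mem _
  | add x y _ _ h1 h2 => rw [map_add]; exact add_mem h1 h2
  | smul r x _ h => rw [map_smul]; exact Submodule.smul_mem _ _ h
  | mem x hx =>
    obtain ⟨p, c, hc, l, hl, rfl⟩ := hx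
    rw [tensMap_tmul]
    exact tmul_mem_tensDegZero (f.map_mem hc) (lamMap_mem α hl)

lemma tensMap_tensD {A B : CDGA k} (f : CDGA.Hom A B) {m n : ℕ} (α : Fin (m + 1) → Fin (n + 1))
    {x : tensLam A.toCGA m} (hx : x ∈ tensDegZero A.toCGA m) :
    tensMap f.toHom α (tensD A m x) = tensD B n (tensMap f.toHom α x) := by
  induction hx using Submodule.span_induction with
  | zero => simp
  | add x y _ _ h1 h2 => simp only [map_add, h1, h2]
  | smul r x _ h => simp only [map_smul, h]
  | mem x hx =>
    obtain ⟨p, c, hc, l, hl, rfl⟩ := hx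
    rw [tensMap_tmul, tensD_tmul A l hc, tensD_tmul B _ (f.map_mem hc), map_add, map_smul,
      tensMap_tmul, tensMap_tmul, f.map_d, lamMap_lamD]

/-- The algebra map `K_alg^m(A) → K_alg^n(B)` induced by `f : A → B` and `α : [m] → [n]`. -/
def cocyclesMap {A B : CDGA k} (f : CDGA.Hom A B) {m n : ℕ} (α : Fin (m + 1) → Fin (n + 1)) :
    cocycles A m →ₐ[k] cocycles B n :=
  ((tensMap f.toHom α).comp (cocycles A m).val).codRestrict (cocycles B n) (fun x =>
    ⟨tensMap_mem f.toHom α x.2.1, by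
      change tensD B n (tensMap f.toHom α x.1) = 0
      rw [← tensMap_tensD f α x.2.1, x.2.2, map_zero]⟩)

lemma tensMap_id (A : CGA k) (m : ℕ) :
    tensMap (𝟙 A : A ⟶ A) (id : Fin (m + 1) → Fin (m + 1)) = AlgHom.id k (tensLam A m) := by
  apply AlgHom.toLinearMap_injective
  apply GradedTensorProduct.hom_ext
  apply TensorProduct.ext'
  intro a l
  refine (tensMap_tmul (𝟙 A : A ⟶ A) id a l).trans ?_
  have : lamMap k (id : Fin (m + 1) → Fin (m + 1)) l = l := by
    rw [lamMap, Finsupp.lmapDomain_id, ExteriorAlgebra.map_id]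
    rfl
  rw [this]
  rfl

lemma tensMap_comp {A B C : CGA k} (f : A ⟶ B) (g : B ⟶ C) {m n l : ℕ}
    (α : Fin (m + 1) → Fin (n + 1)) (β : Fin (n + 1) → Fin (l + 1)) :
    tensMap (f ≫ g) (β ∘ α) = (tensMap g β).comp (tensMap f α) := by
  apply AlgHom.toLinearMap_injective
  apply GradedTensorProduct.hom_ext
  apply TensorProduct.ext'
  intro a x
  refine (tensMap_tmul (f ≫ g) (β ∘ α) a x).trans ?_
  refine Eq.trans ?_ (congrArg (tensMap g β) (tensMap_tmul f α a x)).symm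
  rw [tensMap_tmul]
  have : lamMap k (β ∘ α) x = lamMap k β (lamMap k α x) := by
    rw [lamMap, Finsupp.lmapDomain_comp, ← ExteriorAlgebra.map_comp_map]
    rfl
  rw [this]
  rfl

/-- The cosimplicial commutative algebra `K_alg(C) = Z^0(C ⊗ Λ^•)`. -/
def KalgObj (C : CDGA k) : CosimplicialCommAlg k where
  obj n := CommAlgCat.of k (cocycles C n.len)
  map α := CommAlgCat.ofHom (cocyclesMap (𝟙 C : C ⟶ C) α.toOrderHom)
  map_id n := by
    apply CommAlgCat.hom_ext
    refine AlgHom.ext fun x => Subtype.ext ?_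
    exact DFunLike.congr_fun (tensMap_id C.toCGA n.len) x.1
  map_comp α β := by
    apply CommAlgCat.hom_ext
    refine AlgHom.ext fun x => Subtype.ext ?_
    exact DFunLike.congr_fun
      (tensMap_comp (𝟙 C.toCGA) (𝟙 C.toCGA) α.toOrderHom β.toOrderHom) x.1

variable (k)

/-- The functor `K_alg : cdga ⥤ cCom`, the cosimplicial Dold-Kan denormalization with its
multiplicative structure, in the form `C ↦ Z^0(C ⊗ Λ^•)`. -/
def Kalg : CDGA k ⥤ CosimplicialCommAlg k where
  obj C := KalgObj C
  map {A B} f :=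
    { app := fun n => CommAlgCat.ofHom (cocyclesMap f id)
      naturality := fun m n α => by
        apply CommAlgCat.hom_ext
        refine AlgHom.ext fun x => Subtype.ext ?_
        exact (DFunLike.congr_fun (tensMap_comp (𝟙 A.toCGA) f.toHom α.toOrderHom id) x.1).symm.trans
          (DFunLike.congr_fun (tensMap_comp f.toHom (𝟙 B.toCGA) id α.toOrderHom) x.1) }
  map_id C := by
    ext n
    exact Subtype.ext (DFunLike.congr_fun (tensMap_id C.toCGA n.len) _)
  map_comp f g := by
    ext n
    exact Subtype.ext (DFunLike.congr_fun (tensMap_comp f.toHom g.toHom id id) _)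

/-- The functor `K_alg⁺ : cga ⥤ c⁺Com`: regard a graded commutative algebra as a cdga with zero
differential, apply `K_alg`, and forget the zeroth coface maps. -/
def KalgPlus : CGA k ⥤ AlmostCosimplicialCommAlg k :=
  zeroDiff k ⋙ Kalg k ⋙ forgetCoface _

end DoldKan

end

/-! Everything rests on the shape of a degree 0 cocycle x of C ⊗ Λ^n. Multiplication by e_0 is a
contracting homotopy for ∂, and the algebra map P : e_i ↦ e_i - e_0 satisfies 1 = P + e_0 ∂
(`lamProj_add`). The cocycle equation trades ∂ for the differential of C, so x is recovered from its
projection Px, and every degree 0 element in the image of P occurs (`eq_tensProj_sub_tensCorr`,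
`toCocycle_mem`). The image of P in Λ^n is the exterior algebra on the steps e_{i+1} - e_i, with a
basis indexed by the subsets I of `Fin n`. These subsets are also the monotone surjections out of
[n], and the coordinate at I is the top coefficient after pushing along [n] → [#I]. Hence cocycles
are detected by top coefficients along surjections (`cocycle_ext`). Moreover, top coefficients
vanish on images of maps of Δ₊ that are not onto, and d^0 acts on them as ± d.

Consequently a linear map V → K_alg⁺(C) is a family V^p → C^p that kills the images of
non-surjective maps (`kPlusEquiv`). As V^p is the direct sum of N^p(V) and the span of those images
(`normProj`), this is a graded map N₊(V) → C. For cosimplicial V, compatibility with d^0 becomes the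
cochain map condition (`NormHom.compat_iff`). So Sym ∘ N is left adjoint to K_alg followed by the
forgetful functor to vector spaces.

For algebras, the requirement that such a family come from algebra maps is a system of equations
that does not involve the differential of C (`NormHom.topCoeff_elt_mul`). D₊A is Sym(N₊A) modulo
these equations for the universal family. If A is cosimplicial, the differential of Sym(NA) sends
each relation to ± a relation one degree higher (`MultRel.d_eq`), so the same quotient is a cdga,
and this is DA. Thus D and D₊ agree by construction, and their values on free objects follow from
uniqueness of left adjoints.

The counits are invertible because K_alg and K_alg⁺ are fully faithful. A family on K_alg(B) sees
only top coefficients (`famApp_eq`), so it is a graded linear map B → C. Products of a front and a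
back face, both taken in Δ₊, realise the multiplication of B up to a sign
(`topCoeff_frontFace_mul_backFace`), so multiplicative families are algebra maps. -/

noncomputable section

namespace DoldKan

variable (k : Type u) [Field k]

/-! ## Coordinates on `Λ^n` -/

/-- The linear map `e_j ↦ (1, …, 1, 0, …, 0)` with `j` ones: the coordinates with respect to the
vectors `e_{i+1} - e_i`, modulo `e_0`. -/
def stepCoord (n : ℕ) : (Fin (n + 1) →₀ k) →ₗ[k] (Fin n → k) :=
  Finsupp.linearCombination k (fun j i => if i.castSucc < j then 1 else 0)

/-- The linear map sending the `i`-th standard vector to `e_{i+1} - e_i`. -/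
def stepVec (n : ℕ) : (Fin n → k) →ₗ[k] (Fin (n + 1) →₀ k) :=
  Fintype.linearCombination k (fun i => Finsupp.single i.succ 1 - Finsupp.single i.castSucc 1)

variable {k}

lemma stepCoord_single {n : ℕ} (j : Fin (n + 1)) (i : Fin n) :
    stepCoord k n (Finsupp.single j 1) i = if i.castSucc < j then 1 else 0 := by
  simp [stepCoord]

lemma stepCoord_stepVec {n : ℕ} (v : Fin n → k) : stepCoord k n (stepVec k n v) = v := by
  suffices h : stepCoord k n ∘ₗ stepVec k n = LinearMap.id from LinearMap.congr_fun h v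
  refine (Pi.basisFun k (Fin n)).ext fun i => ?_
  ext a
  simp only [Pi.basisFun_apply, LinearMap.comp_apply, LinearMap.id_apply, stepVec,
    Fintype.linearCombination_apply_single, one_smul, map_sub, Pi.sub_apply, stepCoord_single,
    Fin.castSucc_lt_succ_iff, Fin.castSucc_lt_castSucc_iff, Pi.single_apply]
  rcases lt_trichotomy a i with h | h | h
  · simp [h, h.le, h.ne]
  · simp [h]
  · simp [h.not_gt, h.not_ge, h.ne']

/-- Telescoping: e_j - e_0 is the sum of the steps e_{i+1} - e_i with i < j. The composite is
therefore e_j ↦ e_j - e_0, the projection along e_0 onto the vectors of total weight 0. -/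
lemma stepVec_stepCoord {n : ℕ} (v : Fin (n + 1) →₀ k) : stepVec k n (stepCoord k n v) =
    v - Finsupp.linearCombination k (fun _ : Fin (n + 1) => (1 : k)) v • Finsupp.single 0 1 := by
  suffices h : stepVec k n ∘ₗ stepCoord k n = LinearMap.id -
      (Finsupp.linearCombination k (fun _ : Fin (n + 1) => (1 : k))).smulRight
        (Finsupp.single 0 1) from LinearMap.congr_fun h v
  refine Finsupp.lhom_ext' fun j => LinearMap.ext_ring ?_
  simp only [LinearMap.comp_apply, Finsupp.lsingle_apply, LinearMap.sub_apply, LinearMap.id_apply,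
    LinearMap.smulRight_apply, Finsupp.linearCombination_single, one_smul]
  induction j using Fin.induction with
  | zero =>
    have : stepCoord k n (Finsupp.single 0 1) = 0 := by
      ext i
      simp [stepCoord_single]
    rw [this, map_zero, sub_self]
  | succ j ih =>
    have : stepCoord k n (Finsupp.single j.succ 1)
        = stepCoord k n (Finsupp.single j.castSucc 1) + Pi.single j 1 := by
      ext i
      simp only [stepCoord_single, Pi.add_apply, Fin.castSucc_lt_succ_iff,
        Fin.castSucc_lt_castSucc_iff, Pi.single_apply]
      rcases lt_trichotomy i j with h | h | h
      · simp [h, h.le, h.ne]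
      · simp [h]
      · simp [h.not_gt, h.not_ge, h.ne']
    rw [this, map_add, ih]
    simp only [stepVec, Fintype.linearCombination_apply_single, one_smul]
    abel

variable (k)

/-- The linear form on `Λ^n` that picks the coefficient of `(e_1 - e_0) ⋯ (e_n - e_{n-1})`
modulo `e_0`, up to the sign `(-1)^n`. -/
def topForm (n : ℕ) : Lam k n →ₗ[k] k :=
  -- The sign is chosen so that d^0 acts on top coefficients as (-1)^(n+1) d, which matches the sign
  -- of d^0 in the normalized differential (`topCoeff_tensAct_succ`).
  (-1 : k) ^ n • ExteriorAlgebra.liftAlternating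
    (Pi.single n (Matrix.detRowAlternating.compLinearMap (stepCoord k n)))

/-- The projection `e_i ↦ e_i - e_0` of `Λ^n`. -/
def lamProj (n : ℕ) : Lam k n →ₐ[k] Lam k n :=
  ExteriorAlgebra.map (stepVec k n ∘ₗ stepCoord k n)

/-- The surjection `[n] → [#I]` that increases exactly at the elements of `I`. -/
def countLT {n : ℕ} (I : Finset (Fin n)) (j : Fin (n + 1)) : Fin (I.card + 1) :=
  ⟨(I.filter (fun i => i.castSucc < j)).card, Nat.lt_succ_of_le (Finset.card_filter_le _ _)⟩

/-- The product of the `e_{i+1} - e_i` for `i ∈ I`, up to the sign `(-1)^#I`. -/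
def wedge {n : ℕ} (I : Finset (Fin n)) : Lam k n :=
  -- This sign cancels the one in `topForm`, so that `topForm_wedge` is an honest duality.
  (-1 : k) ^ I.card • ExteriorAlgebra.map (stepVec k n) ((Pi.basisFun k (Fin n)).ExteriorAlgebra I)

variable {k}

/-! ### Minors, surjections and the basis dual to the top forms -/

lemma topForm_ιMulti {n : ℕ} (v : Fin n → (Fin (n + 1) →₀ k)) :
    topForm k n (ExteriorAlgebra.ιMulti k n v)
      = (-1 : k) ^ n * Matrix.det (Matrix.of fun i j => stepCoord k n (v i) j) := by
  rw [topForm, LinearMap.smul_apply, ExteriorAlgebra.liftAlternating_apply_ιMulti,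
    Pi.single_eq_same]
  rfl

lemma topForm_ιMulti_of_ne {n r : ℕ} (h : r ≠ n) (v : Fin r → (Fin (n + 1) →₀ k)) :
    topForm k n (ExteriorAlgebra.ιMulti k r v) = 0 := by
  rw [topForm, LinearMap.smul_apply, ExteriorAlgebra.liftAlternating_apply_ιMulti,
    Pi.single_eq_of_ne h]
  simp

lemma topForm_of_mem {n r : ℕ} (h : r ≠ n) {l : Lam k n} (hl : l ∈ lamGrading k n r) :
    topForm k n l = 0 := by
  change l ∈ ⋀[k]^r (Fin (n + 1) →₀ k) at hl
  rw [← ExteriorAlgebra.ιMulti_span_fixedDegree] at hl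
  induction hl using Submodule.span_induction with
  | zero => simp
  | add x y _ _ h1 h2 => rw [map_add, h1, h2, add_zero]
  | smul r x _ h => rw [map_smul, h, smul_zero]
  | mem x hx =>
    obtain ⟨v, rfl⟩ := hx
    exact topForm_ιMulti_of_ne h v

lemma lamMap_ιMulti {m n r : ℕ} (α : Fin (m + 1) → Fin (n + 1)) (v : Fin r → (Fin (m + 1) →₀ k)) :
    lamMap k α (ExteriorAlgebra.ιMulti k r v)
      = ExteriorAlgebra.ιMulti k r (Finsupp.lmapDomain k k α ∘ v) :=
  ExteriorAlgebra.map_apply_ιMulti _ _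

/-- A downward closed predicate cuts out an initial segment of `Fin c`, so membership amounts to
being smaller than its size. -/
lemma lt_card_filter_iff {c : ℕ} (P : Fin c → Prop) [DecidablePred P]
    (hP : ∀ a b, a ≤ b → P b → P a) (a : Fin c) :
    (a : ℕ) < (Finset.univ.filter P).card ↔ P a := by
  constructor
  · intro h
    by_contra hn
    have : Finset.univ.filter P ⊆ Finset.Iio a := fun b hb => by
      rw [Finset.mem_Iio]
      by_contra hb'
      exact hn (hP a b (not_lt.1 hb') (Finset.mem_filter.1 hb).2)
    have := Finset.card_le_card this
    rw [Fin.card_Iio] at this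
    omega
  · intro h
    have : Finset.Iic a ⊆ Finset.univ.filter P := fun b hb =>
      Finset.mem_filter.2 ⟨Finset.mem_univ _, hP b a (Finset.mem_Iic.1 hb) h⟩
    have := Finset.card_le_card this
    rw [Fin.card_Iic] at this
    omega

/-- Counting and enumerating are adjoint: the elements of I below j are an initial segment of the
increasing enumeration of I. -/
lemma castSucc_lt_countLT {n : ℕ} (I : Finset (Fin n)) (a : Fin I.card) (j : Fin (n + 1)) :
    a.castSucc < countLT I j ↔ (I.orderEmbOfFin rfl a).castSucc < j := by
  rw [Fin.lt_def]
  have h : (countLT I j : ℕ) = (Finset.univ.filter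
      (fun a : Fin I.card => (I.orderEmbOfFin rfl a).castSucc < j)).card := by
    change (I.filter _).card = _
    conv_lhs => rw [← Finset.image_orderEmbOfFin_univ I rfl, Finset.filter_image]
    rw [Finset.card_image_of_injective _ (I.orderEmbOfFin rfl).injective]
  rw [h, Fin.val_castSucc]
  exact lt_card_filter_iff _ (fun a b hab hb =>
    lt_of_le_of_lt (Fin.castSucc_le_castSucc_iff.2 ((I.orderEmbOfFin rfl).monotone hab)) hb) a

/-- The surjection attached to I crosses its a-th cut exactly at the a-th element of I. Pushing
along it therefore selects the step coordinates indexed by I. -/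
lemma stepCoord_countLT {n : ℕ} (I : Finset (Fin n)) (v : Fin (n + 1) →₀ k) (a : Fin I.card) :
    stepCoord k I.card (Finsupp.lmapDomain k k (countLT I) v) a
      = stepCoord k n v (I.orderEmbOfFin rfl a) := by
  suffices h : LinearMap.proj a ∘ₗ stepCoord k I.card ∘ₗ Finsupp.lmapDomain k k (countLT I)
      = LinearMap.proj (I.orderEmbOfFin rfl a) ∘ₗ stepCoord k n from LinearMap.congr_fun h v
  refine Finsupp.lhom_ext' fun j => LinearMap.ext_ring ?_
  simp only [LinearMap.comp_apply, Finsupp.lsingle_apply, Finsupp.lmapDomain_apply,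
    Finsupp.mapDomain_single, LinearMap.proj_apply, stepCoord_single, castSucc_lt_countLT]

/-- The dual basis of the standard exterior basis consists of minors. The minor on the columns I of
the basis vector of J is an identity determinant if J = I. If J ≠ I has the same size, some element
of I is missing from J and gives a zero column. -/
lemma basis_coord_eq {n : ℕ} (I : Finset (Fin n)) :
    (Pi.basisFun k (Fin n)).ExteriorAlgebra.coord I = ExteriorAlgebra.liftAlternating
      (Pi.single I.card (Matrix.detRowAlternating.compLinearMap
        (LinearMap.funLeft k k (I.orderEmbOfFin rfl)))) := by
  refine (Pi.basisFun k (Fin n)).ExteriorAlgebra.ext fun J => ?_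
  rw [Module.Basis.coord_apply, Module.Basis.repr_self]
  by_cases hc : J.card = I.card
  · rw [ExteriorAlgebra.basis_apply_ofCard (Pi.basisFun k (Fin n)) hc,
      ExteriorAlgebra.liftAlternating_apply_ιMulti, Pi.single_eq_same]
    change _ = Matrix.det (fun i j => (Pi.basisFun k (Fin n)) (J.orderEmbOfFin hc i)
      (I.orderEmbOfFin rfl j))
    by_cases h : I = J
    · subst h
      rw [Finsupp.single_eq_same, ← Matrix.det_one (n := Fin I.card)]
      congr 1
      ext i j
      simp [Matrix.one_apply, Pi.single_apply, eq_comm]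
    · rw [Finsupp.single_eq_of_ne h]
      obtain ⟨i, hi, hj⟩ : ∃ i ∈ I, i ∉ J := by
        by_contra! hn
        exact h (Finset.eq_of_subset_of_card_le hn hc.le)
      obtain ⟨a, rfl⟩ : i ∈ Set.range (I.orderEmbOfFin rfl) := by simpa using hi
      refine (Matrix.det_eq_zero_of_column_eq_zero a fun b => ?_).symm
      rw [Pi.basisFun_apply, Pi.single_eq_of_ne]
      intro h'
      exact hj (h' ▸ Finset.orderEmbOfFin_mem J hc b)
  · rw [Finsupp.single_eq_of_ne (by rintro rfl; exact hc rfl), ExteriorAlgebra.basis_apply,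
      ExteriorAlgebra.liftAlternating_apply_ιMulti]
    change _ = (Pi.single (M := fun i => (Fin n → k) [⋀^Fin i]→ₗ[k] k) I.card _ J.card) _
    rw [Pi.single_eq_of_ne hc, AlternatingMap.zero_apply]

/-- By `stepCoord_countLT`, the minor on the columns I is the full determinant after collapsing
along the surjection of I. The sign undoes the one in `topForm`. -/
lemma basis_coord_map_stepCoord {n : ℕ} (I : Finset (Fin n)) (l : Lam k n) :
    (Pi.basisFun k (Fin n)).ExteriorAlgebra.coord I (ExteriorAlgebra.map (stepCoord k n) l)
      = (-1 : k) ^ I.card * topForm k I.card (lamMap k (countLT I) l) := by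
  rw [basis_coord_eq]
  suffices h : ExteriorAlgebra.liftAlternating (Pi.single I.card
      (Matrix.detRowAlternating.compLinearMap (LinearMap.funLeft k k (I.orderEmbOfFin rfl)))) ∘ₗ
        (ExteriorAlgebra.map (stepCoord k n)).toLinearMap
      = (-1 : k) ^ I.card • (topForm k I.card ∘ₗ (lamMap k (countLT I)).toLinearMap) from
    LinearMap.congr_fun h l
  refine ExteriorAlgebra.lhom_ext fun r => AlternatingMap.ext fun v => ?_
  simp only [LinearMap.compAlternatingMap_apply, LinearMap.comp_apply, AlgHom.toLinearMap_apply,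
    LinearMap.smul_apply, lamMap_ιMulti, ExteriorAlgebra.map_apply_ιMulti,
    ExteriorAlgebra.liftAlternating_apply_ιMulti]
  by_cases hr : r = I.card
  · subst hr
    have e : (-1 : k) ^ I.card * (-1 : k) ^ I.card = 1 := by rw [← mul_pow]; simp
    rw [Pi.single_eq_same, topForm_ιMulti, smul_eq_mul, ← mul_assoc, e, one_mul]
    change Matrix.det _ = _
    congr 1
    ext i j
    exact (stepCoord_countLT I (v i) j).symm
  · rw [Pi.single_eq_of_ne hr, topForm_ιMulti_of_ne hr]
    simp

/-- The expansion of `lamProj l` in the elements `wedge I`. -/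
lemma lamProj_eq_sum {n : ℕ} (l : Lam k n) :
    lamProj k n l = ∑ I : Finset (Fin n), topForm k I.card (lamMap k (countLT I) l) • wedge k I := by
  have h := (Pi.basisFun k (Fin n)).ExteriorAlgebra.sum_repr
    (ExteriorAlgebra.map (stepCoord k n) l)
  rw [lamProj, ← ExteriorAlgebra.map_comp_map, AlgHom.comp_apply, ← h, map_sum]
  refine Finset.sum_congr rfl fun I _ => ?_
  rw [← Module.Basis.coord_apply, basis_coord_map_stepCoord, map_smul, wedge, smul_smul, mul_comm]

lemma map_stepCoord_stepVec {n : ℕ} (x : ExteriorAlgebra k (Fin n → k)) :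
    ExteriorAlgebra.map (stepCoord k n) (ExteriorAlgebra.map (stepVec k n) x) = x := by
  have h := ExteriorAlgebra.map_comp_map (stepVec k n) (stepCoord k n)
  rw [show stepCoord k n ∘ₗ stepVec k n = LinearMap.id from LinearMap.ext stepCoord_stepVec,
    ExteriorAlgebra.map_id] at h
  exact DFunLike.congr_fun h x

lemma topForm_wedge {n : ℕ} (I J : Finset (Fin n)) :
    topForm k I.card (lamMap k (countLT I) (wedge k J)) = if I = J then 1 else 0 := by
  have e : (-1 : k) ^ I.card * (-1 : k) ^ I.card = 1 := by rw [← mul_pow]; simp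
  have h := basis_coord_map_stepCoord I (wedge k J)
  rw [wedge, map_smul, map_stepCoord_stepVec, map_smul, Module.Basis.coord_apply,
    Module.Basis.repr_self, ← wedge] at h
  have h' := congrArg ((-1 : k) ^ I.card * ·) h
  simp only [← mul_assoc, e, one_mul] at h'
  rw [← h', smul_eq_mul]
  by_cases hIJ : I = J
  · subst hIJ
    rw [Finsupp.single_eq_same, mul_one, e, if_pos rfl]
  · rw [Finsupp.single_eq_of_ne hIJ, mul_zero, mul_zero, if_neg hIJ]

lemma ιMulti_mem_lamGrading {n r : ℕ} (v : Fin r → (Fin (n + 1) →₀ k)) :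
    ExteriorAlgebra.ιMulti k r v ∈ lamGrading k n r :=
  (ExteriorAlgebra.ιMulti_span_fixedDegree k r).le (Submodule.subset_span ⟨v, rfl⟩)

lemma wedge_mem {n : ℕ} (I : Finset (Fin n)) : wedge k I ∈ lamGrading k n I.card := by
  refine Submodule.smul_mem _ _ ?_
  rw [ExteriorAlgebra.basis_apply, ExteriorAlgebra.map_apply_ιMulti]
  exact ιMulti_mem_lamGrading _

lemma lamProj_mem {n p : ℕ} {x : Lam k n} (hx : x ∈ lamGrading k n p) :
    lamProj k n x ∈ lamGrading k n p := by
  change x ∈ ⋀[k]^p (Fin (n + 1) →₀ k) at hx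
  rw [← ExteriorAlgebra.ιMulti_span_fixedDegree] at hx
  induction hx using Submodule.span_induction with
  | zero => rw [map_zero]; exact zero_mem _
  | add x y _ _ h1 h2 => rw [map_add]; exact add_mem h1 h2
  | smul r x _ h => rw [map_smul]; exact Submodule.smul_mem _ _ h
  | mem x hx =>
    obtain ⟨v, rfl⟩ := hx
    rw [lamProj, ExteriorAlgebra.map_apply_ιMulti]
    exact ιMulti_mem_lamGrading _

/-! ### The generator e_0 and the projection onto the kernel of ∂ -/

variable (k) in
/-- The generator `e_0` of `Λ^n`. -/
def lamZero (n : ℕ) : Lam k n := ExteriorAlgebra.ι k (Finsupp.single 0 1)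

lemma lamZero_mem (n : ℕ) : lamZero k n ∈ lamGrading k n 1 := by
  change _ ∈ (LinearMap.range (ExteriorAlgebra.ι k)) ^ 1
  rw [pow_one]
  exact LinearMap.mem_range_self _ _

lemma lamZero_mul_self (n : ℕ) (l : Lam k n) : lamZero k n * (lamZero k n * l) = 0 := by
  rw [← mul_assoc, lamZero, ExteriorAlgebra.ι_sq_zero, zero_mul]

/-- As ∂ e_0 = 1, multiplication by e_0 is a contracting homotopy: ∂ e_0 + e_0 ∂ = 1. -/
lemma lamD_lamZero_mul {n : ℕ} (l : Lam k n) :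
    lamD k n (lamZero k n * l) = l - lamZero k n * lamD k n l := by
  rw [lamZero, lamD_ι_mul]
  simp

lemma lamProj_ι {n : ℕ} (v : Fin (n + 1) →₀ k) : lamProj k n (ExteriorAlgebra.ι k v) =
    ExteriorAlgebra.ι k v
      - Finsupp.linearCombination k (fun _ : Fin (n + 1) => (1 : k)) v • lamZero k n := by
  rw [lamProj, ExteriorAlgebra.map_apply_ι, LinearMap.comp_apply, stepVec_stepCoord, map_sub,
    map_smul, lamZero]

/-- `id = lamProj + e_0 ∂`. -/
lemma lamProj_add {n : ℕ} (l : Lam k n) : lamProj k n l + lamZero k n * lamD k n l = l := by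
  induction l using CliffordAlgebra.left_induction with
  | algebraMap r =>
    change lamProj k n (algebraMap k (Lam k n) r) + lamZero k n * lamD k n (algebraMap k (Lam k n) r)
      = _
    rw [AlgHom.commutes, lamD_algebraMap, mul_zero, add_zero]
  | add x y h1 h2 =>
    rw [map_add, map_add, mul_add, add_add_add_comm, h1, h2]
  | ι_mul x v ih =>
    change lamProj k n (ExteriorAlgebra.ι k v * x) + lamZero k n * lamD k n (ExteriorAlgebra.ι k v * x)
      = ExteriorAlgebra.ι k v * x
    have hc : lamZero k n * ExteriorAlgebra.ι k v = - (ExteriorAlgebra.ι k v * lamZero k n) :=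
      eq_neg_of_add_eq_zero_left (ExteriorAlgebra.ι_add_mul_swap _ _)
    -- By induction x and its projection differ by a multiple of e_0, which e_0 annihilates.
    have hz : lamZero k n * lamProj k n x = lamZero k n * x := by
      conv_rhs => rw [← ih, mul_add, lamZero_mul_self, add_zero]
    rw [map_mul, lamProj_ι, lamD_ι_mul, sub_mul, smul_mul_assoc, hz, mul_sub, mul_smul_comm,
      ← mul_assoc (lamZero k n), hc, neg_mul, mul_assoc]
    conv_rhs => rw [← ih, mul_add]
    abel

/-- Apply ∂ to 1 = P + e_0 ∂. The homotopy identity and ∂² = 0 give ∂ e_0 ∂ = ∂, so nothing is left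
for ∂ P. -/
lemma lamD_lamProj {n : ℕ} (l : Lam k n) : lamD k n (lamProj k n l) = 0 := by
  have h := congrArg (lamD k n) (lamProj_add l)
  rw [map_add, lamD_lamZero_mul, lamD_lamD, mul_zero, sub_zero] at h
  simpa using h

lemma lamMap_lamZero {m n : ℕ} {α : Fin (m + 1) → Fin (n + 1)} (hα : α 0 = 0) :
    lamMap k α (lamZero k m) = lamZero k n := by
  rw [lamMap, lamZero, ExteriorAlgebra.map_apply_ι, Finsupp.lmapDomain_apply,
    Finsupp.mapDomain_single, hα, lamZero]

lemma lamProj_lamZero (n : ℕ) : lamProj k n (lamZero k n) = 0 := by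
  rw [lamZero, lamProj_ι, lamZero]
  simp

/-- The top form is a determinant in step coordinates, and e_0 has none. -/
lemma topForm_lamProj {n : ℕ} (l : Lam k n) : topForm k n (lamProj k n l) = topForm k n l := by
  suffices h : topForm k n ∘ₗ (lamProj k n).toLinearMap = topForm k n from LinearMap.congr_fun h l
  refine ExteriorAlgebra.lhom_ext fun r => AlternatingMap.ext fun v => ?_
  simp only [LinearMap.compAlternatingMap_apply, LinearMap.comp_apply, AlgHom.toLinearMap_apply,
    lamProj, ExteriorAlgebra.map_apply_ιMulti]
  by_cases hr : r = n
  · subst hr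
    simp [topForm_ιMulti, stepCoord_stepVec]
  · rw [topForm_ιMulti_of_ne hr, topForm_ιMulti_of_ne hr]

/-! ### The top form along maps that are not onto and along d^0 -/

/-- A step coordinate of a pushed-forward vector depends on the map only through the set of j that
it sends above the cut. -/
lemma stepCoord_lmapDomain_congr {m n n' : ℕ} {α : Fin (m + 1) → Fin (n + 1)}
    {β : Fin (m + 1) → Fin (n' + 1)} {a : Fin n} {b : Fin n'}
    (h : ∀ j, a.castSucc < α j ↔ b.castSucc < β j) (v : Fin (m + 1) →₀ k) :
    stepCoord k n (Finsupp.lmapDomain k k α v) a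
      = stepCoord k n' (Finsupp.lmapDomain k k β v) b := by
  suffices h : LinearMap.proj a ∘ₗ stepCoord k n ∘ₗ Finsupp.lmapDomain k k α
      = LinearMap.proj b ∘ₗ stepCoord k n' ∘ₗ Finsupp.lmapDomain k k β from LinearMap.congr_fun h v
  refine Finsupp.lhom_ext' fun j => LinearMap.ext_ring ?_
  simp only [LinearMap.comp_apply, Finsupp.lsingle_apply, Finsupp.lmapDomain_apply,
    Finsupp.mapDomain_single, LinearMap.proj_apply, stepCoord_single, h]

lemma stepCoord_lmapDomain_eq_zero {m n : ℕ} {α : Fin (m + 1) → Fin (n + 1)} {a : Fin n}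
    (h : ∀ j, ¬ a.castSucc < α j) (v : Fin (m + 1) →₀ k) :
    stepCoord k n (Finsupp.lmapDomain k k α v) a = 0 := by
  suffices h : LinearMap.proj a ∘ₗ stepCoord k n ∘ₗ Finsupp.lmapDomain k k α = 0 from
    LinearMap.congr_fun h v
  refine Finsupp.lhom_ext' fun j => LinearMap.ext_ring ?_
  simp only [LinearMap.comp_apply, Finsupp.lsingle_apply, Finsupp.lmapDomain_apply,
    Finsupp.mapDomain_single, LinearMap.proj_apply, stepCoord_single, h, if_false,
    LinearMap.zero_apply]

/-- The top form kills the image of every map that misses a value other than `0`. -/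
lemma topForm_lamMap_eq_zero {m n : ℕ} {α : Fin (m + 1) → Fin (n + 1)} (i : Fin n)
    (hi : ∀ j, α j ≠ i.succ) (l : Lam k m) : topForm k n (lamMap k α l) = 0 := by
  suffices h : topForm k n ∘ₗ (lamMap k α).toLinearMap = 0 from LinearMap.congr_fun h l
  refine ExteriorAlgebra.lhom_ext fun r => AlternatingMap.ext fun v => ?_
  simp only [LinearMap.compAlternatingMap_apply, LinearMap.comp_apply, AlgHom.toLinearMap_apply,
    lamMap_ιMulti, LinearMap.zero_apply]
  by_cases hr : r = n
  · subst hr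
    rw [topForm_ιMulti]
    -- If i + 1 is not a value, then lying above i and lying above i + 1 are the same condition, so
    -- columns i and i + 1 agree. If i is the last column, nothing lies above the cut and the column
    -- is zero.
    by_cases hl : i.val + 1 < r
    · rw [Matrix.det_zero_of_column_eq (i := i) (j := ⟨i.val + 1, hl⟩)
        (by rw [Ne, Fin.ext_iff]; simp), mul_zero]
      intro b
      refine stepCoord_lmapDomain_congr (fun j => ?_) (v b)
      have := hi j
      simp only [Ne, Fin.ext_iff, Fin.lt_def, Fin.val_succ, Fin.val_castSucc] at this ⊢
      omega
    · rw [Matrix.det_eq_zero_of_column_eq_zero i, mul_zero]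
      intro b
      refine stepCoord_lmapDomain_eq_zero (fun j => ?_) (v b)
      have := hi j
      have := (α j).2
      simp only [Ne, Fin.ext_iff, Fin.lt_def, Fin.val_succ, Fin.val_castSucc] at *
      omega
  · rw [topForm_ιMulti_of_ne hr]

/-- After d^0 every e_j lies above the first cut, so the first step coordinate is the total weight.
The projection lands in weight 0, and the first column of the determinant vanishes. -/
lemma topForm_lamMap_succ_lamProj {n : ℕ} (l : Lam k n) :
    topForm k (n + 1) (lamMap k Fin.succ (lamProj k n l)) = 0 := by
  suffices h : topForm k (n + 1) ∘ₗ (lamMap k Fin.succ).toLinearMap ∘ₗ (lamProj k n).toLinearMap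
      = 0 from LinearMap.congr_fun h l
  refine ExteriorAlgebra.lhom_ext fun r => AlternatingMap.ext fun v => ?_
  simp only [LinearMap.compAlternatingMap_apply, LinearMap.comp_apply, AlgHom.toLinearMap_apply,
    lamProj, ExteriorAlgebra.map_apply_ιMulti, lamMap_ιMulti, LinearMap.zero_apply]
  by_cases hr : r = n + 1
  · subst hr
    rw [topForm_ιMulti, Matrix.det_eq_zero_of_column_eq_zero 0, mul_zero]
    intro b
    suffices h : LinearMap.proj 0 ∘ₗ stepCoord k (n + 1) ∘ₗ Finsupp.lmapDomain k k Fin.succ ∘ₗ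
        stepVec k n ∘ₗ stepCoord k n = 0 from LinearMap.congr_fun h (v b)
    refine Finsupp.lhom_ext' fun j => LinearMap.ext_ring ?_
    simp only [LinearMap.comp_apply, Finsupp.lsingle_apply, stepVec_stepCoord, map_sub, map_smul,
      Finsupp.lmapDomain_apply, Finsupp.mapDomain_single, LinearMap.proj_apply,
      stepCoord_single]
    simp
  · rw [topForm_ιMulti_of_ne hr]

/-- The coface d^0 turns e_0 into e_1, whose step coordinates are (1, 0, …, 0). Expanding along that
row leaves the determinant for l, and the minus sign compares (-1)^(n+1) with (-1)^n. -/
lemma topForm_lamMap_succ_lamZero_mul {n : ℕ} (l : Lam k n) :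
    topForm k (n + 1) (lamMap k Fin.succ (lamZero k n * l)) = - topForm k n l := by
  suffices h : topForm k (n + 1) ∘ₗ (lamMap k Fin.succ).toLinearMap ∘ₗ
      LinearMap.mulLeft k (lamZero k n) = - topForm k n from LinearMap.congr_fun h l
  refine ExteriorAlgebra.lhom_ext fun r => AlternatingMap.ext fun v => ?_
  have e : lamZero k n * ExteriorAlgebra.ιMulti k r v
      = ExteriorAlgebra.ιMulti k (r + 1) (Fin.cons (Finsupp.single 0 1) v) := by
    rw [ExteriorAlgebra.ιMulti_succ_apply]
    rfl
  simp only [LinearMap.compAlternatingMap_apply, LinearMap.comp_apply, AlgHom.toLinearMap_apply,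
    LinearMap.mulLeft_apply, e, lamMap_ιMulti, LinearMap.neg_apply]
  by_cases hr : r = n
  · subst hr
    rw [topForm_ιMulti, topForm_ιMulti, Matrix.det_succ_row_zero,
      Finset.sum_eq_single 0]
    · simp only [Matrix.of_apply, Fin.val_zero, pow_zero, one_mul, Function.comp_apply, Fin.cons_zero,
        Finsupp.lmapDomain_apply, Finsupp.mapDomain_single, stepCoord_single]
      rw [if_pos (by simp), one_mul, pow_succ, mul_neg_one, neg_mul]
      congr 3
      ext i j
      simp only [Matrix.submatrix_apply, Matrix.of_apply, Fin.cons_succ, Fin.succAbove_zero]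
      have h := stepCoord_lmapDomain_congr (k := k) (α := Fin.succ) (β := id) (a := j.succ) (b := j)
        (fun a => by simp [Fin.lt_def]) (v i)
      rwa [Finsupp.lmapDomain_id, LinearMap.id_apply] at h
    · intro b _ hb
      simp only [Matrix.of_apply, Function.comp_apply, Fin.cons_zero,
        Finsupp.lmapDomain_apply, Finsupp.mapDomain_single, stepCoord_single]
      rw [if_neg, mul_zero, zero_mul]
      have : (b : ℕ) ≠ 0 := fun h => hb (Fin.ext h)
      simp only [Fin.lt_def, Fin.val_castSucc, Fin.val_succ, Fin.val_zero]
      omega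
    · simp
  · rw [topForm_ιMulti_of_ne hr, topForm_ιMulti_of_ne (by omega), neg_zero]

/-! ## Surjections -/

/-- Every monotone surjection `[n] → [p]` is one of the maps `countLT I`. -/
lemma exists_eq_countLT {n p : ℕ} (σ : Fin (n + 1) → Fin (p + 1)) (hm : Monotone σ)
    (hs : Function.Surjective σ) : ∃ I : Finset (Fin n),
      (⟨p, σ⟩ : Σ p : ℕ, Fin (n + 1) → Fin (p + 1)) = ⟨I.card, countLT I⟩ := by
  let I : Finset (Fin n) := Finset.univ.filter fun i => σ i.castSucc < σ i.succ
  have h0 : σ 0 = 0 := by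
    obtain ⟨j, hj⟩ := hs 0
    exact le_antisymm (hj ▸ hm (Fin.zero_le j)) (Fin.zero_le _)
  -- A monotone map that jumped by two would skip a value.
  have hstep : ∀ i : Fin n, (σ i.succ : ℕ) ≤ σ i.castSucc + 1 := by
    intro i
    by_contra! h
    obtain ⟨j, hj⟩ := hs ⟨σ i.castSucc + 1, by have := (σ i.succ).2; omega⟩
    rcases le_or_gt j i.castSucc with h' | h'
    · have := Fin.le_def.1 (hm h')
      rw [hj] at this
      simp at this
    · have := Fin.le_def.1 (hm (Fin.castSucc_lt_iff_succ_le.1 h'))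
      rw [hj] at this
      simp only at this
      omega
  -- Both sides start at 0 and grow by one exactly at the elements of I.
  have key : ∀ j, (σ j : ℕ) = (I.filter (fun i => i.castSucc < j)).card := by
    intro j
    induction j using Fin.induction with
    | zero => simp [h0]
    | succ j ih =>
      have hle := Fin.le_def.1 (hm (Fin.castSucc_lt_succ (i := j)).le)
      have hj := hstep j
      by_cases hjI : σ j.castSucc < σ j.succ
      · have : I.filter (fun i => i.castSucc < j.succ)
            = insert j (I.filter (fun i => i.castSucc < j.castSucc)) := by
          ext i
          simp only [Finset.mem_filter, Finset.mem_insert, Fin.castSucc_lt_succ_iff,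
            Fin.castSucc_lt_castSucc_iff]
          constructor
          · rintro ⟨hi, h⟩
            rcases h.eq_or_lt with h | h
            · exact Or.inl h
            · exact Or.inr ⟨hi, h⟩
          · rintro (rfl | ⟨hi, h⟩)
            · exact ⟨Finset.mem_filter.2 ⟨Finset.mem_univ _, hjI⟩, le_rfl⟩
            · exact ⟨hi, h.le⟩
        rw [this, Finset.card_insert_of_notMem (by simp), ← ih]
        have := Fin.lt_def.1 hjI
        omega
      · have : I.filter (fun i => i.castSucc < j.succ)
            = I.filter (fun i => i.castSucc < j.castSucc) := by
          ext i
          simp only [Finset.mem_filter, Fin.castSucc_lt_succ_iff, Fin.castSucc_lt_castSucc_iff]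
          refine and_congr_right fun hi => ⟨fun h => lt_of_le_of_ne h ?_, fun h => h.le⟩
          rintro rfl
          exact hjI (Finset.mem_filter.1 hi).2
        rw [this, ← ih]
        rw [Fin.lt_def] at hjI
        omega
  have hp : p = I.card := by
    obtain ⟨j, hj⟩ := hs (Fin.last p)
    have h1 : σ (Fin.last n) = Fin.last p :=
      le_antisymm (Fin.le_last _) (hj ▸ hm (Fin.le_last j))
    have h2 := key (Fin.last n)
    rw [h1, Finset.filter_true_of_mem (fun i _ => Fin.castSucc_lt_last i)] at h2
    exact h2
  refine ⟨I, ?_⟩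
  clear_value I
  subst hp
  congr 1
  funext j
  exact Fin.ext (key j)

lemma countLT_monotone {n : ℕ} (I : Finset (Fin n)) : Monotone (countLT I) := fun _ _ h =>
  Fin.le_def.2 (Finset.card_le_card (Finset.monotone_filter_right _ fun _ _ h' =>
    lt_of_lt_of_le h' h))

lemma countLT_zero {n : ℕ} (I : Finset (Fin n)) : countLT I 0 = 0 :=
  Fin.ext (by simp [countLT])

/-! ## The graded tensor product `C ⊗ Λ^n` -/

/-- The linear map `f ⊗ g : C ⊗ Λ^m → C ⊗ Λ^n`, without signs. -/
def tensLin (C : CGA k) {m n : ℕ} (f : C.carrier →ₗ[k] C.carrier) (g : Lam k m →ₗ[k] Lam k n) :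
    tensLam C m →ₗ[k] tensLam C n :=
  (GradedTensorProduct.of k C.grading (lamGrading k n)).toLinearMap ∘ₗ
    TensorProduct.map f g ∘ₗ (GradedTensorProduct.of k C.grading (lamGrading k m)).symm.toLinearMap

lemma tensLin_tmul (C : CGA k) {m n : ℕ} (f : C.carrier →ₗ[k] C.carrier)
    (g : Lam k m →ₗ[k] Lam k n) (c : C.carrier) (l : Lam k m) :
    tensLin C f g (c ᵍ⊗ₜ[k] l) = (f c ᵍ⊗ₜ[k] g l : tensLam C n) := rfl

lemma tensLin_tensLin (C : CGA k) {m n r : ℕ} (f f' : C.carrier →ₗ[k] C.carrier)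
    (g : Lam k m →ₗ[k] Lam k n) (g' : Lam k n →ₗ[k] Lam k r) (x : tensLam C m) :
    tensLin C f' g' (tensLin C f g x) = tensLin C (f' ∘ₗ f) (g' ∘ₗ g) x := by
  simp only [tensLin, TensorProduct.map_comp]
  rfl

/-- Two linear maps on `C ⊗ Λ^n` that agree on pure tensors are equal. -/
lemma tensLam_hom_ext {C : CGA k} {n : ℕ} {M : Type*} [AddCommGroup M] [Module k M]
    {f g : tensLam C n →ₗ[k] M}
    (h : ∀ (c : C.carrier) (l : Lam k n), f (c ᵍ⊗ₜ[k] l) = g (c ᵍ⊗ₜ[k] l)) : f = g :=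
  GradedTensorProduct.hom_ext _ _ (TensorProduct.ext' h)

lemma tensLin_id (C : CGA k) {m : ℕ} (x : tensLam C m) :
    tensLin C LinearMap.id LinearMap.id x = x := by
  simp only [tensLin, TensorProduct.map_id]
  rfl

lemma tensLin_zero_left (C : CGA k) {m n : ℕ} (g : Lam k m →ₗ[k] Lam k n) (x : tensLam C m) :
    tensLin C 0 g x = 0 := by
  simp [tensLin]

lemma tensLin_zero_right (C : CGA k) {m n : ℕ} (f : C.carrier →ₗ[k] C.carrier) (x : tensLam C m) :
    tensLin C f (0 : Lam k m →ₗ[k] Lam k n) x = 0 := by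
  simp [tensLin]

lemma tensLin_add_right (C : CGA k) {m n : ℕ} (f : C.carrier →ₗ[k] C.carrier)
    (g g' : Lam k m →ₗ[k] Lam k n) (x : tensLam C m) :
    tensLin C f (g + g') x = tensLin C f g x + tensLin C f g' x := by
  simp [tensLin, TensorProduct.map_add_right]

lemma tensLin_sub_right (C : CGA k) {m n : ℕ} (f : C.carrier →ₗ[k] C.carrier)
    (g g' : Lam k m →ₗ[k] Lam k n) (x : tensLam C m) :
    tensLin C f (g - g') x = tensLin C f g x - tensLin C f g' x := by
  rw [sub_eq_add_neg, tensLin_add_right, sub_eq_add_neg]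
  congr 1
  suffices h : tensLin C f (-g') = - tensLin C f g' from LinearMap.congr_fun h x
  refine tensLam_hom_ext fun c l => ?_
  rw [tensLin_tmul, LinearMap.neg_apply, LinearMap.neg_apply, tensLin_tmul,
    GradedTensorProduct.tmul, TensorProduct.tmul_neg, map_neg]

lemma tensD_eq (C : CDGA k) (n : ℕ) (x : tensLam C.toCGA n) : tensD C n x
    = tensLin C.toCGA C.d LinearMap.id x + tensLin C.toCGA C.sgn (lamD k n) x := rfl

/-- The action of `α : [m] → [n]` on `C ⊗ Λ^•`. -/
abbrev tensAct (C : CGA k) {m n : ℕ} (α : Fin (m + 1) → Fin (n + 1)) :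
    tensLam C m →ₐ[k] tensLam C n := tensMap (𝟙 C : C ⟶ C) α

lemma tensAct_eq (C : CGA k) {m n : ℕ} (α : Fin (m + 1) → Fin (n + 1)) (x : tensLam C m) :
    tensAct C α x = tensLin C LinearMap.id (lamMap k α).toLinearMap x := by
  suffices h : (tensAct C α).toLinearMap = tensLin C LinearMap.id (lamMap k α).toLinearMap from
    LinearMap.congr_fun h x
  exact tensLam_hom_ext fun c l => tensMap_tmul (𝟙 C : C ⟶ C) α c l

lemma tensAct_tensAct (C : CGA k) {m n l : ℕ} (α : Fin (m + 1) → Fin (n + 1))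
    (β : Fin (n + 1) → Fin (l + 1)) (x : tensLam C m) :
    tensAct C β (tensAct C α x) = tensAct C (β ∘ α) x :=
  (DFunLike.congr_fun (tensMap_comp (𝟙 C) (𝟙 C) α β) x).symm

lemma tensAct_id (C : CGA k) {m : ℕ} (x : tensLam C m) : tensAct C id x = x :=
  DFunLike.congr_fun (tensMap_id C m) x

/-- The map `c ⊗ l ↦ φ(l) c`. -/
def tensForm (C : CGA k) {n : ℕ} (φ : Lam k n →ₗ[k] k) : tensLam C n →ₗ[k] C.carrier :=
  (TensorProduct.rid k C.carrier).toLinearMap ∘ₗ TensorProduct.map LinearMap.id φ ∘ₗ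
    (GradedTensorProduct.of k C.grading (lamGrading k n)).symm.toLinearMap

lemma tensForm_tmul (C : CGA k) {n : ℕ} (φ : Lam k n →ₗ[k] k) (c : C.carrier) (l : Lam k n) :
    tensForm C φ (c ᵍ⊗ₜ[k] l) = φ l • c := by
  simp [tensForm]

lemma tensForm_tensLin (C : CGA k) {m n : ℕ} {f : C.carrier →ₗ[k] C.carrier}
    {g : Lam k m →ₗ[k] Lam k n} {φ : Lam k m →ₗ[k] k} {ψ : Lam k n →ₗ[k] k}
    (h : ∀ l, ψ (g l) = φ l) (x : tensLam C m) :
    tensForm C ψ (tensLin C f g x) = f (tensForm C φ x) := by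
  suffices h : tensForm C ψ ∘ₗ tensLin C f g = f ∘ₗ tensForm C φ from LinearMap.congr_fun h x
  refine tensLam_hom_ext fun c l => ?_
  rw [LinearMap.comp_apply, LinearMap.comp_apply, tensLin_tmul, tensForm_tmul, tensForm_tmul,
    map_smul, h]

lemma tensForm_neg (C : CGA k) {n : ℕ} (φ : Lam k n →ₗ[k] k) (x : tensLam C n) :
    tensForm C (-φ) x = - tensForm C φ x := by
  suffices h : tensForm C (-φ) = - tensForm C φ from LinearMap.congr_fun h x
  refine tensLam_hom_ext fun c l => ?_
  rw [LinearMap.neg_apply, tensForm_tmul, tensForm_tmul, LinearMap.neg_apply, neg_smul]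

lemma tensForm_zero (C : CGA k) {n : ℕ} (x : tensLam C n) :
    tensForm C (0 : Lam k n →ₗ[k] k) x = 0 := by
  simp [tensForm]

/-! ### Top coefficients, the projection and coordinates in C ⊗ Λ^n -/

/-- The top coefficient `C ⊗ Λ^n → C`. -/
def topCoeff (C : CGA k) (n : ℕ) : tensLam C n →ₗ[k] C.carrier := tensForm C (topForm k n)

lemma topCoeff_tmul (C : CGA k) {n : ℕ} (c : C.carrier) (l : Lam k n) :
    topCoeff C n (c ᵍ⊗ₜ[k] l) = topForm k n l • c := tensForm_tmul C _ c l

lemma topCoeff_mem {C : CGA k} {n : ℕ} {x : tensLam C n} (hx : x ∈ tensDegZero C n) :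
    topCoeff C n x ∈ C.grading n := by
  induction hx using Submodule.span_induction with
  | zero => rw [map_zero]; exact zero_mem _
  | add x y _ _ h1 h2 => rw [map_add]; exact add_mem h1 h2
  | smul r x _ h => rw [map_smul]; exact Submodule.smul_mem _ _ h
  | mem x hx =>
    obtain ⟨p, c, hc, l, hl, rfl⟩ := hx
    rw [topCoeff_tmul]
    by_cases h : p = n
    · subst h; exact Submodule.smul_mem _ _ hc
    · rw [topForm_of_mem h hl, zero_smul]; exact zero_mem _

lemma topCoeff_tensMap {A B : CGA k} (f : A ⟶ B) {n : ℕ} (x : tensLam A n) :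
    topCoeff B n (tensMap f id x) = f.toAlgHom (topCoeff A n x) := by
  suffices h : topCoeff B n ∘ₗ (tensMap f id).toLinearMap = f.toAlgHom.toLinearMap ∘ₗ topCoeff A n
    from LinearMap.congr_fun h x
  refine tensLam_hom_ext fun c l => ?_
  simp only [LinearMap.comp_apply, AlgHom.toLinearMap_apply]
  rw [tensMap_tmul, topCoeff_tmul, topCoeff_tmul, map_smul, lamMap, Finsupp.lmapDomain_id,
    ExteriorAlgebra.map_id]
  rfl

lemma topCoeff_tensLin_eq_zero (C : CGA k) {m n : ℕ} {f : C.carrier →ₗ[k] C.carrier}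
    {g : Lam k m →ₗ[k] Lam k n} (h : ∀ l, topForm k n (g l) = 0)
    (x : tensLam C m) : topCoeff C n (tensLin C f g x) = 0 := by
  rw [topCoeff, tensForm_tensLin C (φ := 0) h, tensForm_zero, map_zero]

lemma topCoeff_tensLin_of_eq (C : CGA k) {n : ℕ} {f : C.carrier →ₗ[k] C.carrier}
    {g : Lam k n →ₗ[k] Lam k n} (h : ∀ l, topForm k n (g l) = topForm k n l)
    (x : tensLam C n) : topCoeff C n (tensLin C f g x) = f (topCoeff C n x) :=
  tensForm_tensLin C h x

lemma topCoeff_tensAct_eq_zero (C : CGA k) {m n : ℕ} {α : Fin (m + 1) → Fin (n + 1)} (i : Fin n)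
    (hi : ∀ j, α j ≠ i.succ) (x : tensLam C m) : topCoeff C n (tensAct C α x) = 0 := by
  rw [tensAct_eq]
  exact topCoeff_tensLin_eq_zero C
    (fun l => by rw [AlgHom.toLinearMap_apply]; exact topForm_lamMap_eq_zero i hi l) x

/-- The projection of `C ⊗ Λ^n` induced by `lamProj`. -/
abbrev tensProj (C : CGA k) (n : ℕ) : tensLam C n →ₗ[k] tensLam C n :=
  tensLin C LinearMap.id (lamProj k n).toLinearMap

lemma topCoeff_tensProj (C : CGA k) {n : ℕ} (x : tensLam C n) :
    topCoeff C n (tensProj C n x) = topCoeff C n x :=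
  topCoeff_tensLin_of_eq C
    (fun l => by rw [AlgHom.toLinearMap_apply]; exact topForm_lamProj l) x

lemma tensProj_mem {C : CGA k} {n : ℕ} {x : tensLam C n} (hx : x ∈ tensDegZero C n) :
    tensProj C n x ∈ tensDegZero C n := by
  induction hx using Submodule.span_induction with
  | zero => rw [map_zero]; exact zero_mem _
  | add x y _ _ h1 h2 => rw [map_add]; exact add_mem h1 h2
  | smul r x _ h => rw [map_smul]; exact Submodule.smul_mem _ _ h
  | mem x hx =>
    obtain ⟨p, c, hc, l, hl, rfl⟩ := hx
    exact tmul_mem_tensDegZero hc (lamProj_mem hl)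

/-- The projection of Λ^n is an algebra map that preserves degrees, so it leaves the Koszul signs
unchanged. -/
lemma tensProj_mul {C : CGA k} {n : ℕ} {x y : tensLam C n} (hx : x ∈ tensDegZero C n)
    (hy : y ∈ tensDegZero C n) :
    tensProj C n (x * y) = tensProj C n x * tensProj C n y := by
  induction hx using Submodule.span_induction with
  | zero => simp
  | add x x' _ _ h1 h2 => rw [add_mul, map_add, h1, h2, map_add, add_mul]
  | smul r x _ h => rw [smul_mul_assoc, map_smul, h, map_smul, smul_mul_assoc]
  | mem x hx =>
    obtain ⟨p, c, hc, l, hl, rfl⟩ := hx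
    induction hy using Submodule.span_induction with
    | zero => simp
    | add x x' _ _ h1 h2 => rw [mul_add, map_add, h1, h2, map_add, mul_add]
    | smul r x _ h => rw [mul_smul_comm, map_smul, h, map_smul, mul_smul_comm]
    | mem y hy =>
      obtain ⟨q, c', hc', l', hl', rfl⟩ := hy
      have h := tmul_mul_tmul C c (lamProj k n l') (lamProj_mem hl) hc'
      rw [← map_mul (lamProj k n)] at h
      rw [tmul_mul_tmul C c l' hl hc', map_smul]
      exact h.symm

/-- The element of `C ⊗ Λ^n` with given coefficients. -/
def ofCoords (C : CGA k) (n : ℕ) : (Finset (Fin n) → C.carrier) →ₗ[k] tensLam C n :=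
  ∑ I : Finset (Fin n), (GradedTensorProduct.of k C.grading (lamGrading k n)).toLinearMap ∘ₗ
    (TensorProduct.mk k C.carrier (Lam k n)).flip (wedge k I) ∘ₗ LinearMap.proj I

lemma ofCoords_apply (C : CGA k) {n : ℕ} (c : Finset (Fin n) → C.carrier) :
    ofCoords C n c = ∑ I : Finset (Fin n), (c I ᵍ⊗ₜ[k] wedge k I : tensLam C n) := by
  simp [ofCoords]

lemma ofCoords_mem {C : CGA k} {n : ℕ} {c : Finset (Fin n) → C.carrier}
    (hc : ∀ I, c I ∈ C.grading I.card) : ofCoords C n c ∈ tensDegZero C n := by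
  rw [ofCoords_apply]
  exact sum_mem fun I _ => tmul_mem_tensDegZero (hc I) (wedge_mem I)

lemma tensMap_ofCoords {A B : CGA k} (f : A ⟶ B) {n : ℕ} (c : Finset (Fin n) → A.carrier) :
    tensMap f id (ofCoords A n c) = ofCoords B n (fun I => f.toAlgHom (c I)) := by
  rw [ofCoords_apply, ofCoords_apply, map_sum]
  refine Finset.sum_congr rfl fun I _ => ?_
  rw [tensMap_tmul, lamMap, Finsupp.lmapDomain_id, ExteriorAlgebra.map_id]
  rfl

/-- The coordinates of an element of `C ⊗ Λ^n`. -/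
def coords (C : CGA k) {n : ℕ} (x : tensLam C n) (I : Finset (Fin n)) : C.carrier :=
  topCoeff C I.card (tensAct C (countLT I) x)

/-- This is `lamProj_eq_sum` with coefficients in C. -/
lemma tensProj_eq_ofCoords (C : CGA k) {n : ℕ} (x : tensLam C n) :
    tensProj C n x = ofCoords C n (coords C x) := by
  let Φ : tensLam C n →ₗ[k] tensLam C n := ofCoords C n ∘ₗ LinearMap.pi
    (fun I => topCoeff C I.card ∘ₗ (tensAct C (countLT I)).toLinearMap)
  suffices h : tensProj C n = Φ from LinearMap.congr_fun h x
  refine tensLam_hom_ext fun c l => ?_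
  simp only [Φ, LinearMap.comp_apply]
  rw [tensLin_tmul, ofCoords_apply, AlgHom.toLinearMap_apply, lamProj_eq_sum,
    GradedTensorProduct.tmul, TensorProduct.tmul_sum, map_sum]
  refine Finset.sum_congr rfl fun I _ => ?_
  rw [LinearMap.pi_apply, LinearMap.comp_apply, AlgHom.toLinearMap_apply, tensMap_tmul,
    topCoeff_tmul, TensorProduct.tmul_smul]
  rfl

lemma coords_ofCoords (C : CGA k) {n : ℕ} (c : Finset (Fin n) → C.carrier) :
    coords C (ofCoords C n c) = c := by
  funext I
  rw [coords, ofCoords_apply, map_sum, map_sum, Finset.sum_eq_single I]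
  · rw [tensMap_tmul, topCoeff_tmul, topForm_wedge, if_pos rfl, one_smul]
    rfl
  · intro J _ hJ
    rw [tensMap_tmul, topCoeff_tmul, topForm_wedge, if_neg hJ.symm, zero_smul]
  · simp

/-! ## Coordinates on cocycles -/

lemma CGA.sgn_sgn (A : CGA k) (x : A.carrier) : A.sgn (A.sgn x) = x := by
  induction x using DirectSum.Decomposition.inductionOn A.grading with
  | zero => simp
  | add x y h1 h2 => simp [h1, h2]
  | @homogeneous i x =>
    have e : (-1 : k) ^ i * (-1 : k) ^ i = 1 := by rw [← mul_pow]; simp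
    rw [A.sgn_of_mem x.2, map_smul, A.sgn_of_mem x.2, smul_smul, e, one_smul]

lemma CDGA.d_sgn_d (A : CDGA k) (x : A.carrier) : A.d (A.sgn (A.d x)) = 0 := by
  induction x using DirectSum.Decomposition.inductionOn A.grading with
  | zero => simp
  | add x y h1 h2 => simp [h1, h2]
  | @homogeneous i x => rw [A.sgn_of_mem (A.d_mem x.2), map_smul, A.d_d, smul_zero]

/-- The operator `c ⊗ l ↦ ± d c ⊗ e_0 l`. -/
def tensCorr (C : CDGA k) (n : ℕ) : tensLam C.toCGA n →ₗ[k] tensLam C.toCGA n :=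
  tensLin C.toCGA (C.sgn ∘ₗ C.d) (LinearMap.mulLeft k (lamZero k n))

lemma tensCorr_mem {C : CDGA k} {n : ℕ} {x : tensLam C.toCGA n}
    (hx : x ∈ tensDegZero C.toCGA n) : tensCorr C n x ∈ tensDegZero C.toCGA n := by
  induction hx using Submodule.span_induction with
  | zero => rw [map_zero]; exact zero_mem _
  | add x y _ _ h1 h2 => rw [map_add]; exact add_mem h1 h2
  | smul r x _ h => rw [map_smul]; exact Submodule.smul_mem _ _ h
  | mem x hx =>
    obtain ⟨p, c, hc, l, hl, rfl⟩ := hx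
    rw [tensCorr, tensLin_tmul, LinearMap.comp_apply, C.sgn_of_mem (C.d_mem hc)]
    refine tmul_mem_tensDegZero (p := p + 1) (Submodule.smul_mem _ _ (C.d_mem hc)) ?_
    rw [add_comm p 1]
    exact SetLike.mul_mem_graded (lamZero_mem (k := k) n) hl

/-- Start from x = Px + e_0 ∂x. The cocycle equation expresses the ∂ term through the differential
of C, which turns e_0 ∂x into minus the correction. -/
lemma eq_tensProj_sub_tensCorr {C : CDGA k} {n : ℕ} {x : tensLam C.toCGA n}
    (hx : tensD C n x = 0) : x = tensProj C.toCGA n x - tensCorr C n x := by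
  have h1 : x = tensProj C.toCGA n x + tensLin C.toCGA LinearMap.id
      (LinearMap.mulLeft k (lamZero k n) ∘ₗ lamD k n) x := by
    rw [tensProj, ← tensLin_add_right]
    conv_lhs => rw [← tensLin_id C.toCGA x]
    congr 2
    exact LinearMap.ext fun l => (lamProj_add l).symm
  -- Applying sgn ⊗ e_0 to the cocycle equation removes the sign in front of ∂, as sgn² = 1.
  have h2 := congrArg (tensLin C.toCGA C.sgn (LinearMap.mulLeft k (lamZero k n))) hx
  rw [tensD_eq, map_add, tensLin_tensLin, tensLin_tensLin, map_zero, LinearMap.comp_id,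
    show C.sgn ∘ₗ C.sgn = LinearMap.id from LinearMap.ext C.sgn_sgn] at h2
  conv_lhs => rw [h1, eq_neg_of_add_eq_zero_right h2]
  rw [sub_eq_add_neg]
  rfl

/-- The element l and its projection differ by a multiple of e_0, and e_0² = 0. Hence the correction
depends on the projection alone. -/
lemma tensCorr_tensProj {C : CDGA k} {n : ℕ} (x : tensLam C.toCGA n) :
    tensCorr C n (tensProj C.toCGA n x) = tensCorr C n x := by
  rw [tensCorr, tensProj, tensLin_tensLin, LinearMap.comp_id]
  congr 2
  refine LinearMap.ext fun l => ?_
  change lamZero k n * lamProj k n l = lamZero k n * l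
  conv_rhs => rw [← lamProj_add l, mul_add, lamZero_mul_self, add_zero]

/-- The cocycle with the same image under `tensProj` as a given element. -/
def toCocycle (C : CDGA k) (n : ℕ) : tensLam C.toCGA n →ₗ[k] tensLam C.toCGA n :=
  tensProj C.toCGA n - tensCorr C n

/-- Put y = Px, so that ∂y = 0 and the element is y - (sgn d ⊗ e_0) y. Its d part is dy, since d sgn
d = 0. Its ∂ part is -dy, by ∂ e_0 = 1 - e_0 ∂ and ∂y = 0. -/
lemma toCocycle_mem {C : CDGA k} {n : ℕ} {x : tensLam C.toCGA n}
    (hx : x ∈ tensDegZero C.toCGA n) : toCocycle C n x ∈ cocycles C n := by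
  refine ⟨sub_mem (tensProj_mem hx) (tensCorr_mem hx), ?_⟩
  rw [toCocycle, LinearMap.sub_apply, map_sub, tensD_eq, ← tensCorr_tensProj, tensD_eq,
    tensCorr]
  generalize hy : tensProj C.toCGA n x = y
  rw [tensLin_tensLin, tensLin_tensLin,
    show C.d ∘ₗ C.sgn ∘ₗ C.d = 0 from LinearMap.ext C.d_sgn_d, tensLin_zero_left, zero_add,
    ← LinearMap.comp_assoc, show C.sgn ∘ₗ C.sgn = LinearMap.id from LinearMap.ext C.sgn_sgn,
    show lamD k n ∘ₗ LinearMap.mulLeft k (lamZero k n) = LinearMap.id -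
      LinearMap.mulLeft k (lamZero k n) ∘ₗ lamD k n from LinearMap.ext lamD_lamZero_mul,
    tensLin_sub_right, LinearMap.id_comp]
  subst hy
  rw [tensProj, tensLin_tensLin, tensLin_tensLin, tensLin_tensLin, LinearMap.comp_assoc,
    show lamD k n ∘ₗ (lamProj k n).toLinearMap = 0 from LinearMap.ext lamD_lamProj,
    LinearMap.comp_zero, tensLin_zero_right, tensLin_zero_right]
  simp

/-- A map that fixes 0 preserves e_0, hence commutes with e_i ↦ e_i - e_0. This is where Δ₊ is
singled out: d^0 does not commute with the projection. -/
lemma lamProj_lamMap {m n : ℕ} {α : Fin (m + 1) → Fin (n + 1)} (hα : α 0 = 0) (l : Lam k m) :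
    lamProj k n (lamMap k α l) = lamMap k α (lamProj k m l) := by
  suffices h : (lamProj k n).comp (lamMap k α) = (lamMap k α).comp (lamProj k m) from
    DFunLike.congr_fun h l
  refine ExteriorAlgebra.hom_ext (LinearMap.ext fun v => ?_)
  simp only [LinearMap.comp_apply, AlgHom.toLinearMap_apply, AlgHom.comp_apply]
  rw [lamProj_ι, map_sub, map_smul, lamMap_lamZero hα, lamMap, ExteriorAlgebra.map_apply_ι,
    lamProj_ι]
  congr 2
  simp [Finsupp.linearCombination_mapDomain, Function.comp_def]

lemma topForm_lamZero_mul {n : ℕ} (l : Lam k n) : topForm k n (lamZero k n * l) = 0 := by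
  rw [← topForm_lamProj, map_mul, lamProj_lamZero, zero_mul, map_zero]

/-- The correction term is a multiple of e_0. It stays one under a map that fixes 0, and the top
form kills such multiples. -/
lemma topCoeff_tensAct_toCocycle {C : CDGA k} {m n : ℕ} {α : Fin (m + 1) → Fin (n + 1)}
    (hα : α 0 = 0) (x : tensLam C.toCGA m) :
    topCoeff C.toCGA n (tensAct C.toCGA α (toCocycle C m x))
      = topCoeff C.toCGA n (tensAct C.toCGA α x) := by
  have h1 : topCoeff C.toCGA n (tensAct C.toCGA α (tensCorr C m x)) = 0 := by
    rw [tensAct_eq, tensCorr, tensLin_tensLin]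
    refine topCoeff_tensLin_eq_zero _ (fun l => ?_) x
    change topForm k n (lamMap k α (lamZero k m * l)) = 0
    rw [map_mul, lamMap_lamZero hα, topForm_lamZero_mul]
  have h2 : tensAct C.toCGA α (tensProj C.toCGA m x) = tensProj C.toCGA n (tensAct C.toCGA α x) := by
    rw [tensAct_eq, tensAct_eq, tensProj, tensProj, tensLin_tensLin, tensLin_tensLin]
    congr 2
    exact LinearMap.ext fun l => (lamProj_lamMap hα l).symm
  rw [toCocycle, LinearMap.sub_apply, map_sub, map_sub, h1, sub_zero, h2, topCoeff_tensProj]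

lemma coords_toCocycle {C : CDGA k} {n : ℕ} (x : tensLam C.toCGA n) :
    coords C.toCGA (toCocycle C n x) = coords C.toCGA x :=
  funext fun I => topCoeff_tensAct_toCocycle (countLT_zero I) x

/-- A cocycle is determined by its coordinates. -/
lemma toCocycle_ofCoords_coords {C : CDGA k} {n : ℕ} {x : tensLam C.toCGA n}
    (hx : tensD C n x = 0) : toCocycle C n (ofCoords C.toCGA n (coords C.toCGA x)) = x := by
  conv_rhs => rw [eq_tensProj_sub_tensCorr hx]
  rw [← tensProj_eq_ofCoords, toCocycle, LinearMap.sub_apply, tensCorr_tensProj, tensProj,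
    tensLin_tensLin, LinearMap.comp_id]
  congr 3
  refine LinearMap.ext fun l => ?_
  have h := lamProj_add (lamProj k n l)
  rwa [lamD_lamProj, mul_zero, add_zero] at h

/-- The criterion by which identities in K_alg(C) are checked below: top coefficients along all
surjections suffice. -/
lemma cocycle_ext {C : CDGA k} {n : ℕ} {x y : tensLam C.toCGA n}
    (hx : tensD C n x = 0) (hy : tensD C n y = 0)
    (h : ∀ I, coords C.toCGA x I = coords C.toCGA y I) : x = y := by
  rw [← toCocycle_ofCoords_coords hx, ← toCocycle_ofCoords_coords hy, funext h]

/-- The zeroth coface map acts on top coefficients by the differential, up to sign. -/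
lemma topCoeff_tensAct_succ {C : CDGA k} {n : ℕ} {x : tensLam C.toCGA n}
    (hx : x ∈ cocycles C n) : topCoeff C.toCGA (n + 1) (tensAct C.toCGA Fin.succ x)
      = (-1 : k) ^ (n + 1) • C.d (topCoeff C.toCGA n x) := by
  have h1 : topCoeff C.toCGA (n + 1) (tensAct C.toCGA Fin.succ (tensProj C.toCGA n x)) = 0 := by
    rw [tensAct_eq, tensProj, tensLin_tensLin]
    refine topCoeff_tensLin_eq_zero _ (fun l => ?_) x
    rw [LinearMap.comp_apply, AlgHom.toLinearMap_apply, AlgHom.toLinearMap_apply]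
    exact topForm_lamMap_succ_lamProj l
  -- The projected part contributes nothing after d^0. The whole value comes from the correction,
  -- which carries the differential of C, because d^0 turns its factor e_0 into e_1.
  have h2 : topCoeff C.toCGA (n + 1) (tensAct C.toCGA Fin.succ (tensCorr C n x))
      = - C.sgn (C.d (topCoeff C.toCGA n x)) := by
    rw [tensAct_eq, tensCorr, tensLin_tensLin, topCoeff,
      tensForm_tensLin C.toCGA (φ := - topForm k n) (fun l => by
        rw [LinearMap.comp_apply, AlgHom.toLinearMap_apply, LinearMap.mulLeft_apply,
          topForm_lamMap_succ_lamZero_mul, LinearMap.neg_apply]),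
      tensForm_neg, map_neg]
    rfl
  conv_lhs => rw [eq_tensProj_sub_tensCorr hx.2]
  rw [map_sub, map_sub, h1, h2, ← C.sgn_of_mem (C.d_mem (topCoeff_mem hx.1)), zero_sub, neg_neg]

/-! ## Maps of `Δ₊` -/

namespace DeltaPlus

/-- The underlying function of a map of `Δ₊`. -/
abbrev fn {m n : ℕ} (f : mk m ⟶ mk n) : Fin (m + 1) → Fin (n + 1) := f.hom.toOrderHom

/-- The map of `Δ₊` given by a monotone function that fixes `0`. -/
def homMk {m n : ℕ} (α : Fin (m + 1) → Fin (n + 1)) (hα : Monotone α) (h0 : α 0 = 0) :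
    mk m ⟶ mk n :=
  ⟨SimplexCategory.mkHom ⟨α, hα⟩, h0⟩

lemma hom_ext {m n : ℕ} {f g : mk m ⟶ mk n} (h : ∀ j, fn f j = fn g j) : f = g :=
  WideSubcategory.hom_ext _ (SimplexCategory.Hom.ext _ _ (OrderHom.ext _ _ (funext h)))

lemma fn_zero {m n : ℕ} (f : mk m ⟶ mk n) : fn f 0 = 0 := f.property

lemma fn_monotone {m n : ℕ} (f : mk m ⟶ mk n) : Monotone (fn f) := f.hom.toOrderHom.monotone

/-- A map misses the value `i + 1`. -/
def Misses {m n : ℕ} (f : mk m ⟶ mk n) (i : Fin n) : Prop := ∀ j, fn f j ≠ i.succ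

lemma surjective_or_misses {m n : ℕ} (f : mk m ⟶ mk n) :
    Function.Surjective (fn f) ∨ ∃ i, Misses f i := by
  by_cases h : Function.Surjective (fn f)
  · exact Or.inl h
  · right
    simp only [Function.Surjective, not_forall, not_exists] at h
    obtain ⟨b, hb⟩ := h
    obtain ⟨i, rfl⟩ := Fin.exists_succ_eq.2 (show b ≠ 0 from fun h => hb 0 (h ▸ fn_zero f))
    exact ⟨i, hb⟩

/-- The endomorphism of `[p]` that moves `j + 1` to `j` and fixes the other elements. -/
def merge {p : ℕ} (j : Fin p) : mk p ⟶ mk p :=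
  homMk (fun x => if x = j.succ then j.castSucc else x)
    (fun a b h => by
      dsimp only
      split_ifs with h1 h2 h2
      · exact le_rfl
      · rw [Fin.le_def, Fin.val_castSucc]
        rw [h1, Fin.le_def, Fin.val_succ] at h
        omega
      · rw [h2] at h
        rw [Fin.le_def, Fin.val_castSucc]
        rw [Fin.le_def, Fin.val_succ] at h
        rw [Fin.ext_iff, Fin.val_succ] at h1
        omega
      · exact h)
    (if_neg (Fin.succ_ne_zero j).symm)

lemma fn_merge {p : ℕ} (j : Fin p) (x : Fin (p + 1)) :
    fn (merge j) x = if x = j.succ then j.castSucc else x := rfl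

lemma misses_merge {p : ℕ} (j : Fin p) : Misses (merge j) j := fun x => by
  rw [fn_merge]
  split_ifs with h
  · exact Fin.castSucc_lt_succ.ne
  · exact h

lemma comp_merge_of_misses {m p : ℕ} {f : mk m ⟶ mk p} {i : Fin p} (hf : Misses f i) :
    f ≫ merge i = f :=
  hom_ext fun x => if_neg (hf x)

lemma misses_comp_merge {m p : ℕ} {f : mk m ⟶ mk p} {i j : Fin p} (hf : Misses f i) (h : j < i) :
    Misses (f ≫ merge j) i := fun x => by
  change fn (merge j) (fn f x) ≠ i.succ
  rw [fn_merge]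
  split_ifs with h1
  · rw [Ne, Fin.ext_iff]
    simp only [Fin.val_castSucc, Fin.val_succ]
    rw [Fin.lt_def] at h
    omega
  · exact hf x

lemma fn_σ {n : ℕ} (i : Fin (n + 1)) (x : Fin (n + 2)) : fn (σ i) x = Fin.predAbove i x := rfl

lemma val_predAbove {n : ℕ} (i : Fin (n + 1)) (x : Fin (n + 2)) :
    (Fin.predAbove i x : ℕ) = if (i : ℕ) < x then (x : ℕ) - 1 else x := by
  by_cases h : i.castSucc < x
  · rw [Fin.predAbove_of_castSucc_lt i x h, if_pos (by simpa [Fin.lt_def] using h), Fin.val_pred]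
  · rw [Fin.predAbove_of_le_castSucc i x (not_lt.1 h), if_neg (by simpa [Fin.lt_def] using h)]
    rfl

lemma merge_comp_σ_self {n : ℕ} (i : Fin (n + 1)) : merge i ≫ σ i = σ i := by
  refine hom_ext fun x => ?_
  change fn (σ i) (fn (merge i) x) = _
  rw [fn_merge]
  split_ifs with h
  · subst h
    rw [fn_σ, fn_σ, Fin.ext_iff, val_predAbove, val_predAbove]
    simp
  · rfl

lemma merge_comp_σ {n : ℕ} {i j : Fin (n + 1)} (h : i < j) :
    ∃ g : mk n ⟶ mk n, merge j ≫ σ i = σ i ≫ g := by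
  rw [Fin.lt_def] at h
  -- The codegeneracy s^i lowers every index above i by one, so merging at j becomes merging at j -
  -- 1.
  refine ⟨merge ⟨j - 1, by omega⟩, hom_ext fun x => ?_⟩
  change fn (σ i) (fn (merge j) x) = fn (merge _) (fn (σ i) x)
  rw [fn_merge, fn_merge, fn_σ]
  by_cases hx : x = j.succ
  · have hx' : Fin.predAbove i x = (⟨j - 1, by omega⟩ : Fin n).succ := by
      rw [Fin.ext_iff, val_predAbove, hx]
      simp only [Fin.val_succ]
      split_ifs <;> omega
    rw [if_pos hx, fn_σ, if_pos hx', Fin.ext_iff, val_predAbove]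
    simp [h]
  · rw [if_neg hx, fn_σ, if_neg]
    intro hx'
    rw [Fin.ext_iff, val_predAbove] at hx'
    rw [Fin.ext_iff] at hx
    simp only [Fin.val_succ] at hx hx'
    split_ifs at hx' <;> omega

lemma merge_factors {n : ℕ} (i : Fin (n + 1)) :
    ∃ g : mk n ⟶ mk (n + 1), merge i = σ i ≫ g := by
  -- The second factor is the coface d^(i+1), which belongs to Δ₊ because i + 1 ≠ 0.
  refine ⟨homMk i.succ.succAbove (Fin.strictMono_succAbove _).monotone
    (Fin.succAbove_ne_zero_zero (Fin.succ_ne_zero i)), hom_ext fun x => ?_⟩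
  change _ = i.succ.succAbove (Fin.predAbove i x)
  rw [fn_merge, Fin.ext_iff]
  rcases lt_trichotomy x i.succ with h | h | h
  · have h' : x ≤ i.castSucc := Fin.le_castSucc_iff.2 h
    rw [if_neg h.ne, Fin.predAbove_of_le_castSucc _ _ h', Fin.succAbove_of_castSucc_lt _ _ (by simpa)]
    simp
  · subst h
    rw [if_pos rfl, Fin.predAbove_succ_self, Fin.succAbove_of_castSucc_lt _ _ (by simp)]
  · rw [if_neg h.ne', Fin.predAbove_of_castSucc_lt _ _ (Fin.castSucc_lt_succ.trans h),
      Fin.succAbove_of_le_castSucc]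
    · simp
    · rw [Fin.le_def, Fin.val_castSucc, Fin.val_pred, Fin.val_succ]
      rw [Fin.lt_def, Fin.val_succ] at h
      omega

/-- The surjection attached to a set `I` of jumps. -/
def surj {n : ℕ} (I : Finset (Fin n)) : mk n ⟶ mk I.card :=
  homMk (countLT I) (countLT_monotone I) (countLT_zero I)

end DeltaPlus

open DeltaPlus

/-! ## The projection onto normalized cochains -/

section NormProj

variable (V : AlmostCosimplicialObject (ModuleCat.{u} k))

/-- The span of the images of the maps of `Δ₊` that miss the value `i + 1`. -/
def decAt {p : ℕ} (i : Fin p) : Submodule k (V.obj (mk p)) :=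
  Submodule.span k {y | ∃ (m : ℕ) (f : mk m ⟶ mk p) (x : V.obj (mk m)), Misses f i ∧
    y = (V.map f).hom x}

/-- The span of the images of the maps of `Δ₊` that are not surjective. -/
def decSub (p : ℕ) : Submodule k (V.obj (mk p)) := ⨆ i, decAt V i

variable {V}

lemma map_mem_decSub {m p : ℕ} {f : mk m ⟶ mk p} {i : Fin p} (hf : Misses f i)
    (x : V.obj (mk m)) : (V.map f).hom x ∈ decSub V p :=
  Submodule.mem_iSup_of_mem i (Submodule.subset_span ⟨m, f, x, hf, rfl⟩)

lemma map_comp_apply {l m n : ℕ} (f : mk l ⟶ mk m) (g : mk m ⟶ mk n) (x : V.obj (mk l)) :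
    (V.map (f ≫ g)).hom x = (V.map g).hom ((V.map f).hom x) := by
  rw [V.map_comp]; rfl

lemma map_id_apply {l : ℕ} (x : V.obj (mk l)) : (V.map (𝟙 (mk l))).hom x = x := by
  rw [V.map_id]; rfl

variable (V) in
/-- The partial products of the operators `1 - merge j`. -/
def normStep (p : ℕ) : ℕ → (V.obj (mk p) →ₗ[k] V.obj (mk p))
  | 0 => LinearMap.id
  | j + 1 => if h : j < p then normStep p j - (V.map (merge ⟨j, h⟩)).hom ∘ₗ normStep p j
      else normStep p j

variable (V) in
/-- The projection of `V^p` onto the normalized cochains, along `decSub`. -/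
def normProj (p : ℕ) : V.obj (mk p) →ₗ[k] V.obj (mk p) := normStep V p p

lemma normStep_succ {p j : ℕ} (h : j < p) (x : V.obj (mk p)) : normStep V p (j + 1) x
    = normStep V p j x - (V.map (merge ⟨j, h⟩)).hom (normStep V p j x) := by
  rw [normStep, dif_pos h]; rfl

lemma sub_normStep_mem (p j : ℕ) (x : V.obj (mk p)) : x - normStep V p j x ∈ decSub V p := by
  induction j with
  | zero => simp [normStep]
  | succ j ih =>
    by_cases h : j < p
    · rw [normStep_succ h, ← sub_add]
      exact add_mem ih (map_mem_decSub (misses_merge _) _)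
    · rwa [normStep, dif_neg h]

lemma sub_normProj_mem {p : ℕ} (x : V.obj (mk p)) : x - normProj V p x ∈ decSub V p :=
  sub_normStep_mem p p x

lemma normProj_mem {p : ℕ} (x : V.obj (mk p)) : normProj V p x ∈ normSub V p := by
  cases p with
  | zero => trivial
  | succ p =>
    -- After j factors the codegeneracies s^i with i < j vanish. The factor 1 - merge j adds s^j,
    -- because s^j merge j = s^j. It keeps the earlier ones, because s^i merge j factors through s^i
    -- for i < j.
    suffices h : ∀ j : ℕ, j ≤ p + 1 → ∀ i : Fin (p + 1), (i : ℕ) < j →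
        (V.map (σ i)).hom (normStep V (p + 1) j x) = 0 from
      mem_normSub_succ.2 fun i => h (p + 1) le_rfl i i.2
    intro j
    induction j with
    | zero => intro _ i hi; omega
    | succ j ih =>
      intro hj i hi
      rw [normStep_succ (by omega), map_sub, ← map_comp_apply]
      rcases Nat.lt_succ_iff_lt_or_eq.1 hi with h | h
      · obtain ⟨g, hg⟩ := merge_comp_σ (i := i) (j := ⟨j, by omega⟩) h
        rw [hg, map_comp_apply, ih (by omega) i h, map_zero, sub_zero]
      · subst h
        rw [merge_comp_σ_self, sub_self]

/-- Each merge factors through a codegeneracy, so every factor 1 - merge j is the identity on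
normalized elements. -/
lemma normProj_of_mem {p : ℕ} {x : V.obj (mk p)} (hx : x ∈ normSub V p) :
    normProj V p x = x := by
  cases p with
  | zero => rfl
  | succ p =>
    suffices h : ∀ j : ℕ, normStep V (p + 1) j x = x from h _
    intro j
    induction j with
    | zero => rfl
    | succ j ih =>
      by_cases h : j < p + 1
      · obtain ⟨g, hg⟩ := merge_factors ⟨j, h⟩
        rw [normStep_succ h, ih, hg, map_comp_apply, mem_normSub_succ.1 hx, map_zero, sub_zero]
      · rwa [normStep, dif_neg h]

/-- On images of maps that miss i + 1, the factors with j < i stay among such images. The factor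
with j = i kills them, because merge i fixes them. With the previous lemmas, V^p splits as the
normalized part plus `decSub`. -/
lemma normProj_of_mem_decSub {p : ℕ} {x : V.obj (mk p)} (hx : x ∈ decSub V p) :
    normProj V p x = 0 := by
  rw [← LinearMap.mem_ker]
  revert x
  change decSub V p ≤ _
  refine iSup_le fun i x hx => ?_
  rw [LinearMap.mem_ker]
  have h1 : ∀ j : ℕ, j ≤ i → normStep V p j x ∈ decAt V i := by
    intro j
    induction j with
    | zero => exact fun _ => hx
    | succ j ih =>
      intro hj
      have hj' : j < p := lt_of_lt_of_le hj i.2.le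
      rw [normStep_succ hj']
      refine sub_mem (ih (by omega)) ?_
      generalize normStep V p j x = y at ih
      have hy := ih (by omega)
      induction hy using Submodule.span_induction with
      | zero => rw [map_zero]; exact zero_mem _
      | add x y _ _ h1 h2 => rw [map_add]; exact add_mem (h1 fun _ => ‹_›) (h2 fun _ => ‹_›)
      | smul r x _ h => rw [map_smul]; exact Submodule.smul_mem _ _ (h fun _ => ‹_›)
      | mem y hy =>
        obtain ⟨m, f, z, hf, rfl⟩ := hy
        rw [← map_comp_apply]
        exact Submodule.subset_span ⟨m, _, z,
          misses_comp_merge hf (Fin.lt_def.2 (Nat.lt_of_succ_le hj)), rfl⟩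
  have h2 : ∀ j : ℕ, (i : ℕ) < j → normStep V p j x = 0 := by
    intro j
    induction j with
    | zero => intro h; omega
    | succ j ih =>
      intro hj
      rcases Nat.lt_succ_iff_lt_or_eq.1 hj with h | h
      · by_cases hj' : j < p
        · rw [normStep_succ hj', ih h, map_zero, sub_zero]
        · rw [normStep, dif_neg hj', ih h]
      · subst h
        rw [normStep_succ i.2, sub_eq_zero]
        have hy := h1 i le_rfl
        generalize normStep V p i x = y at hy
        induction hy using Submodule.span_induction with
        | zero => rw [map_zero]
        | add x y _ _ h1 h2 => rw [map_add]; exact congrArg₂ _ h1 h2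
        | smul r x _ h => rw [map_smul]; exact congrArg _ h
        | mem y hy =>
          obtain ⟨m, f, z, hf, rfl⟩ := hy
          rw [← map_comp_apply, comp_merge_of_misses hf]
  exact h2 p i.2

end NormProj

/-! ## Linear maps out of an almost cosimplicial vector space -/

/-- A family of linear maps `V^p → C^p` that kill the images of the non-surjective maps. -/
@[ext]
structure NormHom (V : AlmostCosimplicialObject (ModuleCat.{u} k)) (C : CGA k) where
  ofFamily ::
  toFun : ∀ p : ℕ, V.obj (mk p) →ₗ[k] C.carrier
  mem : ∀ p x, toFun p x ∈ C.grading p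
  map_eq_zero : ∀ {m p : ℕ} (f : mk m ⟶ mk p) (i : Fin p) (x : V.obj (mk m)), Misses f i →
    toFun p ((V.map f).hom x) = 0

namespace NormHom

variable {V : AlmostCosimplicialObject (ModuleCat.{u} k)}

lemma eq_zero_of_mem {C : CGA k} (ψ : NormHom V C) {p : ℕ} {x : V.obj (mk p)}
    (hx : x ∈ decSub V p) : ψ.toFun p x = 0 := by
  rw [← LinearMap.mem_ker]
  revert x
  change decSub V p ≤ _
  refine iSup_le fun i => Submodule.span_le.2 ?_
  rintro _ ⟨m, f, x, hf, rfl⟩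
  exact ψ.map_eq_zero f i x hf

lemma apply_normProj {C : CGA k} (ψ : NormHom V C) {p : ℕ} (x : V.obj (mk p)) :
    ψ.toFun p (normProj V p x) = ψ.toFun p x := by
  have h := ψ.eq_zero_of_mem (sub_normProj_mem x)
  rw [map_sub, sub_eq_zero] at h
  exact h.symm

lemma ext_of_normSub {C : CGA k} {ψ ψ' : NormHom V C}
    (h : ∀ p, ∀ x ∈ normSub V p, ψ.toFun p x = ψ'.toFun p x) : ψ = ψ' := by
  refine NormHom.ext (funext fun p => LinearMap.ext fun x => ?_)
  rw [← ψ.apply_normProj, ← ψ'.apply_normProj, h p _ (normProj_mem x)]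

/-- The components of a map of graded vector spaces out of the normalized cochains. -/
def normApp {C : CGA k} (φ : (normalizedCochainsPlus k).obj V ⟶ (forgetCGA k).obj C) (p : ℕ) :
    normSub V p →ₗ[k] C.grading p := (φ p).hom

/-- The extension of a map of graded vector spaces from the normalized cochains. -/
def ofNorm {C : CGA k} (φ : (normalizedCochainsPlus k).obj V ⟶ (forgetCGA k).obj C) :
    NormHom V C where
  toFun p := (C.grading p).subtype ∘ₗ normApp φ p ∘ₗ
    (normProj V p).codRestrict (normSub V p) normProj_mem
  mem _ _ := Subtype.property _
  map_eq_zero {_ p} f i x hf := by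
    have h : (normProj V p).codRestrict (normSub V p) normProj_mem ((V.map f).hom x) = 0 :=
      Subtype.ext (normProj_of_mem_decSub (map_mem_decSub hf x))
    rw [LinearMap.comp_apply, LinearMap.comp_apply, h, map_zero, map_zero]

lemma ofNorm_apply {C : CGA k} (φ : (normalizedCochainsPlus k).obj V ⟶ (forgetCGA k).obj C)
    {p : ℕ} (x : normSub V p) : (ofNorm φ).toFun p x = normApp φ p x := by
  have h : (normProj V p).codRestrict (normSub V p) normProj_mem x.1 = x :=
    Subtype.ext (normProj_of_mem x.2)
  change (normApp φ p ((normProj V p).codRestrict (normSub V p) normProj_mem x.1)).1 = _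
  rw [h]

variable (V) in
/-- Families of maps on `V` are the same as maps on normalized cochains. -/
def normEquiv (C : CGA k) :
    ((normalizedCochainsPlus k).obj V ⟶ (forgetCGA k).obj C) ≃ NormHom V C where
  toFun φ := ofNorm φ
  invFun ψ := fun p => ModuleCat.ofHom (((ψ.toFun p) ∘ₗ (normSub V p).subtype).codRestrict
    (C.grading p) (fun _ => ψ.mem p _))
  left_inv φ := funext fun _ => ModuleCat.hom_ext (LinearMap.ext fun x =>
    Subtype.ext (ofNorm_apply φ x))
  right_inv _ := ext_of_normSub fun _ x hx => ofNorm_apply _ ⟨x, hx⟩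

/-! ### Reconstructing cocycles from their top coefficients -/

/-- The element of `C ⊗ Λ^n` with coordinates given by a `NormHom`. -/
def elt {C : CGA k} (ψ : NormHom V C) (n : ℕ) : V.obj (mk n) →ₗ[k] tensLam C n :=
  ofCoords C n ∘ₗ LinearMap.pi fun I => ψ.toFun I.card ∘ₗ (V.map (surj I)).hom

lemma elt_apply {C : CGA k} (ψ : NormHom V C) {n : ℕ} (x : V.obj (mk n)) :
    ψ.elt n x = ofCoords C n fun I => ψ.toFun I.card ((V.map (surj I)).hom x) := rfl

lemma elt_mem {C : CGA k} (ψ : NormHom V C) {n : ℕ} (x : V.obj (mk n)) :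
    ψ.elt n x ∈ tensDegZero C n :=
  ofCoords_mem fun _ => ψ.mem _ _

/-- The cocycle with coordinates given by a `NormHom`. -/
def cocycle {C : CDGA k} (ψ : NormHom V C.toCGA) (n : ℕ) : V.obj (mk n) →ₗ[k] cocycles C n :=
  (toCocycle C n ∘ₗ ψ.elt n).codRestrict (Subalgebra.toSubmodule (cocycles C n))
    (fun x => toCocycle_mem (ψ.elt_mem x))

lemma topCoeff_surj {C : CDGA k} (ψ : NormHom V C.toCGA) {n : ℕ} (x : V.obj (mk n)) (p : ℕ)
    (α : Fin (n + 1) → Fin (p + 1)) (hα : Monotone α) (h0 : α 0 = 0)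
    (hs : Function.Surjective α) :
    topCoeff C.toCGA p (tensAct C.toCGA α (ψ.cocycle n x).1)
      = ψ.toFun p ((V.map (homMk α hα h0)).hom x) := by
  obtain ⟨I, hI⟩ := exists_eq_countLT α hα hs
  -- The target p and the map α are variables, so the equality of dependent pairs can be eliminated
  -- and α becomes `countLT I`.
  cases hI
  have h := congrFun (coords_toCocycle (C := C) (ψ.elt n x)) I
  rw [elt_apply, coords_ofCoords] at h
  exact h

/-- For surjections this is the construction of the cocycle. For a map that misses a value, both
sides vanish. -/
lemma topCoeff_cocycle {C : CDGA k} (ψ : NormHom V C.toCGA) {n p : ℕ} (x : V.obj (mk n))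
    (f : mk n ⟶ mk p) : topCoeff C.toCGA p (tensAct C.toCGA (fn f) (ψ.cocycle n x).1)
      = ψ.toFun p ((V.map f).hom x) := by
  rcases surjective_or_misses f with h | ⟨i, h⟩
  · rw [ψ.topCoeff_surj x p (fn f) (fn_monotone f) (fn_zero f) h]
    exact congrArg (fun g => ψ.toFun p ((V.map g).hom x)) (hom_ext fun _ => rfl)
  · rw [topCoeff_tensAct_eq_zero C.toCGA i h, ψ.map_eq_zero f i x h]

lemma topCoeff_cocycle_self {C : CDGA k} (ψ : NormHom V C.toCGA) {n : ℕ} (x : V.obj (mk n)) :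
    topCoeff C.toCGA n (ψ.cocycle n x).1 = ψ.toFun n x := by
  have h := ψ.topCoeff_cocycle x (𝟙 (mk n))
  rw [map_id_apply] at h
  rw [← h]
  exact congrArg _ (tensAct_id _ _).symm

lemma coords_tensAct {C : CGA k} {m n : ℕ} (α : Fin (m + 1) → Fin (n + 1)) (x : tensLam C m)
    (I : Finset (Fin n)) :
    coords C (tensAct C α x) I = topCoeff C I.card (tensAct C (countLT I ∘ α) x) := by
  rw [coords, tensAct_tensAct]

lemma tensAct_cocycle_mem {C : CDGA k} {m n : ℕ} (α : Fin (m + 1) → Fin (n + 1))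
    (x : cocycles C m) : tensAct C.toCGA α x.1 ∈ cocycles C n :=
  (cocyclesMap (𝟙 C : C ⟶ C) α x).2

/-- The coordinate of either side at I is ψ applied to the image of x under f followed by the
surjection of I. -/
lemma cocycle_map {C : CDGA k} (ψ : NormHom V C.toCGA) {m n : ℕ} (f : mk m ⟶ mk n)
    (x : V.obj (mk m)) :
    (ψ.cocycle n ((V.map f).hom x)).1 = tensAct C.toCGA (fn f) (ψ.cocycle m x).1 := by
  refine cocycle_ext (ψ.cocycle _ _).2.2 (tensAct_cocycle_mem _ _).2 fun I => ?_
  rw [coords_tensAct]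
  refine (ψ.topCoeff_cocycle _ (surj I)).trans ?_
  rw [← map_comp_apply]
  exact (ψ.topCoeff_cocycle _ (f ≫ surj I)).symm

end NormHom

/-- The underlying almost cosimplicial vector space of `K_alg(C)`. -/
abbrev KPlusMod (C : CDGA k) : AlmostCosimplicialObject (ModuleCat.{u} k) :=
  ((Functor.whiskeringRight DeltaPlus _ _).obj (forgetComm k)).obj
    ((forgetCoface _).obj ((Kalg k).obj C))

/-- The underlying cosimplicial vector space of `K_alg(C)`. -/
abbrev KMod (C : CDGA k) : CosimplicialObject (ModuleCat.{u} k) :=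
  ((CosimplicialObject.whiskering _ _).obj (forgetComm k)).obj ((Kalg k).obj C)

section KPlus

variable (V : AlmostCosimplicialObject (ModuleCat.{u} k))

variable {V} in
/-- The components of a map into `K_alg(C)`. -/
def kPlusApp {C : CDGA k} (F : V ⟶ KPlusMod C) (p : ℕ) : V.obj (mk p) →ₗ[k] cocycles C p :=
  (F.app (mk p)).hom

variable {V} in
lemma kPlusApp_map {C : CDGA k} (F : V ⟶ KPlusMod C) {m p : ℕ} (f : mk m ⟶ mk p)
    (x : V.obj (mk m)) : (kPlusApp F p ((V.map f).hom x)).1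
      = tensAct C.toCGA (fn f) (kPlusApp F m x).1 :=
  congrArg (fun φ => (ModuleCat.Hom.hom φ x : cocycles C p).1) (F.naturality f)

/-- Maps of almost cosimplicial vector spaces `V → K_alg(C)` correspond to families of linear
maps `V^p → C^p`. -/
def kPlusEquiv (C : CDGA k) : (V ⟶ KPlusMod C) ≃ NormHom V C.toCGA where
  toFun F :=
    { toFun := fun p => topCoeff C.toCGA p ∘ₗ (cocycles C p).val.toLinearMap ∘ₗ kPlusApp F p
      mem := fun p x => topCoeff_mem (kPlusApp F p x).2.1
      map_eq_zero := fun {m p} f i x hf => by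
        change topCoeff C.toCGA p (kPlusApp F p ((V.map f).hom x)).1 = 0
        rw [kPlusApp_map]
        exact topCoeff_tensAct_eq_zero C.toCGA i hf _ }
  invFun ψ :=
    { app := fun X => ModuleCat.ofHom (ψ.cocycle X.obj.len)
      naturality := fun X Y f => by
        refine ModuleCat.hom_ext (LinearMap.ext fun x => Subtype.ext ?_)
        exact ψ.cocycle_map (m := X.obj.len) (n := Y.obj.len) f x }
  left_inv F := by
    ext X : 2
    refine ModuleCat.hom_ext (LinearMap.ext fun x => Subtype.ext ?_)
    refine cocycle_ext (NormHom.cocycle _ _ x).2.2 (kPlusApp F X.obj.len x).2.2 fun I => ?_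
    refine (NormHom.topCoeff_cocycle _ x (surj I)).trans ?_
    exact congrArg (topCoeff C.toCGA I.card) (kPlusApp_map F (surj I) x)
  right_inv ψ := NormHom.ext (funext fun p => LinearMap.ext fun x => ψ.topCoeff_cocycle_self x)

end KPlus

/-! ## Linear maps out of a cosimplicial vector space -/

section Cosimplicial

variable (V : CosimplicialObject (ModuleCat.{u} k))

/-- The underlying almost cosimplicial vector space. -/
abbrev plusMod : AlmostCosimplicialObject (ModuleCat.{u} k) := (forgetCoface _).obj V

variable {V}

variable (V) in
/-- The action of a map of `Δ` on a cosimplicial vector space. -/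
def fullAct {m n : ℕ} (f : SimplexCategory.mk m ⟶ SimplexCategory.mk n) :
    (plusMod V).obj (mk m) →ₗ[k] (plusMod V).obj (mk n) := (V.map f).hom

lemma fullAct_comp {l m n : ℕ} (f : SimplexCategory.mk l ⟶ SimplexCategory.mk m)
    (g : SimplexCategory.mk m ⟶ SimplexCategory.mk n) (x : (plusMod V).obj (mk l)) :
    fullAct V (f ≫ g) x = fullAct V g (fullAct V f x) := by
  rw [fullAct, V.map_comp]; rfl

/-- A map of `Δ₊` as a map of `Δ`. -/
def toSimplex {m n : ℕ} (f : mk m ⟶ mk n) : SimplexCategory.mk m ⟶ SimplexCategory.mk n := f.hom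

lemma fullAct_toSimplex {m n : ℕ} (f : mk m ⟶ mk n) (x : (plusMod V).obj (mk m)) :
    fullAct V (toSimplex f) x = ((plusMod V).map f).hom x := rfl

/-- A family of linear maps `V^p → C^p` is compatible with the zeroth coface maps and the
differential. -/
def NormHom.Compat {C : CDGA k} (ψ : NormHom (plusMod V) C.toCGA) : Prop :=
  ∀ (p : ℕ) (x : (plusMod V).obj (mk p)), ψ.toFun (p + 1) (fullAct V (SimplexCategory.δ 0) x)
    = (-1 : k) ^ (p + 1) • C.d (ψ.toFun p x)

lemma topCoeff_cofaceZero {C : CDGA k} {n : ℕ} (x : cocycles C n) :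
    topCoeff C.toCGA (n + 1) (tensAct C.toCGA (SimplexCategory.δ (n := n) 0).toOrderHom x.1)
      = (-1 : k) ^ (n + 1) • C.d (topCoeff C.toCGA n x.1) := by
  rw [← topCoeff_tensAct_succ x.2]
  congr 2

/-- A monotone map that does not fix 0 avoids 0 altogether. So Δ is generated by Δ₊ and the zeroth
cofaces. -/
lemma eq_comp_cofaceZero {n p : ℕ} (f : SimplexCategory.mk n ⟶ SimplexCategory.mk (p + 1))
    (h : f.toOrderHom 0 ≠ 0) :
    ∃ g : SimplexCategory.mk n ⟶ SimplexCategory.mk p, f = g ≫ SimplexCategory.δ 0 := by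
  have h' : ∀ j, f.toOrderHom j ≠ 0 := fun j hj =>
    h (le_antisymm (hj ▸ f.toOrderHom.monotone (Fin.zero_le j)) (Fin.zero_le _))
  refine ⟨SimplexCategory.mkHom ⟨fun j => (f.toOrderHom j).pred (h' j), fun a b hab =>
    Fin.pred_le_pred_iff.2 (f.toOrderHom.monotone hab)⟩, SimplexCategory.Hom.ext _ _
      (OrderHom.ext _ _ (funext fun j => ?_))⟩
  exact (Fin.succ_pred _ (h' j)).symm

namespace NormHom

/-- Induction on the target: a map outside Δ₊ splits off a d^0, which acts as the same ± d on both
sides, by compatibility of ψ and by `topCoeff_cofaceZero`. -/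
lemma Compat.topCoeff_cocycle {C : CDGA k} {ψ : NormHom (plusMod V) C.toCGA} (hψ : ψ.Compat)
    {n p : ℕ} (x : (plusMod V).obj (mk n)) (f : SimplexCategory.mk n ⟶ SimplexCategory.mk p) :
    topCoeff C.toCGA p (tensAct C.toCGA f.toOrderHom (ψ.cocycle n x).1)
      = ψ.toFun p (fullAct V f x) := by
  induction p with
  | zero => exact ψ.topCoeff_cocycle x ⟨f, Subsingleton.elim (α := Fin 1) _ _⟩
  | succ p ih =>
    by_cases h : f.toOrderHom 0 = 0
    · exact ψ.topCoeff_cocycle x ⟨f, h⟩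
    · obtain ⟨g, rfl⟩ := eq_comp_cofaceZero f h
      rw [fullAct_comp, hψ, ← ih g]
      refine Eq.trans ?_ (topCoeff_cofaceZero ⟨_, tensAct_cocycle_mem g.toOrderHom (ψ.cocycle n x)⟩)
      rw [tensAct_tensAct]
      rfl

lemma Compat.cocycle_map {C : CDGA k} {ψ : NormHom (plusMod V) C.toCGA} (hψ : ψ.Compat)
    {m n : ℕ} (f : SimplexCategory.mk m ⟶ SimplexCategory.mk n) (x : (plusMod V).obj (mk m)) :
    (ψ.cocycle n (fullAct V f x)).1 = tensAct C.toCGA f.toOrderHom (ψ.cocycle m x).1 := by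
  refine cocycle_ext (ψ.cocycle _ _).2.2 (tensAct_cocycle_mem _ _).2 fun I => ?_
  rw [coords_tensAct]
  refine (hψ.topCoeff_cocycle _ (toSimplex (surj I))).trans ?_
  rw [← fullAct_comp]
  exact (hψ.topCoeff_cocycle _ (f ≫ (toSimplex (surj I)))).symm

/-- If f misses i + 1, then d^0 f = g d^0 where g lies in Δ₊ and misses i + 2, so ψ vanishes on the
result. -/
lemma cofaceZero_eq_zero {C : CGA k} (ψ : NormHom (plusMod V) C) {p : ℕ}
    {x : (plusMod V).obj (mk p)} (hx : x ∈ decSub (plusMod V) p) :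
    ψ.toFun (p + 1) (fullAct V (SimplexCategory.δ 0) x) = 0 := by
  rw [← LinearMap.comp_apply, ← LinearMap.mem_ker]
  revert x
  change decSub (plusMod V) p ≤ _
  refine iSup_le fun i => Submodule.span_le.2 ?_
  rintro _ ⟨m, f, x, hf, rfl⟩
  rw [SetLike.mem_coe, LinearMap.mem_ker, LinearMap.comp_apply, ← fullAct_toSimplex, ← fullAct_comp]
  -- The join of a new least element with f.
  let g : mk (m + 1) ⟶ mk (p + 1) := homMk (Fin.cases 0 (fun j => (fn f j).succ))
    (fun a b h => by
      induction a using Fin.cases with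
      | zero => exact Fin.zero_le _
      | succ a =>
        induction b using Fin.cases with
        | zero => exact absurd h (by simp)
        | succ b =>
          exact Fin.succ_le_succ_iff.2 (fn_monotone f (Fin.succ_le_succ_iff.1 h))) rfl
  have e : toSimplex f ≫ SimplexCategory.δ 0 = SimplexCategory.δ 0 ≫ toSimplex g := by
    refine SimplexCategory.Hom.ext _ _ (OrderHom.ext _ _ (funext fun j => ?_))
    rfl
  rw [e, fullAct_comp, fullAct_toSimplex]
  refine ψ.map_eq_zero g i.succ _ fun j => ?_
  induction j using Fin.cases with
  | zero => exact (Fin.succ_ne_zero _).symm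
  | succ j => exact fun h => hf j (Fin.succ_injective _ h)

/-- The coface d^(j+1) lies in Δ₊ and misses j + 1, so ψ kills its image. Only the d^0 term of the
alternating sum survives. -/
lemma apply_cobdry {C : CGA k} (ψ : NormHom (plusMod V) C) {p : ℕ} (x : (plusMod V).obj (mk p)) :
    ψ.toFun (p + 1) (cobdry V p x)
      = (-1 : k) ^ (p + 1) • ψ.toFun (p + 1) (fullAct V (SimplexCategory.δ 0) x) := by
  have h : cobdry V p x = ∑ i : Fin (p + 2), (-1 : k) ^ (p + 1 + (i : ℕ)) •
      fullAct V (SimplexCategory.δ i) x := by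
    unfold cobdry
    exact LinearMap.sum_apply _ _ _
  refine (congrArg (ψ.toFun (p + 1)) h).trans ?_
  rw [map_sum, Finset.sum_eq_single 0]
  · rw [map_smul]
    rfl
  · intro i _ hi
    obtain ⟨j, rfl⟩ := Fin.exists_succ_eq.2 hi
    let g : mk p ⟶ mk (p + 1) := ⟨SimplexCategory.δ j.succ, Fin.succAbove_ne_zero_zero hi⟩
    have : ψ.toFun (p + 1) (fullAct V (SimplexCategory.δ j.succ) x) = 0 :=
      ψ.map_eq_zero g j x fun a => Fin.succAbove_ne _ _
    rw [map_smul, this, smul_zero]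
  · simp

/-- Both sides of the compatibility equation vanish on `decSub`, so normalized elements suffice. On
these, d^0 and the full coboundary have the same image under ψ up to the sign (-1)^(p+1). -/
lemma compat_iff {C : CDGA k} (ψ : NormHom (plusMod V) C.toCGA) : ψ.Compat ↔
    ∀ p, ∀ x ∈ normSub (plusMod V) p,
      ψ.toFun (p + 1) (cobdry V p x) = C.d (ψ.toFun p x) := by
  have e : ∀ p : ℕ, (-1 : k) ^ p * (-1 : k) ^ p = 1 := fun p => by rw [← mul_pow]; simp
  constructor
  · intro h p x _
    rw [apply_cobdry, h, smul_smul, e, one_smul]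
  · intro h p x
    have h1 := ψ.cofaceZero_eq_zero (sub_normProj_mem x)
    rw [map_sub, map_sub, sub_eq_zero] at h1
    have h2 := h p _ (normProj_mem x)
    rw [apply_cobdry, ← h1, ψ.apply_normProj] at h2
    rw [← h2, smul_smul, e, one_smul]

end NormHom

/-- The restriction of a map of cosimplicial vector spaces to `Δ₊`. -/
def restrictHom {C : CDGA k} (F : V ⟶ KMod C) : plusMod V ⟶ KPlusMod C :=
  (forgetCoface _).map F

lemma restrictHom_fullAct {C : CDGA k} (F : V ⟶ KMod C) {m n : ℕ}
    (f : SimplexCategory.mk m ⟶ SimplexCategory.mk n) (x : (plusMod V).obj (mk m)) :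
    (kPlusApp (restrictHom F) n (fullAct V f x)).1
      = tensAct C.toCGA f.toOrderHom (kPlusApp (restrictHom F) m x).1 :=
  congrArg (fun φ => (ModuleCat.Hom.hom φ x : cocycles C n).1) (F.naturality f)

lemma kPlusEquiv_apply {W : AlmostCosimplicialObject (ModuleCat.{u} k)} {C : CDGA k}
    (F : W ⟶ KPlusMod C) {p : ℕ} (x : W.obj (mk p)) :
    (kPlusEquiv W C F).toFun p x = topCoeff C.toCGA p (kPlusApp F p x).1 := rfl

lemma kPlusEquiv_restrictHom_compat {C : CDGA k} (F : V ⟶ KMod C) :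
    (kPlusEquiv _ C (restrictHom F)).Compat := fun p x => by
  rw [kPlusEquiv_apply, kPlusEquiv_apply, restrictHom_fullAct]
  exact topCoeff_cofaceZero _

variable (V) in
/-- Maps of cosimplicial vector spaces `V → K_alg(C)` correspond to compatible families of linear
maps `V^p → C^p`. -/
def kEquiv (C : CDGA k) :
    (V ⟶ KMod C) ≃ {ψ : NormHom (plusMod V) C.toCGA // ψ.Compat} where
  toFun F := ⟨kPlusEquiv _ C (restrictHom F), kPlusEquiv_restrictHom_compat F⟩
  invFun ψ :=
    { app := fun n => ModuleCat.ofHom (ψ.1.cocycle n.len)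
      naturality := fun m n f => by
        refine ModuleCat.hom_ext (LinearMap.ext fun x => Subtype.ext ?_)
        exact ψ.2.cocycle_map (m := m.len) (n := n.len) f x }
  left_inv F := by
    refine NatTrans.ext (funext fun n => ?_)
    exact congrArg (fun G => NatTrans.app G (mk n.len))
      ((kPlusEquiv (plusMod V) C).left_inv (restrictHom F))
  right_inv ψ := Subtype.ext ((kPlusEquiv (plusMod V) C).right_inv ψ.1)

variable (V) in
/-- The differential of the normalized cochains. -/
def normCobdry (p : ℕ) : ModuleCat.of k (normSub (plusMod V) p) ⟶
    ModuleCat.of k (normSub (plusMod V) (p + 1)) :=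
  ModuleCat.ofHom ((cobdry V p).restrict (cobdry_mem V p))

lemma normalizedCochains_d (p : ℕ) :
    ((normalizedCochains k).obj V).d p (p + 1) = normCobdry V p := by
  simp only [normalizedCochains, CochainComplex.of_d]
  rfl

/-- A map of cochain complexes out of the normalized cochains gives a compatible family. -/
def normEquivCompat (C : CDGA k) : ((normalizedCochains k).obj V ⟶ (forgetCDGA k).obj C) ≃
    {ψ : NormHom (plusMod V) C.toCGA // ψ.Compat} where
  toFun φ := ⟨NormHom.normEquiv (plusMod V) C.toCGA φ.f, by
    rw [NormHom.compat_iff]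
    intro p x hx
    have h := congrArg (fun φ => ((ModuleCat.Hom.hom φ (⟨x, hx⟩ : normSub (plusMod V) p) :
      C.grading (p + 1)) : C.carrier)) (φ.comm p (p + 1))
    rw [forgetCDGA_d, normalizedCochains_d] at h
    have e1 := NormHom.ofNorm_apply (C := C.toCGA) φ.f (⟨x, hx⟩ : normSub (plusMod V) p)
    have e2 := NormHom.ofNorm_apply (C := C.toCGA) φ.f
      (⟨cobdry V p x, cobdry_mem V p x hx⟩ : normSub (plusMod V) (p + 1))
    refine e2.trans (h.symm.trans ?_)
    exact congrArg C.d e1.symm⟩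
  invFun ψ :=
    { f := (NormHom.normEquiv (plusMod V) C.toCGA).symm ψ.1
      comm' := by
        rintro i j rfl
        rw [forgetCDGA_d, normalizedCochains_d]
        refine ModuleCat.hom_ext (LinearMap.ext fun x => Subtype.ext ?_)
        exact ((NormHom.compat_iff ψ.1).1 ψ.2 i x.1 x.2).symm }
  left_inv φ := HomologicalComplex.hom_ext _ _ fun i =>
    congrFun ((NormHom.normEquiv (plusMod V) C.toCGA).left_inv φ.f) i
  right_inv ψ := Subtype.ext ((NormHom.normEquiv (plusMod V) C.toCGA).right_inv ψ.1)

end Cosimplicial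

/-! ## The adjunctions for (almost) cosimplicial vector spaces -/

namespace NormHom

variable {V W : AlmostCosimplicialObject (ModuleCat.{u} k)}

/-- Composition with a map of graded commutative algebras. -/
def map {B C : CGA k} (ψ : NormHom V B) (h : B ⟶ C) : NormHom V C where
  toFun p := h.toAlgHom.toLinearMap ∘ₗ ψ.toFun p
  mem p x := h.map_mem (ψ.mem p x)
  map_eq_zero f i x hf := (congrArg h.toAlgHom (ψ.map_eq_zero f i x hf)).trans (map_zero _)

lemma map_apply {B C : CGA k} (ψ : NormHom V B) (h : B ⟶ C) {p : ℕ} (x : V.obj (mk p)) :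
    (ψ.map h).toFun p x = h.toAlgHom (ψ.toFun p x) := rfl

/-- Composition with a map of almost cosimplicial vector spaces. -/
def comap {C : CGA k} (ψ : NormHom W C) (f : V ⟶ W) : NormHom V C where
  toFun p := ψ.toFun p ∘ₗ (f.app (mk p)).hom
  mem p x := ψ.mem p _
  map_eq_zero {m p} g i x hg := by
    have h : (f.app (mk p)).hom ((V.map g).hom x) = (W.map g).hom ((f.app (mk m)).hom x) :=
      congrArg (fun φ => ModuleCat.Hom.hom φ x) (f.naturality g)
    rw [LinearMap.comp_apply, h]
    exact ψ.map_eq_zero g i _ hg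

lemma map_elt {B C : CGA k} (ψ : NormHom V B) (h : B ⟶ C) {n : ℕ} (x : V.obj (mk n)) :
    (ψ.map h).elt n x = tensMap h id (ψ.elt n x) := by
  rw [elt_apply, elt_apply, tensMap_ofCoords]
  rfl

lemma normEquiv_map_comp {C : CGA k} (f : V ⟶ W)
    (φ : (normalizedCochainsPlus k).obj W ⟶ (forgetCGA k).obj C) :
    normEquiv V C ((normalizedCochainsPlus k).map f ≫ φ) = (normEquiv W C φ).comap f := by
  refine ext_of_normSub fun p x hx => ?_
  refine (ofNorm_apply _ ⟨x, hx⟩).trans ?_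
  exact (ofNorm_apply φ ⟨_, normSub_map f p x hx⟩).symm

end NormHom

lemma kPlusEquiv_comp {V : AlmostCosimplicialObject (ModuleCat.{u} k)} {B C : CDGA k}
    (F : V ⟶ KPlusMod B) (h : B ⟶ C) :
    kPlusEquiv V C (F ≫ ((Functor.whiskeringRight DeltaPlus _ _).obj (forgetComm k)).map
      ((forgetCoface _).map ((Kalg k).map h))) = (kPlusEquiv V B F).map h.toHom :=
  NormHom.ext (funext fun p => LinearMap.ext fun x =>
    topCoeff_tensMap (A := B.toCGA) (B := C.toCGA) h.toHom (kPlusApp F p x).1)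

variable (k)

/-- `Sym₊^* ∘ N₊` is left adjoint to the underlying functor of `K_alg⁺`. -/
def normSymPlusAdj : normalizedCochainsPlus k ⋙ symCGA k ⊣
    KalgPlus k ⋙ (Functor.whiskeringRight DeltaPlus _ _).obj (forgetComm k) :=
  let e (V : AlmostCosimplicialObject (ModuleCat.{u} k)) (C : CGA k) :
      ((symCGA k).obj ((normalizedCochainsPlus k).obj V) ⟶ C) ≃
        (V ⟶ KPlusMod ((zeroDiff k).obj C)) :=
    ((symCGAAdj k).homEquiv _ C).trans
        ((NormHom.normEquiv V C).trans (kPlusEquiv V ((zeroDiff k).obj C)).symm)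
  Adjunction.mkOfHomEquiv
    { homEquiv := e
      homEquiv_naturality_left_symm := fun {V W C} f g => by
        -- The identity is transported to families V^p → C^p, where precomposition with f is
        -- `comap`.
        refine (e V C).injective ?_
        refine ((e V C).apply_symm_apply (f ≫ g)).trans ?_
        refine (kPlusEquiv V ((zeroDiff k).obj C)).injective ?_
        refine Eq.trans ?_ ((kPlusEquiv V ((zeroDiff k).obj C)).apply_symm_apply _).symm
        refine Eq.trans ?_ (congrArg (NormHom.normEquiv V C)
          ((symCGAAdj k).homEquiv_naturality_left ((normalizedCochainsPlus k).map f)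
            ((e W C).symm g))).symm
        rw [NormHom.normEquiv_map_comp]
        have h := congrArg (kPlusEquiv W ((zeroDiff k).obj C)) ((e W C).apply_symm_apply g)
        have h' := ((kPlusEquiv W ((zeroDiff k).obj C)).apply_symm_apply
          (NormHom.normEquiv W C ((symCGAAdj k).homEquiv _ C ((e W C).symm g)))).symm.trans h
        exact congrArg (fun ψ => NormHom.comap ψ f) h'.symm
      homEquiv_naturality_right := fun {V B C} f g => by
        refine (kPlusEquiv V ((zeroDiff k).obj C)).injective ?_
        refine ((kPlusEquiv V ((zeroDiff k).obj C)).apply_symm_apply _).trans ?_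
        refine Eq.trans ?_ (kPlusEquiv_comp (e V B f) ((zeroDiff k).map g)).symm
        refine (congrArg (NormHom.normEquiv V C)
          ((symCGAAdj k).homEquiv_naturality_right f g)).trans ?_
        exact congrArg (fun ψ => NormHom.map ψ g) ((kPlusEquiv V
          ((zeroDiff k).obj B)).apply_symm_apply
            (NormHom.normEquiv V B ((symCGAAdj k).homEquiv _ B f))).symm }

/-- `Sym^* ∘ N` is left adjoint to the underlying functor of `K_alg`. -/
def normSymAdj : normalizedCochains k ⋙ symCDGA k ⊣
    Kalg k ⋙ (CosimplicialObject.whiskering _ _).obj (forgetComm k) :=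
  let e (V : CosimplicialObject (ModuleCat.{u} k)) (C : CDGA k) :
      ((symCDGA k).obj ((normalizedCochains k).obj V) ⟶ C) ≃ (V ⟶ KMod C) :=
    ((symCDGAAdj k).homEquiv _ C).trans ((normEquivCompat C).trans (kEquiv V C).symm)
  Adjunction.mkOfHomEquiv
    { homEquiv := e
      homEquiv_naturality_left_symm := fun {V W C} f g => by
        refine (e V C).injective ?_
        refine ((e V C).apply_symm_apply (f ≫ g)).trans ?_
        refine (kEquiv V C).injective ?_
        refine Eq.trans ?_ ((kEquiv V C).apply_symm_apply _).symm
        refine Eq.trans ?_ (congrArg (normEquivCompat C)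
          ((symCDGAAdj k).homEquiv_naturality_left ((normalizedCochains k).map f)
            ((e W C).symm g))).symm
        refine Subtype.ext ?_
        refine Eq.trans ?_ (NormHom.normEquiv_map_comp ((forgetCoface _).map f) _).symm
        have h := congrArg (kEquiv W C) ((e W C).apply_symm_apply g)
        have h' := ((kEquiv W C).apply_symm_apply
          (normEquivCompat C ((symCDGAAdj k).homEquiv _ C ((e W C).symm g)))).symm.trans h
        exact congrArg (fun ψ => NormHom.comap ψ.1 ((forgetCoface _).map f)) h'.symm
      homEquiv_naturality_right := fun {V B C} f g => by
        refine (kEquiv V C).injective ?_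
        refine ((kEquiv V C).apply_symm_apply _).trans ?_
        refine Subtype.ext ?_
        refine Eq.trans ?_ (kPlusEquiv_comp (restrictHom (e V B f)) g).symm
        refine (congrArg (fun φ => (normEquivCompat C φ).1)
          ((symCDGAAdj k).homEquiv_naturality_right f g)).trans ?_
        exact congrArg (fun ψ => NormHom.map ψ.1 g.toHom) ((kEquiv V B).apply_symm_apply
            (normEquivCompat B ((symCDGAAdj k).homEquiv _ B f))).symm }

variable {k}

/-! ## Multiplicative families -/

/-- The underlying almost cosimplicial vector space of an almost cosimplicial algebra. -/
abbrev plusUnder (A : AlmostCosimplicialCommAlg k) : AlmostCosimplicialObject (ModuleCat.{u} k) :=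
  ((Functor.whiskeringRight DeltaPlus _ _).obj (forgetComm k)).obj A

/-- The underlying cosimplicial vector space of a cosimplicial algebra. -/
abbrev cosUnder (A : CosimplicialCommAlg k) : CosimplicialObject (ModuleCat.{u} k) :=
  ((CosimplicialObject.whiskering _ _).obj (forgetComm k)).obj A

/-- The multiplication of an almost cosimplicial algebra. -/
def plusMul {A : AlmostCosimplicialCommAlg k} {p : ℕ} (a b : (plusUnder A).obj (mk p)) :
    (plusUnder A).obj (mk p) := HMul.hMul (α := A.obj (mk p)) (β := A.obj (mk p)) a b

/-- The unit of an almost cosimplicial algebra. -/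
def plusOne (A : AlmostCosimplicialCommAlg k) (p : ℕ) : (plusUnder A).obj (mk p) :=
  (1 : A.obj (mk p))

lemma map_plusMul {A : AlmostCosimplicialCommAlg k} {p q : ℕ} (f : mk p ⟶ mk q)
    (a b : (plusUnder A).obj (mk p)) : ((plusUnder A).map f).hom (plusMul a b)
      = plusMul (((plusUnder A).map f).hom a) (((plusUnder A).map f).hom b) :=
  map_mul (M := A.obj (mk p)) (A.map f).hom a b

lemma map_plusOne {A : AlmostCosimplicialCommAlg k} {p q : ℕ} (f : mk p ⟶ mk q) :
    ((plusUnder A).map f).hom (plusOne A p) = plusOne A q :=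
  map_one (A.map f).hom

namespace NormHom

lemma tensProj_cocycle {V : AlmostCosimplicialObject (ModuleCat.{u} k)} {C : CDGA k}
    (ψ : NormHom V C.toCGA) {n : ℕ} (x : V.obj (mk n)) :
    tensProj C.toCGA n (ψ.cocycle n x).1 = ψ.elt n x := by
  have h : coords C.toCGA (ψ.cocycle n x).1 = coords C.toCGA (ψ.elt n x) :=
    coords_toCocycle (ψ.elt n x)
  rw [tensProj_eq_ofCoords, h, elt_apply, coords_ofCoords]

/-- The projection is multiplicative and does not change top coefficients, so the correction terms
of the two cocycles are irrelevant. Multiplicativity of a family is thus a condition on graded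
algebras alone, which is why D and D₊ have the same relations. -/
lemma topCoeff_elt_mul {V : AlmostCosimplicialObject (ModuleCat.{u} k)} {C : CDGA k}
    (ψ : NormHom V C.toCGA) {n : ℕ} (x y : V.obj (mk n)) :
    topCoeff C.toCGA n (ψ.elt n x * ψ.elt n y)
      = topCoeff C.toCGA n (ψ.cocycle n x * ψ.cocycle n y).1 := by
  rw [← tensProj_cocycle, ← tensProj_cocycle,
    ← tensProj_mul (ψ.cocycle n x).2.1 (ψ.cocycle n y).2.1, topCoeff_tensProj]
  rfl

variable {A : AlmostCosimplicialCommAlg k}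

/-- A family of linear maps `A^p → C^p` is multiplicative if the corresponding map
`A → K_alg(C)` is a map of algebras. -/
structure IsMult {C : CGA k} (ψ : NormHom (plusUnder A) C) : Prop where
  map_mul : ∀ (p : ℕ) (a b : (plusUnder A).obj (DeltaPlus.mk p)),
    ψ.toFun p (plusMul a b) = topCoeff C p (ψ.elt p a * ψ.elt p b)
  map_one : ∀ p : ℕ, ψ.toFun p (plusOne A p) = topCoeff C p 1

lemma IsMult.map {B C : CGA k} {ψ : NormHom (plusUnder A) B} (hψ : ψ.IsMult) (h : B ⟶ C) :
    (ψ.map h).IsMult where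
  map_mul p a b := by
    rw [map_apply, hψ.map_mul, map_elt, map_elt, ← _root_.map_mul (tensMap h id), topCoeff_tensMap]
  map_one p := by
    rw [map_apply, hψ.map_one, ← topCoeff_tensMap, _root_.map_one]

/-- Pushing along the surjection of I is an algebra map on A and on C ⊗ Λ^•. The comparison of
coordinates at I is therefore the multiplicativity equation in degree #I. -/
lemma IsMult.cocycle_mul {C : CDGA k} {ψ : NormHom (plusUnder A) C.toCGA} (hψ : ψ.IsMult) {n : ℕ}
    (a b : (plusUnder A).obj (DeltaPlus.mk n)) :
    ψ.cocycle n (plusMul a b) = ψ.cocycle n a * ψ.cocycle n b := by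
  refine Subtype.ext (cocycle_ext (ψ.cocycle _ _).2.2 (ψ.cocycle n a * ψ.cocycle n b).2.2
    fun I => ?_)
  refine (ψ.topCoeff_cocycle _ (surj I)).trans ?_
  rw [map_plusMul, hψ.map_mul, topCoeff_elt_mul]
  refine congrArg (topCoeff C.toCGA I.card) ?_
  refine Eq.trans ?_ (_root_.map_mul (tensAct C.toCGA (countLT I)) _ _).symm
  exact congrArg₂ (· * ·) (ψ.cocycle_map (surj I) a) (ψ.cocycle_map (surj I) b)

lemma IsMult.cocycle_one {C : CDGA k} {ψ : NormHom (plusUnder A) C.toCGA} (hψ : ψ.IsMult)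
    (n : ℕ) : ψ.cocycle n (plusOne A n) = 1 := by
  refine Subtype.ext (cocycle_ext (ψ.cocycle _ _).2.2 (1 : cocycles C n).2.2 fun I => ?_)
  refine (ψ.topCoeff_cocycle _ (surj I)).trans ?_
  rw [map_plusOne, hψ.map_one]
  exact congrArg (topCoeff C.toCGA I.card) (_root_.map_one (tensAct C.toCGA (countLT I))).symm

end NormHom

section Plus

variable {A : AlmostCosimplicialCommAlg k}

/-- The components of a map of algebras into `K_alg(C)`. -/
def kPlusAlgApp {C : CDGA k} (F : A ⟶ (forgetCoface _).obj ((Kalg k).obj C)) (p : ℕ) :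
    A.obj (mk p) →ₐ[k] cocycles C p := (F.app (mk p)).hom

/-- The underlying linear map of a map of almost cosimplicial algebras into `K_alg(C)`. -/
def plusLin {C : CDGA k} (F : A ⟶ (forgetCoface _).obj ((Kalg k).obj C)) :
    plusUnder A ⟶ KPlusMod C :=
  ((Functor.whiskeringRight DeltaPlus _ _).obj (forgetComm k)).map F

lemma cocycle_kPlusEquiv {V : AlmostCosimplicialObject (ModuleCat.{u} k)} {C : CDGA k}
    (F : V ⟶ KPlusMod C) {p : ℕ} (x : V.obj (mk p)) :
    (kPlusEquiv V C F).cocycle p x = kPlusApp F p x :=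
  congrArg (fun G => kPlusApp G p x) ((kPlusEquiv V C).left_inv F)

lemma isMult_kPlusEquiv {C : CDGA k} (F : A ⟶ (forgetCoface _).obj ((Kalg k).obj C)) :
    (kPlusEquiv _ C (plusLin F)).IsMult where
  map_mul p a b := by
    rw [NormHom.topCoeff_elt_mul, cocycle_kPlusEquiv, cocycle_kPlusEquiv]
    exact congrArg (fun z : cocycles C p => topCoeff C.toCGA p z.1)
      (map_mul (M := A.obj (mk p)) (kPlusAlgApp F p) a b)
  map_one p := congrArg (fun z : cocycles C p => topCoeff C.toCGA p z.1)
      (map_one (kPlusAlgApp F p))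

variable (A) in
/-- Maps of almost cosimplicial algebras `A → K_alg(C)` correspond to multiplicative families of
linear maps `A^p → C^p`. -/
def kPlusAlgEquiv (C : CDGA k) : (A ⟶ (forgetCoface _).obj ((Kalg k).obj C)) ≃
    {ψ : NormHom (plusUnder A) C.toCGA // ψ.IsMult} where
  toFun F := ⟨kPlusEquiv _ C (plusLin F), isMult_kPlusEquiv F⟩
  invFun ψ :=
    { app := fun X => CommAlgCat.ofHom (AlgHom.ofLinearMap (ψ.1.cocycle X.obj.len)
        (ψ.2.cocycle_one X.obj.len) (ψ.2.cocycle_mul (n := X.obj.len)))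
      naturality := fun X Y f => by
        refine CommAlgCat.hom_ext (AlgHom.ext fun x => Subtype.ext ?_)
        exact ψ.1.cocycle_map (m := X.obj.len) (n := Y.obj.len) f x }
  left_inv F := by
    refine NatTrans.ext (funext fun X => CommAlgCat.hom_ext (AlgHom.ext fun x => ?_))
    exact cocycle_kPlusEquiv (plusLin F) (p := X.obj.len) x
  right_inv ψ := Subtype.ext ((kPlusEquiv (plusUnder A) C).right_inv ψ.1)

end Plus

section Full

variable {A : CosimplicialCommAlg k}

/-- The underlying linear map of a map of cosimplicial algebras into `K_alg(C)`. -/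
def cosLin {C : CDGA k} (F : A ⟶ (Kalg k).obj C) : cosUnder A ⟶ KMod C :=
  ((CosimplicialObject.whiskering _ _).obj (forgetComm k)).map F

variable (A) in
/-- Maps of cosimplicial algebras `A → K_alg(C)` correspond to compatible multiplicative families
of linear maps `A^p → C^p`. -/
def kAlgEquiv (C : CDGA k) : (A ⟶ (Kalg k).obj C) ≃
    {ψ : NormHom (plusUnder ((forgetCoface _).obj A)) C.toCGA //
      NormHom.Compat (V := cosUnder A) ψ ∧ ψ.IsMult} where
  toFun F := ⟨(kEquiv (cosUnder A) C (cosLin F)).1, (kEquiv (cosUnder A) C (cosLin F)).2,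
    isMult_kPlusEquiv ((forgetCoface _).map F)⟩
  invFun ψ :=
    { app := fun n => CommAlgCat.ofHom (AlgHom.ofLinearMap (ψ.1.cocycle n.len)
        (ψ.2.2.cocycle_one n.len) (ψ.2.2.cocycle_mul (n := n.len)))
      naturality := fun m n f => by
        refine CommAlgCat.hom_ext (AlgHom.ext fun x => Subtype.ext ?_)
        exact ψ.2.1.cocycle_map (m := m.len) (n := n.len) f x }
  left_inv F := by
    refine NatTrans.ext (funext fun X => CommAlgCat.hom_ext (AlgHom.ext fun x => ?_))
    exact cocycle_kPlusEquiv (restrictHom (cosLin F)) (p := X.len) x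
  right_inv ψ := Subtype.ext ((kPlusEquiv _ C).right_inv ψ.1)

end Full

/-! ## Quotients of graded commutative algebras -/

section Quotient

variable (B : CGA k) (S : Set B.carrier)

/-- The relation that identifies the elements of `S` with `0`. -/
def killRel : B.carrier → B.carrier → Prop := fun x y => x ∈ S ∧ y = 0

/-- The quotient map by the ideal generated by `S`. -/
def killMk : B.carrier →ₐ[k] RingQuot (killRel B S) := RingQuot.mkAlgHom k (killRel B S)

/-- The grading of the quotient. -/
def killGrading (i : ℕ) : Submodule k (RingQuot (killRel B S)) :=
  (B.grading i).map (killMk B S).toLinearMap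

variable {B S}

lemma killMk_eq_zero {s : B.carrier} (hs : s ∈ S) : killMk B S s = 0 :=
  (RingQuot.mkAlgHom_rel k (s := killRel B S) ⟨hs, rfl⟩).trans (map_zero _)

lemma killMk_surjective : Function.Surjective (killMk B S) := RingQuot.mkAlgHom_surjective k _

lemma killMk_mem {i : ℕ} {x : B.carrier} (hx : x ∈ B.grading i) :
    killMk B S x ∈ killGrading B S i := ⟨x, hx, rfl⟩

variable (S) in
/-- Algebra maps out of the quotient. -/
def killLift {R : Type u} [Semiring R] [Algebra k R] (f : B.carrier →ₐ[k] R)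
    (hf : ∀ s ∈ S, f s = 0) : RingQuot (killRel B S) →ₐ[k] R :=
  RingQuot.liftAlgHom k ⟨f, by
    rintro x y ⟨hx, rfl⟩
    rw [hf x hx, map_zero]⟩

lemma killLift_mk {R : Type u} [Semiring R] [Algebra k R] (f : B.carrier →ₐ[k] R)
    (hf : ∀ s ∈ S, f s = 0) (x : B.carrier) : killLift S f hf (killMk B S x) = f x :=
  RingQuot.liftAlgHom_mkAlgHom_apply _ _ _ _

instance : SetLike.GradedMonoid (killGrading B S) where
  one_mem := ⟨1, SetLike.one_mem_graded _, map_one (killMk B S)⟩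
  mul_mem := by
    rintro i j _ _ ⟨x, hx, rfl⟩ ⟨y, hy, rfl⟩
    exact ⟨x * y, SetLike.mul_mem_graded hx hy, map_mul (killMk B S) x y⟩

variable (B S) in
/-- The homogeneous components of an element, projected to the quotient. -/
def killComponents : B.carrier →ₐ[k] ⨁ i, killGrading B S i :=
  (DirectSum.toAlgebra k (fun i => B.grading i)
    (fun i => DirectSum.lof k ℕ (fun i => killGrading B S i) i ∘ₗ
      (killMk B S).toLinearMap.restrict (fun _ hx => killMk_mem hx))
    (by
      rw [LinearMap.comp_apply, DirectSum.lof_eq_of]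
      exact DirectSum.of_eq_of_gradedMonoid_eq (Sigma.subtype_ext rfl (map_one (killMk B S))))
    (by
      intro i j x y
      simp only [LinearMap.comp_apply, DirectSum.lof_eq_of, DirectSum.of_mul_of]
      exact DirectSum.of_eq_of_gradedMonoid_eq
        (Sigma.subtype_ext rfl (map_mul (killMk B S) _ _)))).comp
    (DirectSum.decomposeAlgEquiv B.grading).toAlgHom

lemma killComponents_of_mem {i : ℕ} {x : B.carrier} (hx : x ∈ B.grading i) :
    killComponents B S x
      = DirectSum.of (fun i => killGrading B S i) i ⟨killMk B S x, killMk_mem hx⟩ := by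
  have h : DirectSum.decomposeAlgEquiv B.grading x
      = DirectSum.lof k ℕ (fun i => B.grading i) i ⟨x, hx⟩ :=
    DirectSum.decompose_of_mem _ hx
  rw [killComponents, AlgHom.comp_apply]
  refine (congrArg _ h).trans ?_
  exact DirectSum.toModule_lof k (M := fun i => B.grading i)
    (φ := fun i => DirectSum.lof k ℕ (fun i => killGrading B S i) i ∘ₗ
      (killMk B S).toLinearMap.restrict (fun _ hx => killMk_mem hx)) i _

variable (B S) in
/-- The quotient of a graded commutative algebra by the ideal generated by homogeneous elements. -/
def quotCGA (hS : ∀ s ∈ S, ∃ i, s ∈ B.grading i) : CGA k where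
  carrier := RingQuot (killRel B S)
  grading := killGrading B S
  gradedAlgebra := GradedAlgebra.ofAlgHom _
    -- The map to components descends because a homogeneous s has a single component, which is zero
    -- in the quotient.
    (killLift S (killComponents B S) (fun s hs => by
      obtain ⟨i, hi⟩ := hS s hs
      rw [killComponents_of_mem hi]
      refine (congrArg _ (Subtype.ext (killMk_eq_zero hs))).trans (map_zero _)))
    (by
      refine RingQuot.ringQuot_ext' _ _ _ (AlgHom.ext fun x => ?_)
      change DirectSum.coeAlgHom _ (killLift S (killComponents B S) _ (killMk B S x)) = killMk B S x
      rw [killLift_mk]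
      induction x using DirectSum.Decomposition.inductionOn B.grading with
      | zero => simp
      | add x y h1 h2 => rw [map_add, map_add, h1, h2, map_add]
      | homogeneous x => rw [killComponents_of_mem x.2, DirectSum.coeAlgHom_of])
    (by
      rintro i ⟨_, x, hx, rfl⟩
      exact (killLift_mk _ _ x).trans (killComponents_of_mem hx))
  graded_comm := by
    rintro i j _ _ ⟨x, hx, rfl⟩ ⟨y, hy, rfl⟩
    have h := congrArg (killMk B S) (B.graded_comm hx hy)
    rw [map_mul, map_smul, map_mul] at h
    exact h

variable {hS : ∀ s ∈ S, ∃ i, s ∈ B.grading i}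

/-- The quotient map. -/
def quotCGA.proj (hS : ∀ s ∈ S, ∃ i, s ∈ B.grading i) : B ⟶ quotCGA B S hS :=
  ⟨killMk B S, fun h => killMk_mem h⟩

lemma quotCGA.hom_ext {C : CGA k} {f g : quotCGA B S hS ⟶ C}
    (h : quotCGA.proj hS ≫ f = quotCGA.proj hS ≫ g) : f = g :=
  CGA.Hom.ext (RingQuot.ringQuot_ext' _ _ _ (congrArg CGA.Hom.toAlgHom h))

/-- Maps out of the quotient. -/
def quotCGA.desc {C : CGA k} (f : B ⟶ C) (hf : ∀ s ∈ S, f.toAlgHom s = 0) :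
    quotCGA B S hS ⟶ C :=
  ⟨killLift S f.toAlgHom hf, by
    rintro i _ ⟨x, hx, rfl⟩
    have h := killLift_mk f.toAlgHom hf x
    refine Set.mem_of_eq_of_mem h (f.map_mem hx)⟩

lemma quotCGA.proj_desc {C : CGA k} (f : B ⟶ C) (hf : ∀ s ∈ S, f.toAlgHom s = 0) :
    quotCGA.proj hS ≫ quotCGA.desc f hf = f :=
  CGA.Hom.ext (AlgHom.ext (killLift_mk f.toAlgHom hf))

end Quotient

/-! ## Quotients of commutative dg algebras -/

section QuotientDG

variable (B : CDGA k) (S : Set B.carrier)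

lemma CGA.sgn_mul (A : CGA k) (x y : A.carrier) : A.sgn (x * y) = A.sgn x * A.sgn y := by
  induction x using DirectSum.Decomposition.inductionOn A.grading with
  | zero => simp
  | add x x' h1 h2 => rw [add_mul, map_add, h1, h2, map_add, add_mul]
  | homogeneous x =>
    induction y using DirectSum.Decomposition.inductionOn A.grading with
    | zero => simp
    | add x x' h1 h2 => rw [mul_add, map_add, h1, h2, map_add, mul_add]
    | homogeneous y =>
      rw [A.sgn_of_mem x.2, A.sgn_of_mem y.2, A.sgn_of_mem (SetLike.mul_mem_graded x.2 y.2),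
        smul_mul_smul_comm, pow_add]

lemma CGA.sgn_one (A : CGA k) : A.sgn 1 = 1 := by
  rw [A.sgn_of_mem SetLike.GradedOne.one_mem, pow_zero, one_smul]

lemma CDGA.d_mul (A : CDGA k) (x y : A.carrier) : A.d (x * y) = A.d x * y + A.sgn x * A.d y := by
  induction x using DirectSum.Decomposition.inductionOn A.grading with
  | zero => simp
  | add x x' h1 h2 => rw [add_mul, map_add, h1, h2, map_add, map_add, add_mul, add_mul]; abel
  | homogeneous x => rw [A.leibniz y x.2, A.sgn_of_mem x.2, smul_mul_assoc]

lemma CDGA.d_one (A : CDGA k) : A.d 1 = 0 := by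
  have h := A.d_mul 1 1
  rw [A.sgn_one] at h
  simpa using h

/-- The algebra map `x ↦ !![± x, d x; 0, x]` to matrices over the quotient. -/
def killDerMatrix : B.carrier →ₐ[k] Matrix (Fin 2) (Fin 2) (RingQuot (killRel B.toCGA S)) :=
  AlgHom.ofLinearMap
    { toFun := fun x => !![killMk B.toCGA S (B.sgn x), killMk B.toCGA S (B.d x);
        0, killMk B.toCGA S x]
      map_add' := fun x y => by
        ext a b
        fin_cases a <;> fin_cases b <;> simp
      map_smul' := fun r x => by
        ext a b
        fin_cases a <;> fin_cases b <;> simp }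
    (by
      change !![_, _; _, _] = _
      rw [B.sgn_one, B.d_one, map_one, map_zero]
      exact Matrix.one_fin_two.symm)
    (fun x y => by
      change !![_, _; _, _] = !![_, _; _, _] * !![_, _; _, _]
      rw [B.sgn_mul, B.d_mul, map_mul, map_add, map_mul, map_mul, map_mul, Matrix.mul_fin_two]
      simp only [mul_zero, zero_mul, add_zero, zero_add]
      rw [add_comm])

variable {B S}

/-- The differential of the quotient. -/
def killD (hS : ∀ s ∈ S, ∃ i, s ∈ B.grading i) (hd : ∀ s ∈ S, killMk B.toCGA S (B.d s) = 0) :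
    RingQuot (killRel B.toCGA S) →ₗ[k] RingQuot (killRel B.toCGA S) :=
  -- At s ∈ S the entries are ± s, ds and s, all zero in the quotient. So the algebra map descends,
  -- and with it the derivation in its upper right corner.
  let f := killLift S (killDerMatrix B S) (fun s hs => by
      change !![_, _; _, _] = _
      obtain ⟨i, hi⟩ := hS s hs
      rw [B.sgn_of_mem hi, map_smul, hd s hs, killMk_eq_zero hs, smul_zero]
      exact (Matrix.eta_fin_two 0).symm)
  { toFun := fun x => f x 0 1
    map_add' := fun x y => by rw [map_add]; rfl
    map_smul' := fun r x => by rw [map_smul]; rfl }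

lemma killD_mk (hS : ∀ s ∈ S, ∃ i, s ∈ B.grading i) (hd : ∀ s ∈ S, killMk B.toCGA S (B.d s) = 0)
    (x : B.carrier) : killD hS hd (killMk B.toCGA S x) = killMk B.toCGA S (B.d x) :=
  congrFun (congrFun (killLift_mk (B := B.toCGA) (killDerMatrix B S) _ x) 0) 1

variable (B S) in
/-- The quotient of a commutative dg algebra by the ideal generated by homogeneous elements whose
differentials lie in the ideal. -/
def quotCDGA (hS : ∀ s ∈ S, ∃ i, s ∈ B.grading i)
    (hd : ∀ s ∈ S, killMk B.toCGA S (B.d s) = 0) : CDGA k where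
  toCGA := quotCGA B.toCGA S hS
  d := killD hS hd
  d_mem := by
    rintro i _ ⟨x, hx, rfl⟩
    exact Set.mem_of_eq_of_mem (killD_mk hS hd x) (killMk_mem (B.d_mem hx))
  d_d := fun x => by
    obtain ⟨x, rfl⟩ := killMk_surjective x
    refine (congrArg (killD hS hd) (killD_mk hS hd x)).trans ?_
    exact (killD_mk hS hd _).trans ((congrArg _ (B.d_d x)).trans (map_zero _))
  leibniz := by
    rintro i _ y ⟨x, hx, rfl⟩
    obtain ⟨y, rfl⟩ := killMk_surjective y
    have h := congrArg (killMk B.toCGA S) (B.leibniz y hx)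
    rw [map_add, map_smul, map_mul (killMk B.toCGA S), map_mul (killMk B.toCGA S),
      ← killD_mk hS hd, ← killD_mk hS hd, ← killD_mk hS hd, map_mul (killMk B.toCGA S)] at h
    exact h

variable {hS : ∀ s ∈ S, ∃ i, s ∈ B.grading i} {hd : ∀ s ∈ S, killMk B.toCGA S (B.d s) = 0}

/-- Maps of commutative dg algebras out of the quotient. -/
def quotCDGA.desc {C : CDGA k} (f : B ⟶ C) (hf : ∀ s ∈ S, f.toAlgHom s = 0) :
    quotCDGA B S hS hd ⟶ C where
  toHom := quotCGA.desc (hS := hS) f.toHom hf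
  map_d := fun x => by
    obtain ⟨x, rfl⟩ := killMk_surjective x
    refine (congrArg (killLift S f.toAlgHom hf) (killD_mk hS hd x)).trans ?_
    refine (killLift_mk f.toAlgHom hf _).trans ((f.map_d x).trans ?_)
    exact congrArg C.d (killLift_mk f.toAlgHom hf x).symm

end QuotientDG

/-! ## The left adjoint of `K_alg⁺` -/

section Plus

/-- The free graded commutative algebra on normalized cochains. -/
abbrev normSym (V : AlmostCosimplicialObject (ModuleCat.{u} k)) : CGA k :=
  freeCGAObj ((normalizedCochainsPlus k).obj V)

/-- Maps out of the free graded commutative algebra on the normalized cochains of `V`. -/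
def normSymEquiv (V : AlmostCosimplicialObject (ModuleCat.{u} k)) (C : CGA k) :
    (normSym V ⟶ C) ≃ NormHom V C :=
  (freeCGAHomEquiv _ C).trans (NormHom.normEquiv V C)

/-- The inclusion of the generators. -/
def genHom (V : AlmostCosimplicialObject (ModuleCat.{u} k)) : NormHom V (normSym V) :=
  normSymEquiv V _ (𝟙 _)

lemma genHom_map {V : AlmostCosimplicialObject (ModuleCat.{u} k)} {C : CGA k}
    (h : normSym V ⟶ C) : (genHom V).map h = normSymEquiv V C h := rfl

variable (A : AlmostCosimplicialCommAlg k)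

/-- The elements of `Sym(N₊(A))` that measure the failure of the inclusion of the generators to be
multiplicative. -/
inductive MultRel : (normSym (plusUnder A)).carrier → Prop
  | mul (p : ℕ) (a b : (plusUnder A).obj (mk p)) : MultRel
      ((genHom (plusUnder A)).toFun p (plusMul a b)
        - topCoeff _ p ((genHom (plusUnder A)).elt p a * (genHom (plusUnder A)).elt p b))
  | one (p : ℕ) : MultRel ((genHom (plusUnder A)).toFun p (plusOne A p) - topCoeff _ p 1)

variable {A}

lemma MultRel.homogeneous {s : (normSym (plusUnder A)).carrier} (hs : MultRel A s) :
    ∃ i, s ∈ (normSym (plusUnder A)).grading i := by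
  cases hs with
  | mul p a b => exact ⟨p, sub_mem ((genHom _).mem p _)
      (topCoeff_mem (mul_mem_tensDegZero ((genHom _).elt_mem a) ((genHom _).elt_mem b)))⟩
  | one p => exact ⟨p, sub_mem ((genHom _).mem p _) (topCoeff_mem (one_mem_tensDegZero _ _))⟩

/-- The elements `elt` and top coefficients are natural in the graded algebra, so h carries each
relation to the corresponding multiplicativity equation in C. -/
lemma MultRel.map_eq_zero {C : CGA k} {h : normSym (plusUnder A) ⟶ C}
    (hh : (normSymEquiv _ C h).IsMult) {s : (normSym (plusUnder A)).carrier}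
    (hs : MultRel A s) : h.toAlgHom s = 0 := by
  rw [← genHom_map] at hh
  cases hs with
  | mul p a b =>
    have e := hh.map_mul p a b
    rw [NormHom.map_apply, NormHom.map_elt, NormHom.map_elt, ← map_mul (tensMap h id),
      topCoeff_tensMap] at e
    rw [map_sub, e, sub_self]
  | one p =>
    have e := hh.map_one p
    rw [NormHom.map_apply, ← map_one (tensMap h id), topCoeff_tensMap] at e
    rw [map_sub, e, sub_self]

variable (A) in
/-- The value of the left adjoint of `K_alg⁺` at `A`. -/
def dPlusObj : CGA k :=
  quotCGA (normSym (plusUnder A)) {s | MultRel A s} fun _ hs => hs.homogeneous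

variable (A) in
/-- The quotient map. -/
def dPlusProj : normSym (plusUnder A) ⟶ dPlusObj A := quotCGA.proj _

lemma isMult_dPlusProj : (normSymEquiv _ _ (dPlusProj A)).IsMult := by
  rw [← genHom_map]
  have h : ∀ x y, MultRel A (x - y) →
      (dPlusProj A).toAlgHom x = (dPlusProj A).toAlgHom y := fun x y hxy => by
    rw [← sub_eq_zero, ← map_sub]
    exact killMk_eq_zero hxy
  refine ⟨fun p a b => ?_, fun p => ?_⟩
  · rw [NormHom.map_apply, NormHom.map_elt, NormHom.map_elt, ← map_mul (tensMap (dPlusProj A) id),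
      topCoeff_tensMap]
    exact h _ _ (MultRel.mul p a b)
  · rw [NormHom.map_apply, ← map_one (tensMap (dPlusProj A) id), topCoeff_tensMap]
    exact h _ _ (MultRel.one p)

variable (A) in
/-- The universal multiplicative family. -/
def univHom : NormHom (plusUnder A) (dPlusObj A) := normSymEquiv _ _ (dPlusProj A)

lemma isMult_univHom : (univHom A).IsMult := isMult_dPlusProj

lemma univHom_map {C : CGA k} (h : dPlusObj A ⟶ C) :
    (univHom A).map h = normSymEquiv _ C (dPlusProj A ≫ h) := rfl

lemma univHom_map_injective {C : CGA k} {h h' : dPlusObj A ⟶ C}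
    (e : (univHom A).map h = (univHom A).map h') : h = h' :=
  quotCGA.hom_ext ((normSymEquiv _ C).injective e)

variable (A) in
/-- The universal property of `dPlusObj`. -/
def dPlusEquiv (C : CGA k) :
    (dPlusObj A ⟶ C) ≃ {ψ : NormHom (plusUnder A) C // ψ.IsMult} where
  toFun h := ⟨(univHom A).map h, isMult_univHom.map h⟩
  invFun ψ := quotCGA.desc ((normSymEquiv _ C).symm ψ.1) fun _ hs =>
    MultRel.map_eq_zero (by rw [Equiv.apply_symm_apply]; exact ψ.2) hs
  left_inv h := by
    refine univHom_map_injective ?_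
    refine (univHom_map _).trans ?_
    refine (congrArg (normSymEquiv _ C) (quotCGA.proj_desc _ _)).trans ?_
    exact Equiv.apply_symm_apply _ _
  right_inv ψ := Subtype.ext (by
    refine (univHom_map _).trans ?_
    refine (congrArg (normSymEquiv _ C) (quotCGA.proj_desc _ _)).trans ?_
    exact Equiv.apply_symm_apply _ _)

lemma kPlusAlgEquiv_comp {B C : CDGA k} (F : A ⟶ (forgetCoface _).obj ((Kalg k).obj B))
    (h : B ⟶ C) : (kPlusAlgEquiv A C (F ≫ (forgetCoface _).map ((Kalg k).map h))).1
      = (kPlusAlgEquiv A B F).1.map h.toHom :=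
  kPlusEquiv_comp (plusLin F) h

/-- Maps `D₊ A → C` correspond to maps `A → K_alg⁺(C)`. -/
def dPlusHomEquiv (A : AlmostCosimplicialCommAlg k) (C : CGA k) :
    (dPlusObj A ⟶ C) ≃ (A ⟶ (KalgPlus k).obj C) :=
  (dPlusEquiv A C).trans (kPlusAlgEquiv A ((zeroDiff k).obj C)).symm

lemma kPlusAlgEquiv_dPlusHomEquiv {C : CGA k} (h : dPlusObj A ⟶ C) :
    (kPlusAlgEquiv A ((zeroDiff k).obj C) (dPlusHomEquiv A C h)).1 = (univHom A).map h :=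
  congrArg Subtype.val ((kPlusAlgEquiv A ((zeroDiff k).obj C)).apply_symm_apply (dPlusEquiv A C h))

lemma dPlusHomEquiv_comp {B C : CGA k} (h : B ⟶ C) (f : dPlusObj A ⟶ B) :
    dPlusHomEquiv A C (f ≫ h) = dPlusHomEquiv A B f ≫ (KalgPlus k).map h := by
  refine (kPlusAlgEquiv A ((zeroDiff k).obj C)).injective (Subtype.ext ?_)
  refine Eq.trans ?_ (kPlusAlgEquiv_comp (dPlusHomEquiv A B f) ((zeroDiff k).map h)).symm
  refine (kPlusAlgEquiv_dPlusHomEquiv (f ≫ h)).trans ?_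
  exact congrArg (fun ψ => NormHom.map ψ h) (kPlusAlgEquiv_dPlusHomEquiv f).symm

end Plus

/-! ## The left adjoint of `K_alg` -/

section Full

/-- The free commutative dg algebra on normalized cochains. -/
abbrev normSymDG (V : CosimplicialObject (ModuleCat.{u} k)) : CDGA k :=
  freeCDGAObj ((normalizedCochains k).obj V)

/-- Maps out of the free commutative dg algebra on the normalized cochains of `V`. -/
def normSymDGEquiv (V : CosimplicialObject (ModuleCat.{u} k)) (C : CDGA k) :
    (normSymDG V ⟶ C) ≃ {ψ : NormHom (plusMod V) C.toCGA // ψ.Compat} :=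
  (freeCDGAHomEquiv _ C).trans (normEquivCompat C)

/-- The generators form the family attached to the identity of the cdga Sym(NV). -/
lemma compat_genHom (V : CosimplicialObject (ModuleCat.{u} k)) :
    NormHom.Compat (C := normSymDG V) (genHom (plusMod V)) :=
  (normSymDGEquiv V _ (𝟙 _)).2

lemma NormHom.Compat.map {V : CosimplicialObject (ModuleCat.{u} k)} {B C : CDGA k}
    {ψ : NormHom (plusMod V) B.toCGA} (hψ : ψ.Compat) (h : B ⟶ C) :
    NormHom.Compat (ψ.map h.toHom) := fun p x => by
  rw [NormHom.map_apply, NormHom.map_apply, hψ, map_smul, h.map_d]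

lemma NormHom.Compat.d_apply {V : CosimplicialObject (ModuleCat.{u} k)} {C : CDGA k}
    {ψ : NormHom (plusMod V) C.toCGA} (hψ : ψ.Compat) {p : ℕ} (x : (plusMod V).obj (mk p)) :
    C.d (ψ.toFun p x)
      = (-1 : k) ^ (p + 1) • ψ.toFun (p + 1) (fullAct V (SimplexCategory.δ 0) x) := by
  rw [hψ, smul_smul, ← mul_pow]
  simp

lemma d_topCoeff {C : CDGA k} {n : ℕ} (x : cocycles C n) : C.d (topCoeff C.toCGA n x.1)
    = (-1 : k) ^ (n + 1) • topCoeff C.toCGA (n + 1)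
      (tensAct C.toCGA (SimplexCategory.δ (n := n) 0).toOrderHom x.1) := by
  rw [topCoeff_cofaceZero, smul_smul, ← mul_pow]
  simp

/-- The underlying almost cosimplicial algebra. -/
abbrev cosPlus (A : CosimplicialCommAlg k) : AlmostCosimplicialCommAlg k :=
  (forgetCoface (CommAlgCat k)).obj A

variable {A : CosimplicialCommAlg k}

lemma fullAct_plusMul {p q : ℕ} (f : SimplexCategory.mk p ⟶ SimplexCategory.mk q)
    (a b : (plusUnder (cosPlus A)).obj (mk p)) :
    fullAct (cosUnder A) f (plusMul a b)
      = plusMul (A := cosPlus A) (fullAct (cosUnder A) f a)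
        (fullAct (cosUnder A) f b) :=
  map_mul (M := A.obj (SimplexCategory.mk p)) (A.map f).hom a b

lemma fullAct_plusOne {p q : ℕ} (f : SimplexCategory.mk p ⟶ SimplexCategory.mk q) :
    fullAct (cosUnder A) f (plusOne (cosPlus A) p)
      = plusOne (cosPlus A) q :=
  map_one (A.map f).hom

lemma CDGA.d_sub {C : CDGA k} {c : k} {x y x' y' : C.carrier} (hx : C.d x = c • x')
    (hy : C.d y = c • y') : C.d (x - y) = c • (x' - y') := by
  rw [map_sub, hx, hy, smul_sub]

/-- On the universal family and on top coefficients of cocycles, d is ± d^0, and d^0 is an algebra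
map. So d carries the relation for (a, b) to ± the relation for (d^0 a, d^0 b), and the unit
relation to ± the next one. The ideal of relations is therefore stable under d. -/
lemma MultRel.d_eq {s : (normSym (plusUnder (cosPlus A))).carrier}
    (hs : @MultRel k _ (cosPlus A) s) :
    ∃ (c : k) (t : (normSymDG (cosUnder A)).carrier), @MultRel k _ (cosPlus A) t ∧
      (normSymDG (cosUnder A)).d s = c • t := by
  have hg := compat_genHom (cosUnder A)
  cases hs with
  | mul p a b =>
    refine ⟨(-1) ^ (p + 1), _, MultRel.mul (A := cosPlus A) (p + 1)
      (fullAct (cosUnder A) (SimplexCategory.δ 0) a)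
      (fullAct (cosUnder A) (SimplexCategory.δ 0) b), ?_⟩
    rw [← fullAct_plusMul]
    refine CDGA.d_sub (C := normSymDG (cosUnder A)) (hg.d_apply _) ?_
    -- The elements `elt` need not be cocycles, so the product is first rewritten with cocycles, to
    -- which d^0 applies, and converted back afterwards.
    refine (congrArg (normSymDG (cosUnder A)).d (NormHom.topCoeff_elt_mul
      (C := normSymDG (cosUnder A)) (genHom (plusMod (cosUnder A))) a b)).trans ?_
    refine (d_topCoeff _).trans ?_
    refine congrArg _ ?_
    refine Eq.trans ?_ (NormHom.topCoeff_elt_mul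
      (C := normSymDG (cosUnder A)) (genHom (plusMod (cosUnder A))) _ _).symm
    refine congrArg (topCoeff _ (p + 1)) ?_
    refine (map_mul (tensAct _ _) _ _).trans ?_
    exact congrArg₂ (· * ·) (hg.cocycle_map _ a).symm (hg.cocycle_map _ b).symm
  | one p =>
    refine ⟨(-1) ^ (p + 1), _, MultRel.one (A := cosPlus A) (p + 1), ?_⟩
    rw [← fullAct_plusOne (SimplexCategory.δ 0)]
    refine CDGA.d_sub (C := normSymDG (cosUnder A)) (hg.d_apply _) ?_
    refine (d_topCoeff (C := normSymDG (cosUnder A)) (1 : cocycles _ p)).trans ?_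
    exact congrArg _ (congrArg (topCoeff _ (p + 1)) (map_one (tensAct _ _)))

lemma killMk_d_eq_zero : ∀ s ∈ {s | MultRel (cosPlus A) s},
    killMk (normSymDG (cosUnder A)).toCGA {s | MultRel (cosPlus A) s}
      ((normSymDG (cosUnder A)).d s) = 0 := fun s hs => by
  obtain ⟨c, t, ht, e⟩ := MultRel.d_eq (A := A) hs
  refine (congrArg _ e).trans ?_
  rw [map_smul]
  exact (congrArg _ (killMk_eq_zero ht)).trans (smul_zero c)

variable (A) in
/-- The value of the left adjoint of `K_alg` at `A`. -/
def dObj : CDGA k :=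
  quotCDGA (normSymDG (cosUnder A)) {s | MultRel (cosPlus A) s}
    (fun _ hs => MultRel.homogeneous hs) killMk_d_eq_zero

variable (A) in
/-- The quotient map. -/
def dProj : normSymDG (cosUnder A) ⟶ dObj A where
  toHom := dPlusProj (cosPlus A)
  map_d x := (killD_mk (fun _ hs => MultRel.homogeneous hs) killMk_d_eq_zero x).symm

/-- The map out of `dObj A` attached to a compatible multiplicative family. -/
def dDesc {C : CDGA k} (ψ : NormHom (plusUnder (cosPlus A)) C.toCGA)
    (h : NormHom.Compat (V := cosUnder A) ψ) (hψ : ψ.IsMult) : dObj A ⟶ C :=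
  quotCDGA.desc ((normSymDGEquiv (cosUnder A) C).symm ⟨ψ, h⟩) fun _ hs =>
    MultRel.map_eq_zero (A := cosPlus A)
      (h := ((normSymEquiv (plusUnder (cosPlus A)) C.toCGA).symm ψ))
      (by rw [Equiv.apply_symm_apply]; exact hψ) hs

lemma compat_univHom : NormHom.Compat (C := dObj A) (V := cosUnder A)
    (univHom (cosPlus A)) :=
  (normSymDGEquiv (cosUnder A) _ (dProj A)).2

variable (A) in
/-- The universal property of `dObj`. -/
def dEquiv (C : CDGA k) : (dObj A ⟶ C) ≃
    {ψ : NormHom (plusUnder (cosPlus A)) C.toCGA //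
      NormHom.Compat (V := cosUnder A) ψ ∧ ψ.IsMult} where
  toFun h := ⟨(univHom (cosPlus A)).map h.toHom,
    NormHom.Compat.map (V := cosUnder A) (B := dObj A) compat_univHom h,
    NormHom.IsMult.map (isMult_univHom (A := cosPlus A)) h.toHom⟩
  invFun ψ := dDesc ψ.1 ψ.2.1 ψ.2.2
  -- A map of cdgas is determined by its underlying graded algebra map, so both inverse laws are
  -- those of D₊.
  left_inv h := CDGA.Hom.ext (congrArg CGA.Hom.toAlgHom
    ((dPlusEquiv (cosPlus A) C.toCGA).left_inv h.toHom))
  right_inv ψ := by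
    have h := congrArg Subtype.val ((dPlusEquiv (cosPlus A) C.toCGA).right_inv ⟨ψ.1, ψ.2.2⟩)
    exact Subtype.ext h

/-- Maps `D A → C` correspond to maps `A → K_alg(C)`. -/
def dHomEquiv (A : CosimplicialCommAlg k) (C : CDGA k) :
    (dObj A ⟶ C) ≃ (A ⟶ (Kalg k).obj C) :=
  (dEquiv A C).trans (kAlgEquiv A C).symm

lemma kAlgEquiv_dHomEquiv {C : CDGA k} (h : dObj A ⟶ C) :
    (kAlgEquiv A C (dHomEquiv A C h)).1 = (univHom (cosPlus A)).map h.toHom :=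
  congrArg Subtype.val ((kAlgEquiv A C).apply_symm_apply (dEquiv A C h))

lemma dHomEquiv_comp {B C : CDGA k} (h : B ⟶ C) (f : dObj A ⟶ B) :
    dHomEquiv A C (f ≫ h) = dHomEquiv A B f ≫ (Kalg k).map h := by
  refine (kAlgEquiv A C).injective (Subtype.ext ?_)
  refine Eq.trans ?_ (kPlusAlgEquiv_comp ((forgetCoface _).map (dHomEquiv A B f)) h).symm
  refine (kAlgEquiv_dHomEquiv (f ≫ h)).trans ?_
  exact congrArg (fun ψ => NormHom.map ψ h.toHom) (kAlgEquiv_dHomEquiv f).symm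

end Full

/-! ## The adjunctions -/

variable (k)

/-- The functor `D₊^*`. -/
def dPlus : AlmostCosimplicialCommAlg k ⥤ CGA k :=
  Adjunction.leftAdjointOfEquiv (G := KalgPlus k) (F_obj := dPlusObj) dPlusHomEquiv
    (fun _ _ _ h f => dPlusHomEquiv_comp h f)

/-- `D₊^*` is left adjoint to `K_alg⁺`. -/
def dPlusAdj : dPlus k ⊣ KalgPlus k :=
  Adjunction.adjunctionOfEquivLeft dPlusHomEquiv (fun _ _ _ h f => dPlusHomEquiv_comp h f)

/-- The functor `D^*`. -/
def dFunctor : CosimplicialCommAlg k ⥤ CDGA k :=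
  Adjunction.leftAdjointOfEquiv (G := Kalg k) (F_obj := dObj) dHomEquiv
    (fun _ _ _ h f => dHomEquiv_comp h f)

/-- `D^*` is left adjoint to `K_alg`. -/
def dAdj : dFunctor k ⊣ Kalg k :=
  Adjunction.adjunctionOfEquivLeft dHomEquiv (fun _ _ _ h f => dHomEquiv_comp h f)

variable {k}

/-- Maps out of D₊A are determined by their effect on the universal family, so this characterizes
D₊f. Together with the same formula for D it gives the naturality of the comparison. -/
lemma univHom_map_dPlus {A B : AlmostCosimplicialCommAlg k} (f : A ⟶ B) :
    (univHom A).map ((dPlus k).map f) = (univHom B).comap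
      (((Functor.whiskeringRight DeltaPlus _ _).obj (forgetComm k)).map f) := by
  refine (kPlusAlgEquiv_dPlusHomEquiv _).symm.trans ?_
  have h : dPlusHomEquiv A _ ((dPlus k).map f) = f ≫ dPlusHomEquiv B _ (𝟙 _) :=
    (dPlusHomEquiv A _).apply_symm_apply _
  rw [h]
  exact congrArg (fun ψ => NormHom.comap ψ
    (((Functor.whiskeringRight DeltaPlus _ _).obj (forgetComm k)).map f))
      (kPlusAlgEquiv_dPlusHomEquiv (𝟙 (dPlusObj B)))

lemma univHom_map_dFunctor {A B : CosimplicialCommAlg k} (f : A ⟶ B) :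
    (univHom (cosPlus A)).map ((dFunctor k).map f).toHom
      = (univHom (cosPlus B)).comap
        (((Functor.whiskeringRight DeltaPlus _ _).obj (forgetComm k)).map
          ((forgetCoface _).map f)) := by
  refine (kAlgEquiv_dHomEquiv _).symm.trans ?_
  have h : dHomEquiv A _ ((dFunctor k).map f) = f ≫ dHomEquiv B _ (𝟙 _) :=
    (dHomEquiv A _).apply_symm_apply _
  rw [h]
  exact congrArg (fun ψ => NormHom.comap ψ
    (((Functor.whiskeringRight DeltaPlus _ _).obj (forgetComm k)).map ((forgetCoface _).map f)))
      (kAlgEquiv_dHomEquiv (𝟙 (dObj B)))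

variable (k)

/-- `D^*` agrees with `D₊^*` after forgetting the differential and the zeroth coface maps. -/
def dForgetIso : dFunctor k ⋙ forgetDiff k ≅ forgetCoface (CommAlgCat.{u} k) ⋙ dPlus k :=
  -- The two graded algebras are the same quotient, so only the action on morphisms has to be
  -- compared.
  NatIso.ofComponents (fun A : CosimplicialCommAlg k => Iso.refl (dPlusObj (cosPlus A)))
    (fun {A B} f => by
    refine univHom_map_injective (k := k) (A := cosPlus A) ?_
    refine Eq.trans ?_ (univHom_map_dPlus (A := cosPlus A) ((forgetCoface _).map f)).symm
    exact univHom_map_dFunctor f)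

/-- `D^*` of a free cosimplicial commutative algebra. -/
def symIso : symCosimplicial k ⋙ dFunctor k ≅ normalizedCochains k ⋙ symCDGA k :=
  -- Both sides are left adjoint to K_alg followed by the forgetful functor to cosimplicial vector
  -- spaces.
  ((symCosimplicialAdj k).comp (dAdj k)).leftAdjointUniq (normSymAdj k)

/-- `D₊^*` of a free almost cosimplicial commutative algebra. -/
def symPlusIso :
    symAlmostCosimplicial k ⋙ dPlus k ≅ normalizedCochainsPlus k ⋙ symCGA k :=
  ((symAlmostCosimplicialAdj k).comp (dPlusAdj k)).leftAdjointUniq (normSymPlusAdj k)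

variable {k}

/-! ## Front and back faces -/

/-- The inclusion of the front face `[p] → [p + q]`. -/
def frontFace (p q : ℕ) (j : Fin (p + 1)) : Fin (p + q + 1) := ⟨j, by omega⟩

/-- The map `[q] → [p + q]` that fixes `0` and sends `j > 0` to `p + j`. -/
def backFace (p q : ℕ) (j : Fin (q + 1)) : Fin (p + q + 1) :=
  -- The usual back face sends 0 to p. Sending 0 to 0 keeps the map in Δ₊ and affects only the first
  -- p step coordinates, which the determinant below does not see.
  if j = 0 then 0 else ⟨p + j, by omega⟩

lemma frontFace_zero (p q : ℕ) : frontFace p q 0 = 0 := rfl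

lemma backFace_zero (p q : ℕ) : backFace p q 0 = 0 := if_pos rfl

lemma frontFace_monotone (p q : ℕ) : Monotone (frontFace p q) := fun _ _ h => h

lemma backFace_monotone (p q : ℕ) : Monotone (backFace p q) := fun a b h => by
  unfold backFace
  split_ifs with h1 h2 h2
  · exact le_rfl
  · exact Fin.zero_le _
  · exact absurd (le_antisymm (h2 ▸ h) (Fin.zero_le _)) h1
  · exact Nat.add_le_add_left h p

/-- The top form of a product of a front face and a back face. -/
lemma topForm_frontFace_mul_backFace {p q : ℕ} (v : Fin p → (Fin (p + 1) →₀ k))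
    (w : Fin q → (Fin (q + 1) →₀ k)) :
    topForm k (p + q) (lamMap k (frontFace p q) (ExteriorAlgebra.ιMulti k p v) *
      lamMap k (backFace p q) (ExteriorAlgebra.ιMulti k q w))
      = topForm k p (ExteriorAlgebra.ιMulti k p v) * topForm k q (ExteriorAlgebra.ιMulti k q w) := by
  rw [lamMap_ιMulti, lamMap_ιMulti, ExteriorAlgebra.ιMulti_mul_ιMulti, topForm_ιMulti,
    topForm_ιMulti, topForm_ιMulti, pow_add]
  -- The matrix of step coordinates is block lower triangular: the front face never rises above p,
  -- so its rows vanish in the last q columns.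
  have h : ∀ M : Matrix (Fin (p + q)) (Fin (p + q)) k, M.submatrix finSumFinEquiv finSumFinEquiv
      = Matrix.fromBlocks (Matrix.of fun i j => stepCoord k p (v i) j) 0
        (Matrix.of fun i j => M (Fin.natAdd p i) (Fin.castAdd q j))
        (Matrix.of fun i j => stepCoord k q (w i) j) →
      M.det = (Matrix.of fun i j => stepCoord k p (v i) j).det *
        (Matrix.of fun i j => stepCoord k q (w i) j).det := fun M hM => by
    rw [← Matrix.det_submatrix_equiv_self finSumFinEquiv, hM, Matrix.det_fromBlocks_zero₁₂]
  rw [h]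
  · ring
  · ext i j
    rcases i with i | i <;> rcases j with j | j
    · simp only [Matrix.submatrix_apply, Matrix.fromBlocks_apply₁₁, Matrix.of_apply,
        finSumFinEquiv_apply_left, Fin.append_left, Function.comp_apply]
      have e := stepCoord_lmapDomain_congr (α := frontFace p q) (β := id)
        (a := Fin.castAdd q j) (b := j) (fun _ => Iff.rfl) (v i)
      rwa [Finsupp.lmapDomain_id] at e
    · simp only [Matrix.submatrix_apply, Matrix.fromBlocks_apply₁₂, Matrix.of_apply,
        finSumFinEquiv_apply_left, finSumFinEquiv_apply_right, Fin.append_left,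
        Function.comp_apply, Matrix.zero_apply]
      refine stepCoord_lmapDomain_eq_zero (fun a => not_lt.2 ?_) (v i)
      rw [Fin.le_def]
      simp [frontFace]
      omega
    · simp
    · simp only [Matrix.submatrix_apply, Matrix.fromBlocks_apply₂₂, Matrix.of_apply,
        finSumFinEquiv_apply_right, Fin.append_right, Function.comp_apply]
      have e := stepCoord_lmapDomain_congr (α := backFace p q) (β := id)
        (a := Fin.natAdd p j) (b := j) (fun a => by
          unfold backFace
          rw [Fin.lt_def, Fin.lt_def]
          split_ifs with h0
          · subst h0; simp
          · simp) (w i)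
      rwa [Finsupp.lmapDomain_id] at e

/-- The element `± (e_1 - e_0) ⋯ (e_p - e_{p-1})`. -/
def topVec (k : Type u) [Field k] (p : ℕ) : Lam k p :=
  (-1 : k) ^ p • ExteriorAlgebra.ιMulti k p fun i => stepVec k p (Pi.single i 1)

lemma topVec_mem (p : ℕ) : topVec k p ∈ lamGrading k p p :=
  Submodule.smul_mem _ _ (ιMulti_mem_lamGrading _)

lemma topForm_topVec (p : ℕ) : topForm k p (topVec k p) = 1 := by
  rw [topVec, map_smul, topForm_ιMulti]
  have h : (Matrix.of fun i j => stepCoord k p (stepVec k p (Pi.single i 1)) j) = 1 := by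
    ext i j
    rw [Matrix.of_apply, stepCoord_stepVec, Matrix.one_apply, Pi.single_apply]
    simp only [eq_comm]
  rw [h, Matrix.det_one, mul_one, smul_eq_mul, ← mul_pow]
  simp

lemma topForm_frontFace_topVec_mul (p q : ℕ) : topForm k (p + q)
    (lamMap k (frontFace p q) (topVec k p) * lamMap k (backFace p q) (topVec k q)) = 1 := by
  have h := topForm_frontFace_mul_backFace (fun i => stepVec k p (Pi.single i 1))
    (fun i => stepVec k q (Pi.single i 1))
  have h1 := topForm_topVec (k := k) p
  have h2 := topForm_topVec (k := k) q
  rw [topVec, map_smul] at h1 h2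
  rw [topVec, topVec, map_smul, map_smul, smul_mul_smul_comm, map_smul, h, ← smul_mul_smul_comm,
    h1, h2, one_mul]

/-! ## Cocycles with prescribed top coefficient -/

lemma tensProj_toCocycle {C : CDGA k} {n : ℕ} (x : tensLam C.toCGA n) :
    tensProj C.toCGA n (toCocycle C n x) = tensProj C.toCGA n x := by
  rw [tensProj_eq_ofCoords, tensProj_eq_ofCoords, coords_toCocycle]

lemma tensProj_tensAct {C : CGA k} {m n : ℕ} {α : Fin (m + 1) → Fin (n + 1)} (hα : α 0 = 0)
    (x : tensLam C m) : tensProj C n (tensAct C α x) = tensAct C α (tensProj C m x) := by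
  rw [tensAct_eq, tensAct_eq, tensProj, tensProj, tensLin_tensLin, tensLin_tensLin]
  congr 2
  refine LinearMap.ext fun l => ?_
  exact lamProj_lamMap hα l

/-- The cocycle with top coefficient `c` whose other coordinates vanish. -/
def topCocycle (C : CDGA k) (p : ℕ) : C.grading p →ₗ[k] cocycles C p :=
  (toCocycle C p ∘ₗ (GradedTensorProduct.of k C.grading (lamGrading k p)).toLinearMap ∘ₗ
    (TensorProduct.mk k C.carrier (Lam k p)).flip (topVec k p) ∘ₗ
      (C.grading p).subtype).codRestrict (Subalgebra.toSubmodule (cocycles C p))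
    (fun c => toCocycle_mem (tmul_mem_tensDegZero c.2 (topVec_mem p)))

lemma topCocycle_val {C : CDGA k} {p : ℕ} (c : C.grading p) : (topCocycle C p c).1
    = toCocycle C p (c.1 ᵍ⊗ₜ[k] topVec k p : tensLam C.toCGA p) := rfl

lemma topCoeff_tensAct_topCocycle {C : CDGA k} {p q : ℕ} {α : Fin (p + 1) → Fin (q + 1)}
    (hα : α 0 = 0) (c : C.grading p) :
    topCoeff C.toCGA q (tensAct C.toCGA α (topCocycle C p c).1)
      = topForm k q (lamMap k α (topVec k p)) • c.1 := by
  rw [topCocycle_val, topCoeff_tensAct_toCocycle hα, tensMap_tmul, topCoeff_tmul]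
  rfl

lemma topCoeff_topCocycle {C : CDGA k} {p : ℕ} (c : C.grading p) :
    topCoeff C.toCGA p (topCocycle C p c).1 = c := by
  have h := topCoeff_tensAct_topCocycle (α := id) rfl c
  rw [tensAct_id, lamMap, Finsupp.lmapDomain_id, ExteriorAlgebra.map_id] at h
  refine h.trans ?_
  rw [AlgHom.id_apply, topForm_topVec, one_smul]

/-- Only projections matter for the top coefficient, so the cocycles may be replaced by c and c'
tensored with the pushed top vectors. Moving c' past the vector of degree -p costs (-1)^(pq), and
the product of the vectors has top form 1. -/
lemma topCoeff_frontFace_mul_backFace {C : CDGA k} {p q : ℕ} (c : C.grading p)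
    (c' : C.grading q) : topCoeff C.toCGA (p + q)
      (tensAct C.toCGA (frontFace p q) (topCocycle C p c).1 *
        tensAct C.toCGA (backFace p q) (topCocycle C q c').1)
      = (-1 : k) ^ (p * q) • (c.1 * c'.1) := by
  have h1 : ∀ {m n : ℕ} {α : Fin (m + 1) → Fin (n + 1)}, α 0 = 0 → ∀ c : C.grading m,
      tensProj C.toCGA n (tensAct C.toCGA α (topCocycle C m c).1)
        = tensProj C.toCGA n (c.1 ᵍ⊗ₜ[k] lamMap k α (topVec k m) : tensLam C.toCGA n) := by
    intro m n α hα c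
    rw [tensProj_tensAct hα, topCocycle_val, tensProj_toCocycle, ← tensProj_tensAct hα,
      tensMap_tmul]
    rfl
  have hp := lamMap_mem (frontFace p q) (topVec_mem (k := k) p)
  have hq := lamMap_mem (backFace p q) (topVec_mem (k := k) q)
  rw [← topCoeff_tensProj, tensProj_mul (NormHom.tensAct_cocycle_mem _ _).1
    (NormHom.tensAct_cocycle_mem _ _).1, h1 (frontFace_zero p q), h1 (backFace_zero p q),
    ← tensProj_mul (tmul_mem_tensDegZero c.2 hp) (tmul_mem_tensDegZero c'.2 hq),
    topCoeff_tensProj, tmul_mul_tmul C.toCGA _ _ hp c'.2, map_smul, topCoeff_tmul,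
    topForm_frontFace_topVec_mul, one_smul]

/-- A map that identifies i and i + 1 equals itself precomposed with merge i, hence factors through
the codegeneracy s^i. -/
lemma map_eq_zero_of_mem_normSub {V : AlmostCosimplicialObject (ModuleCat.{u} k)} {p q : ℕ}
    {x : V.obj (mk (p + 1))} (hx : x ∈ normSub V (p + 1)) (f : mk (p + 1) ⟶ mk q)
    (i : Fin (p + 1)) (h : fn f i.succ = fn f i.castSucc) : (V.map f).hom x = 0 := by
  have e : f = merge i ≫ f := hom_ext fun j => by
    change _ = fn f (fn (merge i) j)
    rw [fn_merge]
    split_ifs with hj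
    · rw [hj, h]
    · rfl
  obtain ⟨g, hg⟩ := merge_factors i
  rw [hg, Category.assoc] at e
  rw [e, map_comp_apply, mem_normSub_succ.1 hx, map_zero]

lemma coords_univ_eq_zero {C : CGA k} {p : ℕ} {x : tensLam C p} (h : topCoeff C p x = 0) :
    coords C x Finset.univ = 0 := by
  obtain ⟨J, hJ⟩ := exists_eq_countLT (id : Fin (p + 1) → Fin (p + 1)) monotone_id
    Function.surjective_id
  have hJ' : J = Finset.univ := by
    rw [← Finset.card_eq_iff_eq_univ, Fintype.card_fin]
    exact (congrArg Sigma.fst hJ).symm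
  -- Stated on dependent pairs, the vanishing can be rewritten along the identification of the
  -- identity with the surjection of the full set.
  let F (s : Σ q : ℕ, Fin (p + 1) → Fin (q + 1)) : Prop :=
    topCoeff C s.1 (tensAct C s.2 x) = 0
  have h0 : F ⟨p, id⟩ := (congrArg _ (tensAct_id C x)).trans h
  rw [hJ, hJ'] at h0
  exact h0

lemma countLT_succ_of_notMem {p : ℕ} {I : Finset (Fin p)} {i : Fin p} (hi : i ∉ I) :
    countLT I i.succ = countLT I i.castSucc :=
  Fin.ext (congrArg Finset.card (Finset.filter_congr fun a ha => by
    have hne : a ≠ i := fun h => hi (h ▸ ha)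
    rw [Fin.castSucc_lt_succ_iff, Fin.castSucc_lt_castSucc_iff]
    exact hne.le_iff_lt))

/-- A normalized cocycle with vanishing top coefficient vanishes. -/
lemma eq_zero_of_topCoeff_eq_zero {C : CDGA k} {p : ℕ} {x : cocycles C p}
    (hx : (x : (KPlusMod C).obj (mk p)) ∈ normSub (KPlusMod C) p)
    (h : topCoeff C.toCGA p x.1 = 0) : x = 0 := by
  refine Subtype.ext (cocycle_ext x.2.2 (0 : cocycles C p).2.2 fun I => ?_)
  have h0 : coords C.toCGA (0 : cocycles C p).1 I = 0 :=
    (congrArg _ (map_zero _)).trans (map_zero _)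
  refine Eq.trans ?_ h0.symm
  -- The coordinate at the full set is the top coefficient. Any other surjection collapses a step i
  -- ∉ I, so it kills normalized elements.
  by_cases hI : I = Finset.univ
  · rw [hI]
    exact coords_univ_eq_zero h
  · obtain ⟨i, hi⟩ : ∃ i, i ∉ I := by
      by_contra hc
      exact hI (Finset.eq_univ_iff_forall.2 (by simpa using hc))
    cases p with
    | zero => exact i.elim0
    | succ p =>
      have h1 := map_eq_zero_of_mem_normSub hx (surj I) i (countLT_succ_of_notMem hi)
      have h2 := congrArg (fun z : cocycles C I.card => topCoeff C.toCGA I.card z.1) h1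
      exact h2.trans (map_zero _)

/-! ## Multiplicative families on `K_alg` -/

/-- The top coefficients, as a multiplicative family on `K_alg(B)`. -/
def topHom (B : CDGA k) : NormHom (KPlusMod B) B.toCGA := kPlusEquiv _ B (𝟙 _)

/-- The action of a map of `Δ₊` on `K_alg(B)`. -/
def kAct {B : CDGA k} {m n : ℕ} (f : mk m ⟶ mk n) (x : cocycles B m) : cocycles B n :=
  cocyclesMap (𝟙 B : B ⟶ B) (fn f) x

section

variable {B C : CDGA k} (ψ : NormHom (KPlusMod B) C.toCGA)

/-- The components of a family on `K_alg(B)`. -/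
def famApp (p : ℕ) : cocycles B p →ₗ[k] C.carrier := ψ.toFun p

/-- Families see only the normalized part of x. Top coefficients are themselves such a family, so
the normalized part also has top coefficient 0 and therefore vanishes. -/
lemma famApp_eq_zero {p : ℕ} {x : cocycles B p} (h : topCoeff B.toCGA p x.1 = 0) :
    famApp ψ p x = 0 := by
  have h1 := (topHom B).apply_normProj (p := p) x
  have h2 : normProj (KPlusMod B) p x = (0 : cocycles B p) :=
    eq_zero_of_topCoeff_eq_zero (x := normProj (KPlusMod B) p x) (normProj_mem _) (h1.trans h)
  have h3 := ψ.apply_normProj (p := p) x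
  rw [h2] at h3
  exact h3.symm.trans (map_zero (famApp ψ p))

/-- The linear map underlying the map of algebras induced by a family on `K_alg(B)`. -/
def famLin : B.carrier →ₗ[k] C.carrier :=
  DirectSum.toModule k ℕ C.carrier (fun p => famApp ψ p ∘ₗ topCocycle B p) ∘ₗ
    (DirectSum.decomposeLinearEquiv B.grading).toLinearMap

lemma famLin_of_mem {p : ℕ} {c : B.carrier} (hc : c ∈ B.grading p) :
    famLin ψ c = famApp ψ p (topCocycle B p ⟨c, hc⟩) := by
  simp only [famLin, LinearMap.comp_apply, LinearEquiv.coe_coe,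
    DirectSum.decomposeLinearEquiv_apply]
  rw [DirectSum.decompose_of_mem _ hc, ← DirectSum.lof_eq_of k, DirectSum.toModule_lof]
  rfl

lemma famLin_mem {p : ℕ} {c : B.carrier} (hc : c ∈ B.grading p) :
    famLin ψ c ∈ C.grading p := by
  rw [famLin_of_mem ψ hc]
  exact ψ.mem p _

/-- A cocycle and the top cocycle with the same top coefficient differ by an element to which
`famApp_eq_zero` applies. -/
lemma famApp_eq {p : ℕ} (x : cocycles B p) :
    famApp ψ p x = famLin ψ (topCoeff B.toCGA p x.1) := by
  rw [famLin_of_mem ψ (topCoeff_mem x.2.1), ← sub_eq_zero, ← map_sub]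
  refine famApp_eq_zero ψ ?_
  refine (map_sub (topCoeff B.toCGA p) _ _).trans ?_
  rw [topCoeff_topCocycle, sub_self]

/-- Along each surjection both sides have as top coefficient the same scalar, the top form of the
pushed top vector, times `famLin` of c. -/
lemma cocycle_topCocycle {p : ℕ} (c : B.grading p) :
    ψ.cocycle p (topCocycle B p c) = topCocycle C p ⟨famLin ψ c.1, famLin_mem ψ c.2⟩ := by
  refine Subtype.ext (cocycle_ext (ψ.cocycle _ _).2.2 (topCocycle _ _ _).2.2 fun I => ?_)
  refine (ψ.topCoeff_cocycle _ (surj I)).trans ?_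
  refine Eq.trans ?_ (topCoeff_tensAct_topCocycle (countLT_zero I) _).symm
  refine (famApp_eq ψ (kAct (surj I) (topCocycle B p c))).trans ?_
  refine (congrArg _ (topCoeff_tensAct_topCocycle (countLT_zero I) c)).trans ?_
  exact map_smul _ _ _

end

section

variable {B C : CDGA k} {ψ : NormHom (KPlusMod B) C.toCGA}

/-- `K_alg(B)` as an almost cosimplicial algebra. -/
abbrev KPlusAlg (B : CDGA k) : AlmostCosimplicialCommAlg k :=
  (forgetCoface _).obj ((Kalg k).obj B)

lemma famLin_one (hψ : NormHom.IsMult (A := KPlusAlg B) ψ) : famLin ψ 1 = 1 := by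
  have e : ∀ D : CGA k, topCoeff D 0 1 = 1 := fun D => by
    have h := topCoeff_tmul D (n := 0) 1 1
    rw [← ExteriorAlgebra.ιMulti_zero_apply (R := k) (fun i : Fin 0 => i.elim0), topForm_ιMulti,
      pow_zero, Matrix.det_isEmpty, one_mul, one_smul, ExteriorAlgebra.ιMulti_zero_apply] at h
    exact h
  have h := hψ.map_one 0
  have h' := famApp_eq ψ (1 : cocycles B 0)
  refine Eq.trans ?_ ((h'.symm.trans h).trans (e C.toCGA))
  exact congrArg (famLin ψ) (e B.toCGA).symm

/-- In B and in C the product is, up to (-1)^(pq), the top coefficient of a front face times a back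
face. The family respects the faces, as they lie in Δ₊, and the products in K_alg. The sign is the
same on both sides and cancels. -/
lemma famLin_mul (hψ : NormHom.IsMult (A := KPlusAlg B) ψ) (x y : B.carrier) :
    famLin ψ (x * y) = famLin ψ x * famLin ψ y := by
  induction x using DirectSum.Decomposition.inductionOn B.grading with
  | zero => simp
  | add x x' h1 h2 => rw [add_mul, map_add, h1, h2, map_add, add_mul]
  | @homogeneous p x =>
    induction y using DirectSum.Decomposition.inductionOn B.grading with
    | zero => simp
    | add x x' h1 h2 => rw [mul_add, map_add, h1, h2, map_add, mul_add]
    | @homogeneous q y =>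
      let f : mk p ⟶ mk (p + q) :=
        homMk (frontFace p q) (frontFace_monotone p q) (frontFace_zero p q)
      let g : mk q ⟶ mk (p + q) :=
        homMk (backFace p q) (backFace_monotone p q) (backFace_zero p q)
      have h1 := (hψ.map_mul (p + q) (kAct f (topCocycle B p x))
        (kAct g (topCocycle B q y))).trans (NormHom.topCoeff_elt_mul ψ _ _)
      have h2 := famApp_eq ψ (kAct f (topCocycle B p x) * kAct g (topCocycle B q y))
      have h3 : (ψ.cocycle (p + q) (kAct f (topCocycle B p x))
            * ψ.cocycle (p + q) (kAct g (topCocycle B q y))).1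
          = tensAct C.toCGA (frontFace p q)
              (topCocycle C p ⟨famLin ψ x.1, famLin_mem ψ x.2⟩).1 *
            tensAct C.toCGA (backFace p q)
              (topCocycle C q ⟨famLin ψ y.1, famLin_mem ψ y.2⟩).1 := by
        rw [← cocycle_topCocycle, ← cocycle_topCocycle]
        exact congrArg₂ (· * ·) (ψ.cocycle_map f (topCocycle B p x))
          (ψ.cocycle_map g (topCocycle B q y))
      have h4 := (congrArg (famLin ψ) (topCoeff_frontFace_mul_backFace x y)).symm.trans
        (h2.symm.trans (h1.trans ((congrArg (topCoeff C.toCGA (p + q)) h3).trans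
          (topCoeff_frontFace_mul_backFace _ _))))
      rw [map_smul] at h4
      have e : (-1 : k) ^ (p * q) * (-1 : k) ^ (p * q) = 1 := by rw [← mul_pow]; simp
      have h5 := congrArg ((-1 : k) ^ (p * q) • ·) h4
      simpa only [smul_smul, e, one_smul] using h5

/-- The map of graded commutative algebras induced by a multiplicative family on `K_alg(B)`. -/
def famHom (hψ : NormHom.IsMult (A := KPlusAlg B) ψ) : B.toCGA ⟶ C.toCGA :=
  ⟨AlgHom.ofLinearMap (famLin ψ) (famLin_one hψ) (famLin_mul hψ), fun h => famLin_mem ψ h⟩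

lemma topHom_map_famHom (hψ : NormHom.IsMult (A := KPlusAlg B) ψ) :
    (topHom B).map (famHom hψ) = ψ :=
  NormHom.ext (funext fun _ => LinearMap.ext fun x => (famApp_eq ψ x).symm)

lemma topHom_map_injective {D : CGA k} {h h' : B.toCGA ⟶ D}
    (e : (topHom B).map h = (topHom B).map h') : h = h' := by
  refine CGA.Hom.ext (AlgHom.ext fun x => ?_)
  induction x using DirectSum.Decomposition.inductionOn B.grading with
  | zero => simp
  | add x x' h1 h2 => rw [map_add, h1, h2, map_add]
  | @homogeneous p x =>
    have h1 : h.toAlgHom (topCoeff B.toCGA p (topCocycle B p x).1)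
        = h'.toAlgHom (topCoeff B.toCGA p (topCocycle B p x).1) :=
      congrArg (fun φ => NormHom.toFun φ p (topCocycle B p x)) e
    rwa [topCoeff_topCocycle] at h1

/-- The differential of x is ± the top coefficient of d^0 of its top cocycle, and compatibility says
that ψ turns d^0 into the differential of C with the same sign. -/
lemma famLin_d (hc : NormHom.Compat (V := KMod B) ψ) (x : B.carrier) :
    famLin ψ (B.d x) = C.d (famLin ψ x) := by
  induction x using DirectSum.Decomposition.inductionOn B.grading with
  | zero => simp
  | add x x' h1 h2 => rw [map_add, map_add, h1, h2, map_add, map_add]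
  | @homogeneous p x =>
    have h1 := hc.d_apply (p := p) (topCocycle B p x)
    have h2 := famApp_eq ψ (topCocycle B p x)
    have h3 := famApp_eq ψ (p := p + 1) (fullAct (KMod B) (SimplexCategory.δ 0) (topCocycle B p x))
    have h4 : B.d x = _ := (congrArg B.d (topCoeff_topCocycle x).symm).trans
      (d_topCoeff (topCocycle B p x))
    rw [topCoeff_topCocycle] at h2
    rw [h4, map_smul, ← h2]
    exact Eq.trans (congrArg _ h3.symm) h1.symm

end

/-! ## `K_alg` and `K_alg⁺` are fully faithful -/

lemma kPlusAlgEquiv_map {B C : CDGA k} (h : B ⟶ C) :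
    (kPlusAlgEquiv (KPlusAlg B) C ((forgetCoface _).map ((Kalg k).map h))).1
      = (topHom B).map h.toHom :=
  kPlusEquiv_comp (𝟙 (KPlusMod B)) h

instance : (Kalg k).Faithful where
  map_injective {B C} h h' e := by
    have h1 := kPlusAlgEquiv_map h
    rw [e, kPlusAlgEquiv_map] at h1
    exact CDGA.Hom.ext (congrArg CGA.Hom.toAlgHom (topHom_map_injective h1.symm))

/-- The family of F is compatible and multiplicative, so it is the family of top coefficients
followed by a cdga map. That map is the preimage of F. -/
instance : (Kalg k).Full where
  map_surjective {B C} F := by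
    have hψ := (kAlgEquiv _ C F).2
    refine ⟨⟨famHom hψ.2, famLin_d hψ.1⟩, ?_⟩
    refine (kAlgEquiv _ C).injective (Subtype.ext ?_)
    exact (kPlusAlgEquiv_map (B := B) _).trans (topHom_map_famHom hψ.2)

instance : (KalgPlus k).Faithful where
  map_injective {B C} h h' e := by
    have h1 := kPlusAlgEquiv_map ((zeroDiff k).map h)
    have h2 := kPlusAlgEquiv_map ((zeroDiff k).map h')
    have h3 := congrArg (fun F => (kPlusAlgEquiv _ ((zeroDiff k).obj C) F).1) e
    exact topHom_map_injective (B := (zeroDiff k).obj B) (h1.symm.trans (h3.trans h2))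

instance : (KalgPlus k).Full where
  map_surjective {B C} F := by
    have hψ := (kPlusAlgEquiv (KPlusAlg ((zeroDiff k).obj B)) ((zeroDiff k).obj C) F).2
    refine ⟨famHom hψ, ?_⟩
    refine (kPlusAlgEquiv (KPlusAlg ((zeroDiff k).obj B)) ((zeroDiff k).obj C)).injective
      (Subtype.ext ?_)
    exact (kPlusAlgEquiv_map ((zeroDiff k).map (famHom hψ))).trans (topHom_map_famHom hψ)

end DoldKan

end

theorem mainTheorem10 (k : Type u) [Field k] [CharZero k] :
    ∃ (D : DoldKan.CosimplicialCommAlg k ⥤ DoldKan.CDGA k)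
      (DPlus : DoldKan.AlmostCosimplicialCommAlg k ⥤ DoldKan.CGA k)
      (adj : D ⊣ DoldKan.Kalg k) (adjPlus : DPlus ⊣ DoldKan.KalgPlus k),
      Nonempty (DoldKan.symCosimplicial k ⋙ D ≅
        DoldKan.normalizedCochains k ⋙ DoldKan.symCDGA k) ∧
      Nonempty (DoldKan.symAlmostCosimplicial k ⋙ DPlus ≅
        DoldKan.normalizedCochainsPlus k ⋙ DoldKan.symCGA k) ∧
      Nonempty (D ⋙ DoldKan.forgetDiff k ≅
        DoldKan.forgetCoface (CommAlgCat.{u} k) ⋙ DPlus) ∧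
      IsIso adj.counit ∧ IsIso adjPlus.counit :=
  ⟨DoldKan.dFunctor k, DoldKan.dPlus k, DoldKan.dAdj k, DoldKan.dPlusAdj k,
    ⟨DoldKan.symIso k⟩, ⟨DoldKan.symPlusIso k⟩, ⟨DoldKan.dForgetIso k⟩,
    -- The counit of an adjunction is invertible when the right adjoint is full and faithful.
    inferInstance, inferInstance⟩
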